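/- Let $M$ be a compact complex manifold with $n=\dim_{\mathbb C}M$ and canonical bundle $K_M=\Lambda^nT^*M$. Let $$H^{1,1}_{\mathrm{BC}}(M,\mathbb R)=\frac{\{d\text{-closed smooth real }(1,1)\text{-forms on }M\}}{\{\sqrt{-1}\,\partial\bar\partial\psi:\ \psi\in C^\infty(M,\mathbb R)\}}.$$ For a holomorphic line bundle $L\to M$ let $c_1^{\mathrm{BC}}(L)\in H^{1,1}_{\mathrm{BC}}(M,\mathbb R)$ be the class of the curvature form $R_h=-\sqrt{-1}\,\partial\bar\partial\log h$ of any smooth Hermitian metric $h$ on the fibers of $L$ (locally, $h$ stands for $|s|_h^2$ with $s$ a local holomorphic frame of $L$); this does not depend on $h$. Put $c_1^{\mathrm{BC}}(M)=c_1^{\mathrm{BC}}(K_M^*)$. The Chern–Ricci form of a Hermitian metric $g$ on $M$ with fundamental form $\omega$ is given in local holomorphic coordinates by $\mathrm{Ric}(\omega)=-\sqrt{-1}\,\partial\bar\partial\log\det(g_{j\bar k})$. **Proposition 1.1.** The following are equivalent: 1. $c_1^{\mathrm{BC}}(M)=0$ in $H^{1,1}_{\mathrm{BC}}(M,\mathbb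 R)$; 2. there exists a Hermitian metric $\omega$ on $M$ with $\mathrm{Ric}(\omega)=0$; 3. there exists a Hermitian metric on the fibers of $K_M$ with vanishing curvature; 4. there exists a Hermitian metric $\omega$ on $M$ whose Chern connection has restricted holonomy contained in $SU(n)$, that is, at every point $x\in M$ the parallel transport along every null-homotopic piecewise smooth loop based at $x$ lies in the special unitary group of $T_xM$ with its Hermitian inner product. Moreover, if $K_M$ is holomorphically torsion, i.e. if there exists an integer $\ell\ge 1$ such that $K_M^{\ell}\cong\mathcal O_M$ as holomorphic line bundles, then $c_1^{\mathrm{BC}}(M)=0$. -/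

import Mathlib

open scoped Manifold ContDiff

namespace BottChern

open Set Bundle Manifold
open scoped Topology ComplexConjugate

noncomputable section

set_option linter.unusedSectionVars false

/-- The model space `ℂⁿ` of an `n`-dimensional complex manifold. -/
abbrev Cn (n : ℕ) : Type := EuclideanSpace ℂ (Fin n)

section Local
variable {n : ℕ}

/-- Multiplication by `i`, as a real-linear map. -/
def mulI (n : ℕ) : Cn n →L[ℝ] Cn n :=
  (Complex.I • ContinuousLinearMap.id ℂ (Cn n)).restrictScalars ℝ

/-- The real 1-form `d^c u = i (∂̄ - ∂) u` of a real function `u` on an open part of `ℂⁿ`. Since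
`∂̄u(v) = (du(v) + i du(iv)) / 2` and `∂u(v) = (du(v) - i du(iv)) / 2`, it is `v ↦ -du(iv)`. -/
def dc (u : Cn n → ℝ) (z : Cn n) : Cn n [⋀^Fin 1]→L[ℝ] ℝ :=
  ContinuousAlternatingMap.ofSubsingleton ℝ (Cn n) ℝ (0 : Fin 1)
    (-(fderiv ℝ u z).comp (mulI n))

/-- The real 2-form `i ∂∂̄u = (1/2) d d^c u` of a real function `u` on an open part of `ℂⁿ`; in
coordinates it is `i ∑_{j,k} (∂²u / ∂z_j ∂z̄_k) dz_j ∧ dz̄_k`. -/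
def iddbarC (u : Cn n → ℝ) (z : Cn n) : Cn n [⋀^Fin 2]→L[ℝ] ℝ :=
  (1 / 2 : ℝ) • extDeriv (dc u) z

@[simp] lemma mulI_apply (v : Cn n) : mulI n v = Complex.I • v := rfl

lemma dc_apply (u : Cn n → ℝ) (z : Cn n) (v : Fin 1 → Cn n) :
    dc u z v = -fderiv ℝ u z (Complex.I • v 0) := rfl

/-- The linear map sending `du` to `d^c u`. -/
def dcL (n : ℕ) : (Cn n →L[ℝ] ℝ) →L[ℝ] (Cn n [⋀^Fin 1]→L[ℝ] ℝ) :=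
  (ContinuousAlternatingMap.ofSubsingletonLIE (𝕜 := ℝ) (E := Cn n) (F := ℝ)
    (0 : Fin 1)).toContinuousLinearEquiv.toContinuousLinearMap.comp
    (-(ContinuousLinearMap.compL ℝ (Cn n) (Cn n) ℝ).flip (mulI n))

lemma dc_eq (u : Cn n → ℝ) : dc u = fun z => dcL n (fderiv ℝ u z) := by
  ext z v
  simp [dc_apply, dcL]

lemma eventually_differentiableAt {u : Cn n → ℝ} {z : Cn n} (h : ContDiffAt ℝ ∞ u z) :
    ∀ᶠ w in 𝓝 z, DifferentiableAt ℝ u w := by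
  have h2 : ContDiffAt ℝ 2 u z := h.of_le ENat.LEInfty.out
  filter_upwards [h2.eventually (by simp)] with w hw
  exact hw.differentiableAt (by simp)

lemma dc_congr {u v : Cn n → ℝ} {z : Cn n} (h : u =ᶠ[𝓝 z] v) : dc u =ᶠ[𝓝 z] dc v := by
  rw [dc_eq, dc_eq]
  filter_upwards [h.fderiv (𝕜 := ℝ)] with w hw
  rw [hw]

lemma iddbarC_congr {u v : Cn n → ℝ} {z : Cn n} (h : u =ᶠ[𝓝 z] v) :
    iddbarC u z = iddbarC v z := by
  rw [iddbarC, iddbarC, (dc_congr h).extDeriv_eq]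

lemma contDiffAt_dc {u : Cn n → ℝ} {z : Cn n} (h : ContDiffAt ℝ ∞ u z) :
    ContDiffAt ℝ ∞ (dc u) z := by
  rw [dc_eq]
  exact (dcL n).contDiff.contDiffAt.comp z (h.fderiv_right (m := ∞) (by simp))

lemma contDiffAt_iddbarC {u : Cn n → ℝ} {z : Cn n} (h : ContDiffAt ℝ ∞ u z) :
    ContDiffAt ℝ ∞ (iddbarC u) z := by
  have h1 := (contDiffAt_dc h).fderiv_right (m := ∞) (by simp)
  let A := ContinuousAlternatingMap.alternatizeUncurryFinCLM (n := 1) ℝ (Cn n) ℝ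
  have h2 : ContDiffAt ℝ ∞ (A ∘ fderiv ℝ (dc u)) z := A.contDiff.contDiffAt.comp z h1
  exact (contDiffAt_const (c := (1 / 2 : ℝ))).smul h2

lemma extDeriv_iddbarC {u : Cn n → ℝ} {z : Cn n} (h : ContDiffAt ℝ ∞ u z) :
    extDeriv (iddbarC u) z = 0 := by
  have : extDeriv (iddbarC u) z = (1 / 2 : ℝ) • extDeriv (extDeriv (dc u)) z :=
    extDeriv_fun_smul _ _
  rw [this, extDeriv_extDeriv_apply (contDiffAt_dc h) (by simpa using ENat.LEInfty.out), smul_zero]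

lemma iddbarC_apply {u : Cn n → ℝ} {z : Cn n} (h : ContDiffAt ℝ ∞ u z) (v w : Cn n) :
    iddbarC u z ![v, w] = (1 / 2 : ℝ) *
      (fderiv ℝ (fderiv ℝ u) z w (Complex.I • v) - fderiv ℝ (fderiv ℝ u) z v (Complex.I • w)) := by
  have h1 := (h.fderiv_right (m := ∞) (by simp)).differentiableAt (by simp)
  have h2 : fderiv ℝ (dc u) z = (dcL n).comp (fderiv ℝ (fderiv ℝ u) z) := by
    rw [dc_eq]
    exact ((dcL n).hasFDerivAt.comp z h1.hasFDerivAt).fderiv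
  rw [iddbarC, extDeriv, h2]
  have hr : Fin.removeNth 1 ![v, w] 0 = v := rfl
  simp [ContinuousAlternatingMap.alternatizeUncurryFin_apply, Fin.sum_univ_succ, dcL, hr]
  ring

lemma iddbarC_mulI {u : Cn n → ℝ} {z : Cn n} (h : ContDiffAt ℝ ∞ u z) :
    (iddbarC u z).compContinuousLinearMap (mulI n) = iddbarC u z := by
  ext v
  have hs : IsSymmSndFDerivAt ℝ u z := h.isSymmSndFDerivAt (by simpa using ENat.LEInfty.out)
  have hv : v = ![v 0, v 1] := by ext i; fin_cases i <;> rfl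
  rw [hv, ContinuousAlternatingMap.compContinuousLinearMap_apply]
  have : (⇑(mulI n) ∘ ![v 0, v 1]) = ![Complex.I • v 0, Complex.I • v 1] := by
    ext i; fin_cases i <;> rfl
  rw [this, iddbarC_apply h, iddbarC_apply h]
  simp only [smul_smul, Complex.I_mul_I, neg_smul, one_smul, map_neg]
  rw [hs.eq (Complex.I • v 1) (v 0), hs.eq (Complex.I • v 0) (v 1)]
  ring

lemma iddbarC_add {u v : Cn n → ℝ} {z : Cn n} (hu : ContDiffAt ℝ ∞ u z)
    (hv : ContDiffAt ℝ ∞ v z) : iddbarC (u + v) z = iddbarC u z + iddbarC v z := by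
  have : dc (u + v) =ᶠ[𝓝 z] dc u + dc v := by
    filter_upwards [eventually_differentiableAt hu, eventually_differentiableAt hv] with w h1 h2
    simp only [dc_eq, Pi.add_apply]
    rw [fderiv_add h1 h2, map_add]
  rw [iddbarC, this.extDeriv_eq, extDeriv_add ((contDiffAt_dc hu).differentiableAt (by simp))
    ((contDiffAt_dc hv).differentiableAt (by simp)), smul_add]
  rfl

lemma iddbarC_smul (c : ℝ) {u : Cn n → ℝ} {z : Cn n} (hu : ContDiffAt ℝ ∞ u z) :
    iddbarC (c • u) z = c • iddbarC u z := by
  have : dc (c • u) =ᶠ[𝓝 z] c • dc u := by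
    filter_upwards [eventually_differentiableAt hu] with w h1
    simp only [dc_eq, Pi.smul_apply]
    rw [fderiv_const_smul h1, map_smul]
  rw [iddbarC, this.extDeriv_eq, extDeriv_smul, iddbarC, smul_comm]

/-- `i ∂∂̄` commutes with pullback along holomorphic maps. -/
lemma iddbarC_comp {u : Cn n → ℝ} {f : Cn n → Cn n} {z : Cn n}
    (hu : ContDiffAt ℝ ∞ u (f z)) (hf : ContDiffAt ℂ ω f z) :
    iddbarC (u ∘ f) z = (iddbarC u (f z)).compContinuousLinearMap (fderiv ℝ f z) := by
  have hf' : ContDiffAt ℝ ω f z := hf.restrict_scalars ℝ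
  have : dc (u ∘ f) =ᶠ[𝓝 z] fun w => (dc u (f w)).compContinuousLinearMap (fderiv ℝ f w) := by
    have h1 := hf'.continuousAt.eventually (eventually_differentiableAt hu)
    filter_upwards [h1, hf.eventually (by simp)] with w h1 h2
    have h3 := h2.differentiableAt (by simp)
    have h4 := (h2.restrict_scalars ℝ).differentiableAt (n := ω) (by simp)
    ext v
    rw [dc_apply, fderiv_comp w h1 h4,
      ContinuousAlternatingMap.compContinuousLinearMap_apply, dc_apply]
    simp only [ContinuousLinearMap.comp_apply, Function.comp_apply]
    rw [h3.fderiv_restrictScalars ℝ]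
    simp
  rw [iddbarC, this.extDeriv_eq, extDeriv_pullback ((contDiffAt_dc hu).differentiableAt (by simp))
    hf' (by simp)]
  rfl

/-- `log |f|²` is pluriharmonic for a non-vanishing holomorphic function `f`. -/
lemma iddbarC_log_normSq {f : Cn n → ℂ} {z : Cn n} (hf : ContDiffAt ℂ ω f z) (h0 : f z ≠ 0) :
    iddbarC (fun w => Real.log (Complex.normSq (f w))) z = 0 := by
  -- near `z` we have `log |f|² = 2 Re (log (f / f z)) + const`
  set F : Cn n → ℂ := fun w => Complex.log (f w / f z) with hF
  have hs : f z / f z ∈ Complex.slitPlane := by simp [h0]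
  have hFa : ContDiffAt ℂ ω F z := 
    ContDiffAt.comp (g := Complex.log) (f := fun w => f w / f z) z (Complex.contDiffAt_log hs)
      (hf.div_const (f z))
  have hev : (fun w => Real.log (Complex.normSq (f w))) =ᶠ[𝓝 z]
      fun w => 2 * (F w).re + Real.log (Complex.normSq (f z)) := by
    filter_upwards [hf.continuousAt.eventually_ne h0] with w hw
    have h1 : Complex.normSq (f w) ≠ 0 := by simpa using hw
    have h2 : Complex.normSq (f z) ≠ 0 := by simpa using h0
    simp only [hF, Complex.log_re]
    rw [norm_div, Real.log_div (by simpa using hw) (by simpa using h0), Complex.normSq_eq_norm_sq,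
      Complex.normSq_eq_norm_sq, Real.log_pow, Real.log_pow]
    push_cast; ring
  rw [iddbarC_congr hev]
  have hdc : dc (fun w => 2 * (F w).re + Real.log (Complex.normSq (f z))) =ᶠ[𝓝 z]
      extDeriv (fun w => ContinuousAlternatingMap.constOfIsEmpty ℝ (Cn n) (Fin 0)
        (2 * (F w).im)) := by
    filter_upwards [hFa.eventually (by simp)] with w h2
    have h3 := (h2.differentiableAt (by simp)).hasFDerivAt
    have h4 := h3.restrictScalars ℝ
    have hre := ((Complex.reCLM.hasFDerivAt.comp w h4).const_mul 2).add_const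
      (Real.log (Complex.normSq (f z)))
    have him := (Complex.imCLM.hasFDerivAt.comp w h4).const_mul 2
    rw [extDeriv_constOfIsEmpty]
    ext v
    have e1 := hre.fderiv
    have e2 := him.fderiv
    simp only [Function.comp_def, Complex.reCLM_apply, Complex.imCLM_apply] at e1 e2
    rw [dc_apply, e1, e2]
    simp
  rw [iddbarC, hdc.extDeriv_eq, extDeriv_extDeriv_apply (r := ω) _ (by simp), smul_zero]
  have h5 : ContDiffAt ℝ ω (fun w => 2 * (F w).im) z :=
    contDiffAt_const.mul (Complex.imCLM.contDiff.contDiffAt.comp z (hFa.restrict_scalars ℝ))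
  exact (ContinuousAlternatingMap.constOfIsEmptyLIE (𝕜 := ℝ) (E := Cn n) (F := ℝ)
    (ι := Fin 0)).toContinuousLinearEquiv.contDiff.contDiffAt.comp z h5

end Local

section Forms
variable (n : ℕ) (M : Type*) [TopologicalSpace M] [ChartedSpace (Cn n) M]

/-- Real 2-forms on `M` (no regularity required). The complex manifold `M` is viewed as a real
manifold through the same charts, so its real tangent space at `x` is
`TangentSpace 𝓘(ℝ, Cn n) x`. -/
def TwoForm : Type _ := Π x : M, TangentSpace 𝓘(ℝ, Cn n) x [⋀^Fin 2]→L[ℝ] ℝ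

instance : AddCommGroup (TwoForm n M) :=
  inferInstanceAs (AddCommGroup (Π x : M, TangentSpace 𝓘(ℝ, Cn n) x [⋀^Fin 2]→L[ℝ] ℝ))

instance : Module ℝ (TwoForm n M) :=
  inferInstanceAs (Module ℝ (Π x : M, TangentSpace 𝓘(ℝ, Cn n) x [⋀^Fin 2]→L[ℝ] ℝ))

variable {n M}

/-- The coordinate expression of a 2-form in a chart `φ`: its pullback under `φ⁻¹`. -/
def TwoForm.inChart (ρ : TwoForm n M) (φ : OpenPartialHomeomorph M (Cn n)) (z : Cn n) :
    Cn n [⋀^Fin 2]→L[ℝ] ℝ :=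
  (ρ (φ.symm z)).compContinuousLinearMap (mfderiv 𝓘(ℝ, Cn n) 𝓘(ℝ, Cn n) φ.symm z)

/-- The almost complex structure of the tangent spaces. The tangent space at `x` is a copy of `ℂⁿ`,
identified by the preferred holomorphic chart at `x`. -/
def almostComplex (x : M) : TangentSpace 𝓘(ℝ, Cn n) x →L[ℝ] TangentSpace 𝓘(ℝ, Cn n) x := mulI n

variable (n M)

/-- The real vector space of smooth `d`-closed real `(1,1)`-forms. A real 2-form `ρ` is of type
`(1,1)` iff `ρ(Jv, Jw) = ρ(v, w)`. -/
def closedReal11Forms : Submodule ℝ (TwoForm n M) where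
  carrier := {ρ |
    (∀ φ ∈ atlas (Cn n) M, ContDiffOn ℝ ∞ (ρ.inChart φ) φ.target) ∧
    (∀ φ ∈ atlas (Cn n) M, ∀ z ∈ φ.target, extDeriv (ρ.inChart φ) z = 0) ∧
    (∀ x, (ρ x).compContinuousLinearMap (almostComplex x) = ρ x)}
  zero_mem' := by
    refine ⟨fun φ _ => ?_, fun φ _ z _ => ?_, fun x => ?_⟩
    · have : TwoForm.inChart (0 : TwoForm n M) φ = 0 := by ext; rfl
      rw [this]; exact contDiffOn_const
    · have : TwoForm.inChart (0 : TwoForm n M) φ = (0 : ℝ) • TwoForm.inChart 0 φ := by ext; simp; rfl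
      rw [this, extDeriv_smul, zero_smul]
    · ext; rfl
  add_mem' := by
    rintro a b ⟨ha1, ha2, ha3⟩ ⟨hb1, hb2, hb3⟩
    have : ∀ φ, TwoForm.inChart (a + b) φ = a.inChart φ + b.inChart φ := fun φ => by ext; rfl
    refine ⟨fun φ h => ?_, fun φ h z hz => ?_, fun x => ?_⟩
    · rw [this]; exact (ha1 φ h).add (hb1 φ h)
    · rw [this, extDeriv_add, ha2 φ h z hz, hb2 φ h z hz, add_zero]
      · exact ((ha1 φ h).contDiffAt (φ.open_target.mem_nhds hz)).differentiableAt (by simp)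
      · exact ((hb1 φ h).contDiffAt (φ.open_target.mem_nhds hz)).differentiableAt (by simp)
    · have h1 := ha3 x
      have h2 := hb3 x
      ext v
      have h1' := DFunLike.congr_fun h1 v
      have h2' := DFunLike.congr_fun h2 v
      exact congrArg₂ (· + ·) h1' h2'
  smul_mem' := by
    rintro c a ⟨ha1, ha2, ha3⟩
    have : ∀ φ, TwoForm.inChart (c • a) φ = c • a.inChart φ := fun φ => by ext; rfl
    refine ⟨fun φ h => ?_, fun φ h z hz => ?_, fun x => ?_⟩
    · rw [this]; exact contDiffOn_const.smul (ha1 φ h)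
    · rw [this, extDeriv_smul, ha2 φ h z hz, smul_zero]
    · ext v
      exact congrArg (c * ·) (DFunLike.congr_fun (ha3 x) v)

variable {M}
/-- The value at `x` of the real `(1,1)`-form `i ∂∂̄u` on `M`, computed in the preferred holomorphic
chart at `x`. It depends only on the germ of `u` at `x`, and it may be computed in any chart of the
atlas, see `iddbar_inChart`. -/
def iddbar (u : M → ℝ) (x : M) : TangentSpace 𝓘(ℝ, Cn n) x [⋀^Fin 2]→L[ℝ] ℝ :=
  (iddbarC (u ∘ (chartAt (Cn n) x).symm) (chartAt (Cn n) x x)).compContinuousLinearMap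
    (mfderiv 𝓘(ℝ, Cn n) 𝓘(ℝ, Cn n) (chartAt (Cn n) x) x)

variable {n}

lemma isManifold_real [IsManifold 𝓘(ℂ, Cn n) ω M] : IsManifold 𝓘(ℝ, Cn n) ω M := by
  apply isManifold_of_contDiffOn
  intro e e' he he'
  have := (mem_groupoid_of_pregroupoid.1
    (HasGroupoid.compatible (G := contDiffGroupoid ω 𝓘(ℂ, Cn n)) he he')).1
  exact this.restrict_scalars ℝ

variable [IsManifold 𝓘(ℂ, Cn n) ω M]

lemma contDiffAt_transition {φ ψ : OpenPartialHomeomorph M (Cn n)} (hφ : φ ∈ atlas (Cn n) M)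
    (hψ : ψ ∈ atlas (Cn n) M) {z : Cn n} (hz : z ∈ φ.target) (hz' : φ.symm z ∈ ψ.source) :
    ContDiffAt ℂ ω (ψ ∘ φ.symm) z := by
  have h1 := (mem_groupoid_of_pregroupoid.1
    (HasGroupoid.compatible (G := contDiffGroupoid ω 𝓘(ℂ, Cn n)) hφ hψ)).1
  have h3 : ContDiffOn ℂ ω (φ.symm.trans ψ) (φ.symm.trans ψ).source := by
    simpa [contDiffPregroupoid] using h1
  have h2 := h3.contDiffAt (x := z) (by
    apply IsOpen.mem_nhds
    · exact (φ.symm.trans ψ).open_source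
    · simp [hz, hz'])
  exact h2

lemma mdifferentiableAt_chart {φ : OpenPartialHomeomorph M (Cn n)} (hφ : φ ∈ atlas (Cn n) M)
    {x : M} (hx : x ∈ φ.source) : MDifferentiableAt 𝓘(ℝ, Cn n) 𝓘(ℝ, Cn n) φ x := by
  have := isManifold_real (n := n) (M := M)
  exact mdifferentiableAt_atlas hφ hx

lemma mdifferentiableAt_chart_symm {φ : OpenPartialHomeomorph M (Cn n)} (hφ : φ ∈ atlas (Cn n) M)
    {z : Cn n} (hz : z ∈ φ.target) : MDifferentiableAt 𝓘(ℝ, Cn n) 𝓘(ℝ, Cn n) φ.symm z := by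
  have := isManifold_real (n := n) (M := M)
  exact mdifferentiableAt_atlas_symm hφ hz

/-- Coordinate expressions of smooth functions are smooth. -/
lemma contDiffAt_of_contMDiffAt {u : M → ℝ} {φ : OpenPartialHomeomorph M (Cn n)}
    (hφ : φ ∈ atlas (Cn n) M) {z : Cn n} (hz : z ∈ φ.target)
    (hu : ContMDiffAt 𝓘(ℝ, Cn n) 𝓘(ℝ, ℝ) ∞ u (φ.symm z)) : ContDiffAt ℝ ∞ (u ∘ φ.symm) z := by
  have := isManifold_real (n := n) (M := M)
  rw [← contMDiffAt_iff_contDiffAt]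
  refine hu.comp z ?_
  exact (contMDiffOn_symm_of_mem_maximalAtlas (IsManifold.subset_maximalAtlas hφ)).contMDiffAt
    (φ.open_target.mem_nhds hz)

lemma iddbar_inChart {u : M → ℝ} {φ : OpenPartialHomeomorph M (Cn n)}
    (hφ : φ ∈ atlas (Cn n) M) {z : Cn n} (hz : z ∈ φ.target)
    (hu : ContMDiffAt 𝓘(ℝ, Cn n) 𝓘(ℝ, ℝ) ∞ u (φ.symm z)) :
    TwoForm.inChart (iddbar n u) φ z = iddbarC (u ∘ φ.symm) z := by
  set x := φ.symm z with hx
  set ψ := chartAt (Cn n) x with hψ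
  have hxψ : φ.symm z ∈ ψ.source := mem_chart_source (Cn n) x
  have hψa : ψ ∈ atlas (Cn n) M := chart_mem_atlas (Cn n) x
  have hev : u ∘ φ.symm =ᶠ[𝓝 z] (u ∘ ψ.symm) ∘ (ψ ∘ φ.symm) := by
    have h1 := (φ.continuousAt_symm hz).eventually (ψ.open_source.mem_nhds hxψ)
    filter_upwards [h1] with w hw
    simp [ψ.left_inv hw]
  have hψx : (ψ ∘ φ.symm) z = ψ x := rfl
  have hsm : ContDiffAt ℝ ∞ (u ∘ ψ.symm) ((ψ ∘ φ.symm) z) :=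
    contDiffAt_of_contMDiffAt hψa (ψ.map_source hxψ) (by
      rw [hψx, ψ.left_inv hxψ]; exact hu)
  rw [iddbarC_congr hev, iddbarC_comp hsm (contDiffAt_transition hφ hψa hz hxψ)]
  have hcomp := mfderiv_comp z (mdifferentiableAt_chart hψa hxψ)
    (mdifferentiableAt_chart_symm hφ hz)
  rw [mfderiv_eq_fderiv] at hcomp
  rw [hcomp]
  rfl

/-- A 2-form that is locally `i ∂∂̄` of smooth functions is a smooth closed real `(1,1)`-form. -/
lemma iddbar_mem {u : TwoForm n M}
    (h : ∀ x, ∃ v : M → ℝ, ∃ U ∈ 𝓝 x, ContMDiffOn 𝓘(ℝ, Cn n) 𝓘(ℝ, ℝ) ∞ v U ∧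
      ∀ y ∈ U, u y = iddbar n v y) : u ∈ closedReal11Forms n M := by
  have key : ∀ φ ∈ atlas (Cn n) M, ∀ z ∈ φ.target, ∃ w : Cn n → ℝ, ContDiffAt ℝ ∞ w z ∧
      u.inChart φ =ᶠ[𝓝 z] iddbarC w := by
    intro φ hφ z hz
    obtain ⟨v, U, hU, hv, hUv⟩ := h (φ.symm z)
    obtain ⟨U', hU'U, hU'o, hzU'⟩ := mem_nhds_iff.1 hU
    refine ⟨v ∘ φ.symm, contDiffAt_of_contMDiffAt hφ hz (hv.contMDiffAt hU), ?_⟩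
    filter_upwards [(φ.continuousAt_symm hz).eventually (hU'o.mem_nhds hzU'),
      φ.open_target.mem_nhds hz] with w hw hw'
    rw [← iddbar_inChart hφ hw' (hv.contMDiffAt (mem_nhds_iff.2 ⟨U', hU'U, hU'o, hw⟩))]
    simp only [TwoForm.inChart]
    rw [hUv _ (hU'U hw)]
  refine ⟨fun φ hφ z hz => ?_, fun φ hφ z hz => ?_, fun x => ?_⟩
  · obtain ⟨w, hw, he⟩ := key φ hφ z hz
    exact ((contDiffAt_iddbarC hw).congr_of_eventuallyEq he).contDiffWithinAt
  · obtain ⟨w, hw, he⟩ := key φ hφ z hz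
    rw [he.extDeriv_eq, extDeriv_iddbarC hw]
  · obtain ⟨v, U, hU, hv, hUv⟩ := h x
    rw [hUv x (mem_of_mem_nhds hU)]
    have hs := mem_chart_source (Cn n) x
    have h1 : ContDiffAt ℝ ∞ (v ∘ (chartAt (Cn n) x).symm) (chartAt (Cn n) x x) :=
      contDiffAt_of_contMDiffAt (chart_mem_atlas (Cn n) x) (mem_chart_target (Cn n) x) (by
        rw [(chartAt (Cn n) x).left_inv hs]; exact hv.contMDiffAt hU)
    have h2 := iddbarC_mulI h1
    have h3 : (mfderiv 𝓘(ℝ, Cn n) 𝓘(ℝ, Cn n) (chartAt (Cn n) x) x :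
      TangentSpace 𝓘(ℝ, Cn n) x →L[ℝ] Cn n) = ContinuousLinearMap.id ℝ (Cn n) := by
      have := isManifold_real (n := n) (M := M)
      have h4 := mfderiv_chartAt_eq_tangentCoordChange (I := 𝓘(ℝ, Cn n)) (x := x) (y := x)
        (mem_chart_source (Cn n) x)
      ext1 v
      have h5 := tangentCoordChange_self (I := 𝓘(ℝ, Cn n)) (x := x) (z := x) (v := v)
        (mem_extChartAt_source x)
      rw [← h4] at h5
      exact h5
    ext a
    have h4 := DFunLike.congr_fun h2 a
    simp only [iddbar]
    rw [h3]
    exact h4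

lemma iddbar_add {u v : M → ℝ} {x : M} (hu : ContMDiffAt 𝓘(ℝ, Cn n) 𝓘(ℝ, ℝ) ∞ u x)
    (hv : ContMDiffAt 𝓘(ℝ, Cn n) 𝓘(ℝ, ℝ) ∞ v x) :
    iddbar n (u + v) x = iddbar n u x + iddbar n v x := by
  have hs := mem_chart_source (Cn n) x
  have h1 := fun (w : M → ℝ) (hw : ContMDiffAt 𝓘(ℝ, Cn n) 𝓘(ℝ, ℝ) ∞ w x) =>
    contDiffAt_of_contMDiffAt (u := w) (chart_mem_atlas (Cn n) x) (mem_chart_target (Cn n) x)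
     (by rw [(chartAt (Cn n) x).left_inv hs]; exact hw)
  have := iddbarC_add (h1 u hu) (h1 v hv)
  ext a
  have h4 := DFunLike.congr_fun this
    (fun i => mfderiv 𝓘(ℝ, Cn n) 𝓘(ℝ, Cn n) (chartAt (Cn n) x) x (a i))
  exact h4

lemma iddbar_smul (c : ℝ) {u : M → ℝ} {x : M} (hu : ContMDiffAt 𝓘(ℝ, Cn n) 𝓘(ℝ, ℝ) ∞ u x) :
    iddbar n (c • u) x = c • iddbar n u x := by
  have hs := mem_chart_source (Cn n) x
  have h1 := contDiffAt_of_contMDiffAt (u := u) (chart_mem_atlas (Cn n) x) (mem_chart_target (Cn n) x)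
     (by rw [(chartAt (Cn n) x).left_inv hs]; exact hu)
  have := iddbarC_smul c h1
  ext a
  have h4 := DFunLike.congr_fun this
    (fun i => mfderiv 𝓘(ℝ, Cn n) 𝓘(ℝ, Cn n) (chartAt (Cn n) x) x (a i))
  exact h4

lemma iddbar_neg {u : M → ℝ} {x : M} (hu : ContMDiffAt 𝓘(ℝ, Cn n) 𝓘(ℝ, ℝ) ∞ u x) :
    iddbar n (-u) x = -iddbar n u x := by
  have h := iddbar_smul (-1) hu
  have h1 : (-1 : ℝ) • u = -u := by ext; simp
  rw [h1] at h
  rw [h]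
  ext a
  exact neg_one_mul _

variable (n M)
/-- The subspace of the forms `i ∂∂̄ψ` with `ψ ∈ C^∞(M, ℝ)`. -/
def ddbarExactForms : Submodule ℝ (closedReal11Forms n M) where
  carrier := {ρ | ∃ ψ : M → ℝ, ContMDiff 𝓘(ℝ, Cn n) 𝓘(ℝ, ℝ) ∞ ψ ∧ (ρ : TwoForm n M) = iddbar n ψ}
  zero_mem' := by
    refine ⟨0, contMDiff_const, ?_⟩
    funext x
    have := iddbar_smul (n := n) (x := x) 0 (u := (0 : M → ℝ)) contMDiffAt_const
    rw [zero_smul, zero_smul] at this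
    exact this.symm
  add_mem' := by
    rintro a b ⟨u, hu, hau⟩ ⟨v, hv, hbv⟩
    refine ⟨u + v, hu.add hv, ?_⟩
    funext x
    rw [iddbar_add hu.contMDiffAt hv.contMDiffAt]
    exact congrArg₂ (· + ·) (congrFun hau x) (congrFun hbv x)
  smul_mem' := by
    rintro c a ⟨u, hu, hau⟩
    refine ⟨c • u, (contMDiff_const (c := c)).mul hu, ?_⟩
    funext x
    rw [iddbar_smul c hu.contMDiffAt]
    exact congrArg (c • ·) (congrFun hau x)

/-- The real Bott–Chern cohomology group `H^{1,1}_{BC}(M, ℝ)`. -/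
abbrev H11BC : Type _ := closedReal11Forms n M ⧸ ddbarExactForms n M

end Forms

section Metrics

/-- A smooth Hermitian metric on the fibres of a complex vector bundle `V` over `M`: a positive
definite Hermitian form on each fibre (antilinear in its first argument, linear in its second) whose
coefficients in each of the local trivializations of the bundle are smooth functions. -/
structure HermitianMetric (n : ℕ) {M : Type*} [TopologicalSpace M] [ChartedSpace (Cn n) M]
    (F : Type*) [NormedAddCommGroup F] [NormedSpace ℂ F]
    (V : M → Type*) [TopologicalSpace (TotalSpace F V)] [∀ x, AddCommGroup (V x)]
    [∀ x, Module ℂ (V x)] [∀ x, TopologicalSpace (V x)] [FiberBundle F V] where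
  form : ∀ x, V x →ₗ⋆[ℂ] V x →ₗ[ℂ] ℂ
  conj_form : ∀ x v w, conj (form x w v) = form x v w
  pos : ∀ x v, v ≠ 0 → 0 < (form x v v).re
  smooth : ∀ (e : Trivialization F (π F V)) [MemTrivializationAtlas e] (a b : F),
    ContMDiffOn 𝓘(ℝ, Cn n) 𝓘(ℝ, ℂ) ∞ (fun x => form x (e.symm x a) (e.symm x b)) e.baseSet

variable {n : ℕ} {M : Type*} [TopologicalSpace M] [ChartedSpace (Cn n) M]

lemma contMDiffAt_restrictScalars {F : Type*} [NormedAddCommGroup F] [NormedSpace ℂ F]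
    [NormedSpace ℝ F] [IsScalarTower ℝ ℂ F] {f : M → F} {x : M} {k : ℕ∞ω}
    (h : ContMDiffAt 𝓘(ℂ, Cn n) 𝓘(ℂ, F) k f x) : ContMDiffAt 𝓘(ℝ, Cn n) 𝓘(ℝ, F) k f x := by
  rw [contMDiffAt_iff] at h ⊢
  exact ⟨h.1, h.2.restrict_scalars ℝ⟩

lemma iddbar_congr {u v : M → ℝ} {x : M} (h : u =ᶠ[𝓝 x] v) : iddbar n u x = iddbar n v x := by
  have : u ∘ (chartAt (Cn n) x).symm =ᶠ[𝓝 (chartAt (Cn n) x x)] v ∘ (chartAt (Cn n) x).symm := by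
    have hc := (chartAt (Cn n) x).continuousAt_symm (mem_chart_target (Cn n) x)
    rw [ContinuousAt, (chartAt (Cn n) x).left_inv (mem_chart_source (Cn n) x)] at hc
    exact hc.eventually h
  simp only [iddbar]
  rw [iddbarC_congr this]

variable [IsManifold 𝓘(ℂ, Cn n) ω M]

lemma iddbar_log_normSq {g : M → ℂ} {x : M} (hg : ContMDiffAt 𝓘(ℂ, Cn n) 𝓘(ℂ, ℂ) ω g x)
    (h0 : g x ≠ 0) : iddbar n (fun y => Real.log (Complex.normSq (g y))) x = 0 := by
  set φ := chartAt (Cn n) x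
  have hx : φ.symm (φ x) = x := φ.left_inv (mem_chart_source (Cn n) x)
  have h1 : ContDiffAt ℂ ω (g ∘ φ.symm) (φ x) := by
    rw [← contMDiffAt_iff_contDiffAt]
    refine ContMDiffAt.comp (φ x) (by rw [hx]; exact hg) ?_
    exact (contMDiffOn_symm_of_mem_maximalAtlas (IsManifold.subset_maximalAtlas
      (chart_mem_atlas (Cn n) x))).contMDiffAt
      (φ.open_target.mem_nhds (mem_chart_target (Cn n) x))
  have h2 := iddbarC_log_normSq h1 (by simpa [hx] using h0)
  have h3 : iddbar n (fun y => Real.log (Complex.normSq (g y))) x =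
      (iddbarC (fun w => Real.log (Complex.normSq ((g ∘ φ.symm) w))) (φ x)).compContinuousLinearMap
    (mfderiv 𝓘(ℝ, Cn n) 𝓘(ℝ, Cn n) φ x) := rfl
  rw [h3, h2]
  rfl

section Existence
variable [CompactSpace M] [T2Space M]
  {F : Type*} [NormedAddCommGroup F] [InnerProductSpace ℂ F]
  (V : M → Type*) [TopologicalSpace (TotalSpace F V)] [∀ x, AddCommGroup (V x)]
  [∀ x, Module ℂ (V x)] [∀ x, TopologicalSpace (V x)] [FiberBundle F V]
  [VectorBundle ℂ F V] [ContMDiffVectorBundle ω F V 𝓘(ℂ, Cn n)]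

/-- Hermitian metrics exist on holomorphic vector bundles over compact manifolds. -/
theorem HermitianMetric.nonempty : Nonempty (HermitianMetric n F V) := by
  have := isManifold_real (n := n) (M := M)
  obtain ⟨t, ht⟩ := CompactSpace.elim_nhds_subcover
    (fun x : M => (trivializationAt F V x).baseSet)
    (fun x => (trivializationAt F V x).open_baseSet.mem_nhds
      (FiberBundle.mem_baseSet_trivializationAt' x))
  obtain ⟨ρ, hρ⟩ := SmoothPartitionOfUnity.exists_isSubordinate 𝓘(ℝ, Cn n) (s := (univ : Set M))
    isClosed_univ (fun i : t => (trivializationAt F V (i : M)).baseSet)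
    (fun i => (trivializationAt F V (i : M)).open_baseSet)
    (by
      intro x _
      have hx : x ∈ ⋃ y ∈ t, (trivializationAt F V y).baseSet := by rw [ht]; trivial
      simp only [mem_iUnion] at hx ⊢
      obtain ⟨y, hy, hxy⟩ := hx
      exact ⟨⟨y, hy⟩, hxy⟩)
  let A : ∀ (i : t) (x : M), V x →ₗ[ℂ] F := fun i x =>
    ((trivializationAt F V (i : M)).continuousLinearMapAt ℂ x : V x →ₗ[ℂ] F)
  let B : ∀ (x : M), V x →ₗ⋆[ℂ] V x →ₗ[ℂ] ℂ := fun x =>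
    ∑ i : t, ((ρ i x : ℝ) : ℂ) • (((innerₛₗ ℂ).comp (A i x)).compl₂ (A i x))
  have hB : ∀ x v w, B x v w = ∑ i : t, ((ρ i x : ℝ) : ℂ) * inner ℂ (A i x v) (A i x w) := by
    intro x v w
    simp [B, LinearMap.sum_apply]
  refine ⟨⟨B, ?_, ?_, ?_⟩⟩
  · intro x v w
    simp only [hB, map_sum, map_mul, Complex.conj_ofReal, inner_conj_symm]
  · intro x v hv
    rw [hB, Complex.re_sum]
    have hsq : ∀ u : F, (inner ℂ u u).re = ‖u‖ ^ 2 := fun u => inner_self_eq_norm_sq (𝕜 := ℂ) u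
    have hnn : ∀ i : t, 0 ≤ (((ρ i x : ℝ) : ℂ) * inner ℂ (A i x v) (A i x v)).re := by
      intro i
      rw [Complex.re_ofReal_mul]
      rw [hsq]
      exact mul_nonneg (ρ.nonneg i x) (sq_nonneg _)
    obtain ⟨i, hi⟩ := ρ.exists_pos_of_mem (mem_univ x)
    refine Finset.sum_pos' (fun i _ => hnn i) ⟨i, Finset.mem_univ _, ?_⟩
    have hxb : x ∈ (trivializationAt F V (i : M)).baseSet :=
      hρ i (subset_tsupport _ (by simpa using hi.ne'))
    have hA : A i x v ≠ 0 := by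
      intro h0
      apply hv
      have := (trivializationAt F V (i : M)).symmL_continuousLinearMapAt (R := ℂ) hxb v
      rw [← this]
      have h1 : (trivializationAt F V (i : M)).continuousLinearMapAt ℂ x v = 0 := h0
      rw [h1, map_zero]
    rw [Complex.re_ofReal_mul, hsq]
    exact mul_pos hi (pow_pos (norm_pos_iff.2 hA) 2)
  · intro e he a b x hx
    refine ContMDiffAt.contMDiffWithinAt ?_
    have hfun : (fun y => B y (e.symm y a) (e.symm y b)) = fun y => ∑ᶠ i : t, ρ i y •
        inner ℂ (A i y (e.symm y a)) (A i y (e.symm y b)) := by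
      funext y
      rw [hB, finsum_eq_sum_of_fintype]
      simp
    rw [hfun]
    refine ρ.contMDiffAt_finsum fun i hi => ?_
    have hxi : x ∈ (trivializationAt F V (i : M)).baseSet := hρ i hi
    have hsm : ∀ c : F, ContMDiffAt 𝓘(ℝ, Cn n) 𝓘(ℝ, F) ∞ (fun y => A i y (e.symm y c)) x := by
      intro c
      have h1 : ContMDiffAt 𝓘(ℂ, Cn n) 𝓘(ℂ, F →L[ℂ] F) ω
          (fun y => (e.coordChangeL ℂ (trivializationAt F V (i : M)) y : F →L[ℂ] F)) x :=
        contMDiffAt_coordChangeL hx hxi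
      have h2 := (contMDiffAt_restrictScalars (h1.clm_apply
        (contMDiffAt_const (c := c)))).of_le (n := ω) (m := ∞) le_top
      refine h2.congr_of_eventuallyEq ?_
      filter_upwards [e.open_baseSet.mem_nhds hx,
        (trivializationAt F V (i : M)).open_baseSet.mem_nhds hxi] with y hy hyi
      have := e.coordChangeL_apply (R := ℂ) (trivializationAt F V (i : M)) ⟨hy, hyi⟩ c
      simp only [A]
      rw [ContinuousLinearMap.coe_coe, Trivialization.continuousLinearMapAt_apply,
        Trivialization.coe_linearMapAt_of_mem _ hyi]
      exact this.symm
    exact (contDiff_inner (𝕜 := ℂ) (E := F)).contDiffAt.contMDiffAt.comp x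
      ((hsm a).prodMk_space (hsm b))

end Existence

section LineBundle

variable {L : M → Type*} [TopologicalSpace (TotalSpace ℂ L)] [∀ x, AddCommGroup (L x)]
  [∀ x, Module ℂ (L x)] [∀ x, TopologicalSpace (L x)] [FiberBundle ℂ L]

/-- The squared length `|s|²_h` of the local frame `s` given by a local trivialization of the line
bundle `L`. -/
def HermitianMetric.weight (h : HermitianMetric n ℂ L) (e : Trivialization ℂ (π ℂ L)) (y : M) : ℝ :=
  (h.form y (e.symm y 1) (e.symm y 1)).re

/-- The value at `x` of the curvature form `R_h = -i ∂∂̄ log |s|²_h`, for the local holomorphic frame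
`s` of `L` given by the preferred trivialization at `x`. Every other local trivialization gives the
same form, see `HermitianMetric.curvature_eq`. -/
def HermitianMetric.curvature (h : HermitianMetric n ℂ L) (x : M) :
    TangentSpace 𝓘(ℝ, Cn n) x [⋀^Fin 2]→L[ℝ] ℝ :=
  -iddbar n (fun y => Real.log (h.weight (trivializationAt ℂ L x) y)) x

variable [VectorBundle ℂ ℂ L] [ContMDiffVectorBundle ω ℂ L 𝓘(ℂ, Cn n)]

variable (h h' : HermitianMetric n ℂ L) (e e' : Trivialization ℂ (π ℂ L))
  [MemTrivializationAtlas e] [MemTrivializationAtlas e']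

lemma HermitianMetric.weight_pos {y : M} (hy : y ∈ e.baseSet) : 0 < h.weight e y := by
  refine h.pos y _ fun h0 => ?_
  have h1 := e.continuousLinearMapAt_symmL (R := ℂ) hy 1
  rw [e.symmL_apply hy, h0, map_zero] at h1
  exact zero_ne_one h1

lemma HermitianMetric.contMDiffAt_log_weight {y : M} (hy : y ∈ e.baseSet) :
    ContMDiffAt 𝓘(ℝ, Cn n) 𝓘(ℝ, ℝ) ∞ (fun y => Real.log (h.weight e y)) y := by
  have h1 := (h.smooth e 1 1).contMDiffAt (e.open_baseSet.mem_nhds hy)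
  have h2 : ContMDiffAt 𝓘(ℝ, Cn n) 𝓘(ℝ, ℝ) ∞ (fun y => h.weight e y) y :=
    (Complex.reCLM.contDiff.contDiffAt.contMDiffAt).comp y h1
  exact ((Real.contDiffAt_log.2 (h.weight_pos e hy).ne').contMDiffAt).comp y h2

lemma HermitianMetric.weight_change {y : M} (hy : y ∈ e.baseSet) (hy' : y ∈ e'.baseSet) :
    h.weight e y = Complex.normSq (e.coordChangeL ℂ e' y 1) * h.weight e' y ∧
      e.coordChangeL ℂ e' y 1 ≠ 0 := by
  constructor
  swap
  · simp
  have h1 : e.symm y 1 = (e.coordChangeL ℂ e' y 1) • e'.symm y 1 := by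
    rw [← e.symmL_apply (R := ℂ) hy, ← e'.symmL_apply (R := ℂ) hy', ← map_smul, smul_eq_mul, mul_one,
      e.coordChangeL_apply e' ⟨hy, hy'⟩, e'.symmL_apply hy', e.symmL_apply hy]
    exact (e'.symm_apply_apply_mk hy' _).symm
  simp only [HermitianMetric.weight]
  rw [h1]
  simp only [map_smulₛₗ, LinearMap.smul_apply, smul_eq_mul, RingHom.id_apply]
  rw [← mul_assoc, mul_comm (e.coordChangeL ℂ e' y 1), ← Complex.normSq_eq_conj_mul_self, Complex.re_ofReal_mul]

lemma HermitianMetric.iddbar_log_weight {y : M} (hy : y ∈ e.baseSet) (hy' : y ∈ e'.baseSet) :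
    iddbar n (fun y => Real.log (h.weight e y)) y =
      iddbar n (fun y => Real.log (h.weight e' y)) y := by
  set g : M → ℂ := fun y => e.coordChangeL ℂ e' y 1
  have hg : ContMDiffAt 𝓘(ℂ, Cn n) 𝓘(ℂ, ℂ) ω g y := by
    have h1 : ContMDiffAt 𝓘(ℂ, Cn n) 𝓘(ℂ, ℂ →L[ℂ] ℂ) ω
        (fun y => (e.coordChangeL ℂ e' y : ℂ →L[ℂ] ℂ)) y := contMDiffAt_coordChangeL hy hy'
    exact h1.clm_apply (contMDiffAt_const (c := (1 : ℂ)))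
  have hg0 : g y ≠ 0 := (h.weight_change e e' hy hy').2
  have hev : (fun y => Real.log (h.weight e y)) =ᶠ[𝓝 y]
      (fun y => Real.log (Complex.normSq (g y))) + fun y => Real.log (h.weight e' y) := by
    filter_upwards [e.open_baseSet.mem_nhds hy, e'.open_baseSet.mem_nhds hy'] with z hz hz'
    obtain ⟨h1, h2⟩ := h.weight_change e e' hz hz'
    rw [h1, Real.log_mul (by simp) (h.weight_pos e' hz').ne']
    rfl
  have hgs : ContMDiffAt 𝓘(ℝ, Cn n) 𝓘(ℝ, ℝ) ∞ (fun y => Real.log (Complex.normSq (g y))) y := by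
    have h1 := (contMDiffAt_restrictScalars hg).of_le (n := ω) (m := ∞) le_top
    have h2 : ContDiffAt ℝ ∞ (fun w : ℂ => Real.log (Complex.normSq w)) (g y) := by
      refine ContDiffAt.log ?_ (by simpa using hg0)
      have h3 : (Complex.normSq : ℂ → ℝ) = fun w => ‖w‖ ^ 2 := by
        funext w; exact Complex.normSq_eq_norm_sq w
      rw [h3]
      exact (contDiff_norm_sq ℝ).contDiffAt
    exact h2.contMDiffAt.comp y h1
  rw [iddbar_congr hev, iddbar_add hgs (h.contMDiffAt_log_weight e' hy'),
    iddbar_log_normSq hg hg0, zero_add]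

lemma HermitianMetric.curvature_eq {y : M} (hy : y ∈ e.baseSet) :
    h.curvature y = -iddbar n (fun y => Real.log (h.weight e y)) y := by
  rw [h.iddbar_log_weight e (trivializationAt ℂ L y) hy
    (FiberBundle.mem_baseSet_trivializationAt' y)]
  rfl

lemma HermitianMetric.curvature_mem : h.curvature ∈ closedReal11Forms n M := by
  refine iddbar_mem fun x => ?_
  let e := trivializationAt ℂ L x
  have hs : ∀ y ∈ e.baseSet, ContMDiffAt 𝓘(ℝ, Cn n) 𝓘(ℝ, ℝ) ∞
      (-fun y => Real.log (h.weight e y)) y := fun y hy =>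
    ContMDiffAt.neg (h.contMDiffAt_log_weight e hy)
  refine ⟨-fun y => Real.log (h.weight e y), e.baseSet,
    e.open_baseSet.mem_nhds (FiberBundle.mem_baseSet_trivializationAt' x),
    fun y hy => (hs y hy).contMDiffWithinAt, fun y hy => ?_⟩
  exact (h.curvature_eq e hy).trans (iddbar_neg (h.contMDiffAt_log_weight e hy)).symm

/-- The curvature, as a closed real `(1,1)`-form. -/
def HermitianMetric.curvatureForm : closedReal11Forms n M := ⟨h.curvature, h.curvature_mem⟩

lemma HermitianMetric.curvature_sub :
    h.curvatureForm - h'.curvatureForm ∈ ddbarExactForms n M := by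
  set ψ : M → ℝ := fun x => Real.log (h'.weight (trivializationAt ℂ L x) x) -
    Real.log (h.weight (trivializationAt ℂ L x) x) with hψ
  have hloc : ∀ x, ψ =ᶠ[𝓝 x] (fun y => Real.log (h'.weight (trivializationAt ℂ L x) y)) +
      -fun y => Real.log (h.weight (trivializationAt ℂ L x) y) := by
    intro x
    filter_upwards [(trivializationAt ℂ L x).open_baseSet.mem_nhds
      (FiberBundle.mem_baseSet_trivializationAt' x)] with y hy
    have hy' := FiberBundle.mem_baseSet_trivializationAt' (F := ℂ) (E := L) y
    obtain ⟨h1, h2⟩ := h.weight_change (trivializationAt ℂ L y) (trivializationAt ℂ L x) hy' hy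
    obtain ⟨h3, -⟩ := h'.weight_change (trivializationAt ℂ L y) (trivializationAt ℂ L x) hy' hy
    simp only [hψ, Pi.add_apply, Pi.neg_apply]
    rw [h1, h3, Real.log_mul (by simp) (h.weight_pos _ hy).ne',
      Real.log_mul (by simp) (h'.weight_pos _ hy).ne']
    ring
  have hsm : ∀ (k : HermitianMetric n ℂ L) (x : M), ContMDiffAt 𝓘(ℝ, Cn n) 𝓘(ℝ, ℝ) ∞
      (fun y => Real.log (k.weight (trivializationAt ℂ L x) y)) x := fun k x =>
    k.contMDiffAt_log_weight _ (FiberBundle.mem_baseSet_trivializationAt' x)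
  have hsm' : ∀ (k : HermitianMetric n ℂ L) (x : M), ContMDiffAt 𝓘(ℝ, Cn n) 𝓘(ℝ, ℝ) ∞
      (-fun y => Real.log (k.weight (trivializationAt ℂ L x) y)) x := fun k x =>
    ContMDiffAt.neg (hsm k x)
  refine ⟨ψ, fun x => ?_, ?_⟩
  · exact ((hsm h' x).add (hsm' h x)).congr_of_eventuallyEq (hloc x)
  · funext x
    rw [iddbar_congr (hloc x), iddbar_add (hsm h' x) (hsm' h x), iddbar_neg (hsm h x)]
    change h.curvature x - h'.curvature x = _
    simp only [HermitianMetric.curvature]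
    abel

variable [CompactSpace M] [T2Space M]

variable (n L) in
/-- The first Bott–Chern class `c₁^{BC}(L)` of a holomorphic line bundle: the class of the curvature
form of a Hermitian metric on `L`. By `firstBottChernClass_eq` the metric is irrelevant. -/
def firstBottChernClass : H11BC n M :=
  Submodule.Quotient.mk (HermitianMetric.nonempty (n := n) (F := ℂ) L).some.curvatureForm

lemma firstBottChernClass_eq (h : HermitianMetric n ℂ L) :
    firstBottChernClass n L = Submodule.Quotient.mk h.curvatureForm :=
  (Submodule.Quotient.eq _).2 (HermitianMetric.curvature_sub _ _)

end LineBundle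
end Metrics

section Canonical

lemma contDiff_det (n : ℕ) : ContDiff ℂ ω (fun A : Cn n →L[ℂ] Cn n => A.det) := by
  let b := (EuclideanSpace.basisFun (Fin n) ℂ).toBasis
  have h : (fun A : Cn n →L[ℂ] Cn n => A.det) =
      fun A : Cn n →L[ℂ] Cn n => ∑ σ : Equiv.Perm (Fin n), (Equiv.Perm.sign σ : ℂ) *
        ∏ i, (A (b i)) (σ i) := by
    funext A
    rw [ContinuousLinearMap.det, ← LinearMap.det_toMatrix b, Matrix.det_apply']
    simp [b, LinearMap.toMatrix_apply]
  rw [h]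
  refine ContDiff.sum fun σ _ => contDiff_const.mul (contDiff_prod fun i _ => ?_)
  exact (EuclideanSpace.proj (𝕜 := ℂ) (σ i) : Cn n →L[ℂ] ℂ).contDiff.comp
    (contDiff_id.clm_apply contDiff_const)

variable (n : ℕ) (M : Type*) [TopologicalSpace M] [ChartedSpace (Cn n) M]
  [IsManifold 𝓘(ℂ, Cn n) ω M]

/-- The canonical line bundle `K_M = Λⁿ T*M`, with one local trivialization for each chart of the
atlas. In a chart with coordinates `z` the local frame is `dz₁ ∧ ⋯ ∧ dzₙ`. If `a` is the coefficient
of an `n`-form in the chart `i`, then its coefficient in the chart `j` is `a · det (∂zⁱ/∂zʲ)`. -/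
def canonicalCore : VectorBundleCore ℂ M ℂ (atlas (Cn n) M) where
  baseSet i := i.1.source
  isOpen_baseSet i := i.1.open_source
  indexAt := achart (Cn n)
  mem_baseSet_at := mem_chart_source (Cn n)
  coordChange i j x := ((tangentBundleCore 𝓘(ℂ, Cn n) M).coordChange j i x).det •
    ContinuousLinearMap.id ℂ ℂ
  coordChange_self i x hx v := by
    have : (tangentBundleCore 𝓘(ℂ, Cn n) M).coordChange i i x = ContinuousLinearMap.id ℂ (Cn n) := by
      ext1 w
      exact (tangentBundleCore 𝓘(ℂ, Cn n) M).coordChange_self i x hx w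
    rw [this]
    simp [ContinuousLinearMap.det]
  continuousOn_coordChange i j := by
    have h := (tangentBundleCore 𝓘(ℂ, Cn n) M).continuousOn_coordChange j i
    rw [inter_comm] at h
    exact ((contDiff_det n).continuous.comp_continuousOn h).smul continuousOn_const
  coordChange_comp i j k x hx v := by
    have h := (tangentBundleCore 𝓘(ℂ, Cn n) M).coordChange_linear_comp k j i x
      ⟨⟨hx.2, hx.1.2⟩, hx.1.1⟩
    rw [← h]
    simp only [_root_.smul_apply, ContinuousLinearMap.id_apply, smul_eq_mul,
      ContinuousLinearMap.det, ContinuousLinearMap.toLinearMap_comp, LinearMap.det_comp]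
    ring

instance : (canonicalCore n M).IsContMDiff 𝓘(ℂ, Cn n) ω where
  contMDiffOn_coordChange i j := by
    have : (tangentBundleCore 𝓘(ℂ, Cn n) M).IsContMDiff 𝓘(ℂ, Cn n) ω :=
      
      tangentBundleCore.isContMDiff (I := 𝓘(ℂ, Cn n)) (M := M) (n := ω)
    have h := (tangentBundleCore 𝓘(ℂ, Cn n) M).contMDiffOn_coordChange 𝓘(ℂ, Cn n) (n := ω) j i
    rw [inter_comm] at h
    exact ((contDiff_det n).contMDiff.comp_contMDiffOn h).smul contMDiffOn_const

variable {n M} {ι : Type*}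

lemma lineCore_ne_zero (Z : VectorBundleCore ℂ M ℂ ι) {i j : ι} {x : M}
    (hx : x ∈ Z.baseSet i ∩ Z.baseSet j) : Z.coordChange i j x 1 ≠ 0 := by
  intro h
  have h1 := Z.coordChange_comp i j i x ⟨hx, hx.1⟩ 1
  rw [h, map_zero, Z.coordChange_self i x hx.1] at h1
  exact zero_ne_one h1

/-- The `k`-th tensor power of a line bundle, with the transition functions raised to the power `k`;
it is the dual bundle for `k = -1`. -/
def tensorPowerCore (Z : VectorBundleCore ℂ M ℂ ι) (k : ℤ) : VectorBundleCore ℂ M ℂ ι where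
  baseSet := Z.baseSet
  isOpen_baseSet := Z.isOpen_baseSet
  indexAt := Z.indexAt
  mem_baseSet_at := Z.mem_baseSet_at
  coordChange i j x := (Z.coordChange i j x 1) ^ k • ContinuousLinearMap.id ℂ ℂ
  coordChange_self i x hx v := by simp [Z.coordChange_self i x hx]
  continuousOn_coordChange i j :=
    (((Z.continuousOn_coordChange i j).clm_apply continuousOn_const).zpow₀ k
      fun _ hx => Or.inl (lineCore_ne_zero Z hx)).smul continuousOn_const
  coordChange_comp i j k x hx v := by
    have h := Z.coordChange_comp i j k x hx 1
    have h1 : Z.coordChange j k x (Z.coordChange i j x 1) =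
        Z.coordChange i j x 1 * Z.coordChange j k x 1 := by
      rw [← smul_eq_mul, ← map_smul, smul_eq_mul, mul_one]
    rw [← h, h1, mul_zpow]
    simp only [_root_.smul_apply, ContinuousLinearMap.id_apply, smul_eq_mul]
    ring

instance (Z : VectorBundleCore ℂ M ℂ ι) [Z.IsContMDiff 𝓘(ℂ, Cn n) ω] (k : ℤ) :
    (tensorPowerCore Z k).IsContMDiff 𝓘(ℂ, Cn n) ω where
  contMDiffOn_coordChange i j := by
    have h1 : ContMDiffOn 𝓘(ℂ, Cn n) 𝓘(ℂ, ℂ) ω (fun x => Z.coordChange i j x 1)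
        (Z.baseSet i ∩ Z.baseSet j) :=
      (Z.contMDiffOn_coordChange 𝓘(ℂ, Cn n) (n := ω) i j).clm_apply
        (contMDiffOn_const (I := 𝓘(ℂ, Cn n)) (I' := 𝓘(ℂ, ℂ)) (c := (1 : ℂ)))
    have h3 : ContMDiffOn 𝓘(ℂ, Cn n) 𝓘(ℂ, ℂ →L[ℂ] ℂ) ω
        (fun _ : M => ContinuousLinearMap.id ℂ ℂ) (Z.baseSet i ∩ Z.baseSet j) :=
      contMDiffOn_const
    suffices h4 : ContMDiffOn 𝓘(ℂ, Cn n) 𝓘(ℂ, ℂ) ω (fun x => (Z.coordChange i j x 1) ^ k)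
        (Z.baseSet i ∩ Z.baseSet j) from h4.smul h3
    intro x hx
    have h2 : ContDiffAt ℂ ω (fun w : ℂ => w ^ k) (Z.coordChange i j x 1) := by
      have h0 := lineCore_ne_zero Z hx
      cases k with
      | ofNat m => simpa using (contDiff_id.pow m).contDiffAt
      | negSucc m =>
        simp only [zpow_negSucc]
        exact (contDiff_id.pow (m + 1)).contDiffAt.inv (pow_ne_zero _ h0)
    exact h2.contMDiffAt.comp_contMDiffWithinAt x (h1 x hx)

variable (n M)

/-- The canonical bundle `K_M`. -/
abbrev CanonicalBundle : M → Type := (canonicalCore n M).Fiber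

/-- The tensor power `K_M^k`, for `k ∈ ℤ`. -/
abbrev CanonicalPower (k : ℤ) : M → Type := (tensorPowerCore (canonicalCore n M) k).Fiber

/-- `c₁^{BC}(M) = c₁^{BC}(K_M^*)`. -/
def manifoldBottChernClass [CompactSpace M] [T2Space M] : H11BC n M :=
  firstBottChernClass n (CanonicalPower n M (-1))

/-- Two holomorphic line bundles over `M` are isomorphic: there is a family of linear isomorphisms
of the fibres such that it and its inverse are holomorphic maps of the total spaces. -/
def HolomorphicallyIsomorphic (n : ℕ) {M : Type*} [TopologicalSpace M]
    [ChartedSpace (Cn n) M] (L L' : M → Type*)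
    [TopologicalSpace (TotalSpace ℂ L)] [∀ x, AddCommGroup (L x)]
    [∀ x, Module ℂ (L x)] [∀ x, TopologicalSpace (L x)] [FiberBundle ℂ L]
    [TopologicalSpace (TotalSpace ℂ L')] [∀ x, AddCommGroup (L' x)]
    [∀ x, Module ℂ (L' x)] [∀ x, TopologicalSpace (L' x)] [FiberBundle ℂ L'] : Prop :=
  ∃ Φ : ∀ x, L x ≃ₗ[ℂ] L' x,
    ContMDiff (𝓘(ℂ, Cn n).prod 𝓘(ℂ, ℂ)) (𝓘(ℂ, Cn n).prod 𝓘(ℂ, ℂ)) ω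
      (fun p : TotalSpace ℂ L => (⟨p.1, Φ p.1 p.2⟩ : TotalSpace ℂ L')) ∧
    ContMDiff (𝓘(ℂ, Cn n).prod 𝓘(ℂ, ℂ)) (𝓘(ℂ, Cn n).prod 𝓘(ℂ, ℂ)) ω
      (fun p : TotalSpace ℂ L' => (⟨p.1, (Φ p.1).symm p.2⟩ : TotalSpace ℂ L))

end Canonical

section Hermitian

/-- A curve is piecewise smooth on `[0, 1]`. -/
def IsPiecewiseSmooth (n : ℕ) {M : Type*} [TopologicalSpace M]
    [ChartedSpace (Cn n) M] (γ : ℝ → M) : Prop :=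
  ∃ (m : ℕ) (t : Fin (m + 1) → ℝ), Monotone t ∧ t 0 = 0 ∧ t (Fin.last m) = 1 ∧
    ∀ i : Fin m, ContMDiffOn 𝓘(ℝ, ℝ) 𝓘(ℝ, Cn n) ∞ γ (Icc (t i.castSucc) (t i.succ))

variable {n : ℕ} {M : Type*} [TopologicalSpace M] [ChartedSpace (Cn n) M]
  [IsManifold 𝓘(ℂ, Cn n) ω M]

variable (n M) in
/-- A Hermitian metric on `M`: a Hermitian metric on the holomorphic tangent bundle. -/
abbrev TangentHermitianMetric : Type _ :=
  HermitianMetric n (Cn n) (TangentSpace 𝓘(ℂ, Cn n) : M → Type _)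

/-- The coordinate vector field `∂/∂z_j` of a chart `φ`, at the point with coordinates `z`. -/
def coordField (φ : OpenPartialHomeomorph M (Cn n)) (j : Fin n) (z : Cn n) :
    TangentSpace 𝓘(ℂ, Cn n) (φ.symm z) :=
  mfderiv 𝓘(ℂ, Cn n) 𝓘(ℂ, Cn n) φ.symm z (EuclideanSpace.single j (1 : ℂ) : Cn n)

/-- The matrix `g_{j k̄} = g(∂/∂z_j, ∂/∂z_k)` (linear in the vector indexed by `j`, antilinear in the
one indexed by `k`) in a chart `φ`, at the point with coordinates `z`. -/
def metricMatrix (g : TangentHermitianMetric n M) (φ : OpenPartialHomeomorph M (Cn n)) (z : Cn n) :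
    Matrix (Fin n) (Fin n) ℂ :=
  Matrix.of fun j k => g.form (φ.symm z) (coordField φ k z) (coordField φ j z)

/-- The value at `x` of the Chern–Ricci form `Ric(ω) = -i ∂∂̄ log det g`, where `g` is the matrix of the
metric in the preferred chart at `x`. -/
def chernRicci (g : TangentHermitianMetric n M) (x : M) :
    TangentSpace 𝓘(ℝ, Cn n) x [⋀^Fin 2]→L[ℝ] ℝ :=
  -iddbar n (fun y => Real.log
    (metricMatrix g (chartAt (Cn n) x) (chartAt (Cn n) x y)).det.re) x

/-- The `(1,0)`-derivative `∂f(a) = ∑ᵢ aᵢ ∂f/∂zᵢ` at `z`. -/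
def del (f : Cn n → ℂ) (z a : Cn n) : ℂ :=
  (1 / 2) * (fderiv ℝ f z a - Complex.I * fderiv ℝ f z (Complex.I • a))

/-- The matrix `A(a) = ∂G(a) · G⁻¹`, `G = (g_{j k̄})`, of the Chern connection in the holomorphic
frame `∂/∂z_j`: `∇_a ∂/∂z_j = ∑_k A(a)_{jk} ∂/∂z_k`, that is
`A(a)_{jk} = ∑_i aᵢ Γ_{ij}^k` with `Γ_{ij}^k = ∑_l g^{k l̄} ∂g_{j l̄}/∂z_i`. -/
def chernConnectionMatrix (g : TangentHermitianMetric n M) (φ : OpenPartialHomeomorph M (Cn n))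
    (z a : Cn n) : Matrix (Fin n) (Fin n) ℂ :=
  (Matrix.of fun j k => del (fun w => metricMatrix g φ w j k) z a) * (metricMatrix g φ z)⁻¹

/-- The components of a tangent vector `p` in the frame `∂/∂z_j` of a chart `φ`. -/
def components (φ : OpenPartialHomeomorph M (Cn n)) (p : TangentBundle 𝓘(ℂ, Cn n) M) : Cn n :=
  mfderiv 𝓘(ℂ, Cn n) 𝓘(ℂ, Cn n) φ p.1 p.2

/-- A curve `V` in the tangent bundle, over the curve `γ` in `M` underlying it, is a parallel vector
field along `γ` on `[0, 1]` for the Chern connection: it is continuous and, away from finitely many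
times (the corners of `γ`), its components `u` in every chart satisfy
`u_k' + ∑_j u_j A(γ')_{jk} = 0`. -/
def IsParallel (g : TangentHermitianMetric n M) (V : ℝ → TangentBundle 𝓘(ℂ, Cn n) M) : Prop :=
  ContinuousOn V (Icc 0 1) ∧
  ∃ S : Finset ℝ, ∀ t ∈ Ioo (0 : ℝ) 1, t ∉ S → ∀ φ ∈ atlas (Cn n) M, (V t).1 ∈ φ.source →
    ∀ k : Fin n, HasDerivAt (fun τ => components φ (V τ) k)
      (-∑ j, components φ (V t) j *
        chernConnectionMatrix g φ (φ (V t).1) (deriv (fun τ => φ (V τ).1) t) j k) t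

/-- The restricted holonomy group `Hol⁰` at `x` of the Chern connection of `g`: the parallel
transports along the null-homotopic piecewise smooth loops based at `x`. -/
def restrictedHolonomy (g : TangentHermitianMetric n M) (x : M) :
    Set (TangentSpace 𝓘(ℂ, Cn n) x →ₗ[ℂ] TangentSpace 𝓘(ℂ, Cn n) x) :=
  {P | ∃ γ : Path x x, IsPiecewiseSmooth n γ.extend ∧ γ.Homotopic (Path.refl x) ∧
    ∀ v : TangentSpace 𝓘(ℂ, Cn n) x, ∃ V : ℝ → TangentBundle 𝓘(ℂ, Cn n) M,
      IsParallel g V ∧ (∀ t ∈ Icc (0 : ℝ) 1, (V t).1 = γ.extend t) ∧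
        V 0 = ⟨x, v⟩ ∧ V 1 = ⟨x, P v⟩}

/-- The special unitary group `SU(T_xM, g_x) ≅ SU(n)`. -/
def specialUnitary (g : TangentHermitianMetric n M) (x : M) :
    Set (TangentSpace 𝓘(ℂ, Cn n) x →ₗ[ℂ] TangentSpace 𝓘(ℂ, Cn n) x) :=
  {A | (∀ v w, g.form x (A v) (A w) = g.form x v w) ∧ LinearMap.det A = 1}

end Hermitian

end

end BottChern

/-!
Everything rests on one observation: for a Hermitian metric `g` on `M`, with matrix `G` in the
coordinate frames, the functions `det G` transform like the weights of a Hermitian metric on `K_M^*`,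
whose curvature is the Chern–Ricci form (`isWeightFamily_detMetric`, `curvature_canonical`). Hence a
Ricci-flat `g` gives a flat metric on `K_M`, and a flat metric on `K_M` gives, by duality, a flat
metric on `K_M^*` and so `c₁^{BC}(M) = 0` (`manifoldBottChernClass_eq_zero`). Conversely, if
`Ric(g) = i ∂∂̄ψ`, then a conformal change of `g` by a power of `e^ψ` makes it Ricci-flat
(`exists_chernRicci_eq_zero`); in dimension zero there is nothing to do. If `K_M^ℓ` is trivial, then
the `ℓ`-th root of the trivial metric on `K_M^ℓ` is a flat metric on `K_M`
(`exists_flat_metric_of_torsion`).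

For the holonomy, the trace of the Chern connection matrix `∂G · G⁻¹` is `∂ log det G`
(`trace_connection`), and its exterior derivative is a multiple of `i ∂∂̄ log det G`
(`fderiv_delReal_symm_iff`). The connection preserves `g`, so only determinants are at stake.

If `g` is Ricci-flat, then locally `det G = |f|²` with `f` holomorphic (`exists_flat_factor`), and
for a parallel frame with component matrix `X` the number `f · det X` is constant. The quotients of
the factors `f` in overlapping charts, corrected by the Jacobian, are locally constant: they are the
transition functions of a bundle with discrete fibre, that is, of a covering space. Liftings of
null-homotopic loops to a covering are closed (`flat_section_eq`), and so the determinant of the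
parallel transport is `1`.

If the restricted holonomy of `g` lies in the special unitary groups, then the determinant of the
parallel transport along a small ellipse in a chart, which is the exponential of minus the integral of
`∂ log det G`, is `1`; the integral is small, so it vanishes. The second-order term of this integral
is the area of the ellipse times the exterior derivative of `∂ log det G`, which is therefore zero
(`fderiv_symm_of_integral_ellipse`). Here the parallel transport is obtained from the existence
theorem for linear differential equations, and it solves the equation in every chart by the
transformation rule of the connection (`connection_transition`).
-/

namespace BottChern

open Set Bundle Manifold
open scoped Topology ComplexConjugate

noncomputable section

set_option linter.unusedSectionVars false

/-! ### Hermitian metrics given by local weights -/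

section Weights

variable {n : ℕ} {M : Type*} [TopologicalSpace M] [ChartedSpace (Cn n) M]
  {ι : Type*} (Z : VectorBundleCore ℂ M ℂ ι)

lemma lineCore_apply (i j : ι) (x : M) (a : ℂ) :
    Z.coordChange i j x a = a * Z.coordChange i j x 1 := by
  rw [← smul_eq_mul, ← map_smul, smul_eq_mul, mul_one]

lemma lineCore_mul {i j k : ι} {x : M} (hi : x ∈ Z.baseSet i) (hj : x ∈ Z.baseSet j)
    (hk : x ∈ Z.baseSet k) :
    Z.coordChange i j x 1 * Z.coordChange j k x 1 = Z.coordChange i k x 1 := by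
  rw [← lineCore_apply, Z.coordChange_comp i j k x ⟨⟨hi, hj⟩, hk⟩]

/-- A family of positive functions `ρ i`, smooth on the trivializing sets of a line bundle and
transforming like the squared lengths `|s_i|²` of the local frames. -/
structure IsWeightFamily (Z : VectorBundleCore ℂ M ℂ ι) (ρ : ι → M → ℝ) : Prop where
  pos : ∀ i, ∀ x ∈ Z.baseSet i, 0 < ρ i x
  smooth : ∀ i, ContMDiffOn 𝓘(ℝ, Cn n) 𝓘(ℝ, ℝ) ∞ (ρ i) (Z.baseSet i)
  change : ∀ i j, ∀ x ∈ Z.baseSet i ∩ Z.baseSet j,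
    ρ i x = Complex.normSq (Z.coordChange i j x 1) * ρ j x

variable {Z} {ρ : ι → M → ℝ}

/-- The Hermitian metric on a line bundle for which the local frames have squared lengths `ρ i`. -/
def HermitianMetric.ofWeights (hρ : IsWeightFamily (n := n) Z ρ) : HermitianMetric n ℂ Z.Fiber where
  form x := ((ρ (Z.indexAt x) x : ℝ) : ℂ) • (innerₛₗ ℂ : ℂ →ₗ⋆[ℂ] ℂ →ₗ[ℂ] ℂ)
  conj_form x v w := by
    change conj (((ρ (Z.indexAt x) x : ℝ) : ℂ) * inner ℂ (E := ℂ) w v) =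
      ((ρ (Z.indexAt x) x : ℝ) : ℂ) * inner ℂ (E := ℂ) v w
    rw [map_mul, Complex.conj_ofReal]
    exact congrArg _ (inner_conj_symm (𝕜 := ℂ) (E := ℂ) v w)
  pos x v hv := by
    change 0 < (((ρ (Z.indexAt x) x : ℝ) : ℂ) * inner ℂ (E := ℂ) v v).re
    rw [Complex.re_ofReal_mul]
    refine mul_pos (hρ.pos _ x (Z.mem_baseSet_at x)) ?_
    have h : (inner ℂ (E := ℂ) v v).re = ‖id (α := ℂ) v‖ ^ 2 := inner_self_eq_norm_sq (𝕜 := ℂ) (E := ℂ) v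
    rw [h]
    exact pow_pos (norm_pos_iff.2 hv) 2
  smooth e he a b := by
    obtain ⟨i, rfl⟩ := he.out
    have h1 : ContMDiffOn 𝓘(ℝ, Cn n) 𝓘(ℝ, ℂ) ∞ (fun x => ((ρ i x : ℝ) : ℂ) * inner ℂ a b)
        (Z.baseSet i) :=
      (Complex.ofRealCLM.smulRight (inner ℂ a b : ℂ)).contDiff.contMDiff.comp_contMDiffOn
        (hρ.smooth i)
    refine h1.congr fun x hx => ?_
    have hx' : x ∈ Z.baseSet i ∩ Z.baseSet (Z.indexAt x) := ⟨hx, Z.mem_baseSet_at x⟩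
    have h2 : ∀ c : ℂ, Trivialization.symm (Z.localTriv i) x c =
        c * Z.coordChange i (Z.indexAt x) x 1 := fun c => by
      rw [← lineCore_apply]
      exact Z.localTriv_symm_apply i hx c
    change ((ρ (Z.indexAt x) x : ℝ) : ℂ) * inner ℂ (E := ℂ)
      (Trivialization.symm (Z.localTriv i) x a) (Trivialization.symm (Z.localTriv i) x b) = _
    rw [h2, h2, hρ.change i _ x hx']
    simp only [RCLike.inner_apply, map_mul]
    push_cast
    rw [Complex.normSq_eq_conj_mul_self]
    ring

lemma HermitianMetric.ofWeights_weight (hρ : IsWeightFamily (n := n) Z ρ) {i : ι} {x : M}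
    (hx : x ∈ Z.baseSet i) : (HermitianMetric.ofWeights hρ).weight (Z.localTriv i) x = ρ i x := by
  have hx' : x ∈ Z.baseSet i ∩ Z.baseSet (Z.indexAt x) := ⟨hx, Z.mem_baseSet_at x⟩
  have h2 : Trivialization.symm (Z.localTriv i) x 1 = Z.coordChange i (Z.indexAt x) x 1 :=
    Z.localTriv_symm_apply i hx 1
  rw [HermitianMetric.weight, h2]
  change (((ρ (Z.indexAt x) x : ℝ) : ℂ) * inner ℂ (Z.coordChange i (Z.indexAt x) x 1)
    (Z.coordChange i (Z.indexAt x) x 1)).re = _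
  rw [hρ.change i _ x hx', Complex.re_ofReal_mul, mul_comm]
  congr 1
  rw [RCLike.inner_apply, mul_comm, ← Complex.normSq_eq_conj_mul_self, Complex.ofReal_re]

variable [IsManifold 𝓘(ℂ, Cn n) ω M]

lemma HermitianMetric.ofWeights_curvature (hρ : IsWeightFamily (n := n) Z ρ) (x : M) :
    (HermitianMetric.ofWeights hρ).curvature x =
      -iddbar n (fun y => Real.log (ρ (Z.indexAt x) y)) x := by
  rw [HermitianMetric.curvature]
  congr 1
  apply iddbar_congr
  filter_upwards [(Z.isOpen_baseSet _).mem_nhds (Z.mem_baseSet_at x)] with y hy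
  rw [← ofWeights_weight hρ hy]
  rfl

variable [Z.IsContMDiff 𝓘(ℂ, Cn n) ω]

instance instMemTrivializationAtlasLocalTriv (i : ι) : MemTrivializationAtlas (Z.localTriv i) :=
  ⟨⟨i, rfl⟩⟩

lemma HermitianMetric.isWeightFamily (h : HermitianMetric n ℂ Z.Fiber) :
    IsWeightFamily (n := n) Z fun i => h.weight (Z.localTriv i) where
  pos i x hx := h.weight_pos (Z.localTriv i) hx
  smooth i := Complex.reCLM.contDiff.contMDiff.comp_contMDiffOn (h.smooth (Z.localTriv i) 1 1)
  change i j x hx := by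
    rw [(h.weight_change (Z.localTriv i) (Z.localTriv j) hx.1 hx.2).1]
    congr 2
    exact Z.localTriv_coordChange_eq i j hx 1

lemma HermitianMetric.curvature_eq_weight (h : HermitianMetric n ℂ Z.Fiber) (x : M) :
    h.curvature x =
      -iddbar n (fun y => Real.log (h.weight (Z.localTriv (Z.indexAt x)) y)) x := rfl

lemma IsWeightFamily.contMDiffAt_log (hρ : IsWeightFamily (n := n) Z ρ) {i : ι} {x : M}
    (hx : x ∈ Z.baseSet i) :
    ContMDiffAt 𝓘(ℝ, Cn n) 𝓘(ℝ, ℝ) ∞ (fun y => Real.log (ρ i y)) x :=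
  (Real.contDiffAt_log.2 (hρ.pos i x hx).ne').contMDiffAt.comp x
    ((hρ.smooth i).contMDiffAt ((Z.isOpen_baseSet i).mem_nhds hx))

/-- The inverses of the weights of a metric are the weights of the dual metric. -/
lemma IsWeightFamily.inv (hρ : IsWeightFamily (n := n) Z ρ) :
    IsWeightFamily (n := n) (tensorPowerCore Z (-1)) fun i x => (ρ i x)⁻¹ where
  pos i x hx := inv_pos.2 (hρ.pos i x hx)
  smooth i x hx := (hρ.smooth i x hx).inv₀ (hρ.pos i x hx).ne'
  change i j x hx := by
    have : (tensorPowerCore Z (-1)).coordChange i j x 1 = (Z.coordChange i j x 1)⁻¹ := by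
      simp [tensorPowerCore]
    rw [this, hρ.change i j x hx, mul_inv, Complex.normSq_inv]

lemma iddbar_log_inv {u : M → ℝ} {x : M}
    (hu : ContMDiffAt 𝓘(ℝ, Cn n) 𝓘(ℝ, ℝ) ∞ (fun y => Real.log (u y)) x) :
    iddbar n (fun y => Real.log (u y)⁻¹) x = -iddbar n (fun y => Real.log (u y)) x := by
  rw [← iddbar_neg hu]
  congr 1
  funext y
  simp [Real.log_inv]

end Weights

/-! ### Coordinate frames and the matrix of a metric -/

section Frames

variable {n : ℕ} {M : Type*} [TopologicalSpace M] [ChartedSpace (Cn n) M]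

/-- The inverse of a chart induces at `z` a linear map from `ℂⁿ` to the tangent space of `M`, which
is the model space; it maps the standard basis to the coordinate fields. -/
def frame (φ : OpenPartialHomeomorph M (Cn n)) (z : Cn n) : Cn n →L[ℂ] Cn n :=
  mfderiv 𝓘(ℂ, Cn n) 𝓘(ℂ, Cn n) φ.symm z

/-- The Jacobian matrix `∂f_k/∂z_j` of a holomorphic map, with row index `j`. -/
def jac (f : Cn n → Cn n) (z : Cn n) : Matrix (Fin n) (Fin n) ℂ :=
  Matrix.of fun j k => fderiv ℂ f z (EuclideanSpace.single j (1 : ℂ)) k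

lemma sum_smul_single (a : Cn n) : ∑ j, a j • EuclideanSpace.single j (1 : ℂ) = a := by
  ext k
  simp [Pi.single_apply]

lemma clm_apply_eq_sum (L : Cn n →L[ℂ] Cn n) (a : Cn n) (k : Fin n) :
    L a k = ∑ j, a j * L (EuclideanSpace.single j (1 : ℂ)) k := by
  conv_lhs => rw [← sum_smul_single a]
  simp

lemma det_of_apply_single (Q : Cn n →ₗ[ℂ] Cn n) :
    (Matrix.of fun i k : Fin n => Q (EuclideanSpace.single i (1 : ℂ)) k).det = LinearMap.det Q := by
  let b := (EuclideanSpace.basisFun (Fin n) ℂ).toBasis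
  rw [← LinearMap.det_toMatrix b, ← Matrix.det_transpose]
  congr 1

lemma det_jac (f : Cn n → Cn n) (z : Cn n) : (jac f z).det = (fderiv ℂ f z).det :=
  det_of_apply_single (fderiv ℂ f z : Cn n →ₗ[ℂ] Cn n)

variable [IsManifold 𝓘(ℂ, Cn n) ω M] {φ ψ : OpenPartialHomeomorph M (Cn n)}

lemma mdifferentiableAt_complex_symm (hφ : φ ∈ atlas (Cn n) M) {z : Cn n} (hz : z ∈ φ.target) :
    MDifferentiableAt 𝓘(ℂ, Cn n) 𝓘(ℂ, Cn n) φ.symm z :=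
  mdifferentiableAt_atlas_symm hφ hz

lemma frame_eq (hφ : φ ∈ atlas (Cn n) M) {z : Cn n} (hz : z ∈ φ.target) :
    frame φ z = fderiv ℂ (chartAt (Cn n) (φ.symm z) ∘ φ.symm) z := by
  rw [frame, (mdifferentiableAt_complex_symm hφ hz).mfderiv]
  simp [writtenInExtChartAt, fderivWithin_univ]
  rfl

lemma localTriv_symm_eq_frame (hφ : φ ∈ atlas (Cn n) M) {x : M} (hx : x ∈ φ.source) (a : Cn n) :
    ((tangentBundleCore 𝓘(ℂ, Cn n) M).localTriv ⟨φ, hφ⟩).symm x a = frame φ (φ x) a := by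
  rw [frame_eq hφ (φ.map_source hx), φ.left_inv hx]
  refine ((tangentBundleCore 𝓘(ℂ, Cn n) M).localTriv_symm_apply ⟨φ, hφ⟩ hx a).trans ?_
  simp [tangentBundleCore, fderivWithin_univ, achart]
  rfl

lemma frame_transition (hφ : φ ∈ atlas (Cn n) M) (hψ : ψ ∈ atlas (Cn n) M) {z : Cn n}
    (hz : z ∈ φ.target) (hz' : φ.symm z ∈ ψ.source) :
    frame φ z = (frame ψ (ψ (φ.symm z))).comp (fderiv ℂ (ψ ∘ φ.symm) z) := by
  have hT := (contDiffAt_transition hφ hψ hz hz').differentiableAt (by simp)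
  have hev : φ.symm =ᶠ[𝓝 z] ψ.symm ∘ (ψ ∘ φ.symm) := by
    filter_upwards [(φ.continuousAt_symm hz).eventually (ψ.open_source.mem_nhds hz')] with w hw
    simp [ψ.left_inv hw]
  have h1 := mfderiv_comp z (I := 𝓘(ℂ, Cn n)) (I' := 𝓘(ℂ, Cn n)) (I'' := 𝓘(ℂ, Cn n))
    (g := ψ.symm) (f := ψ ∘ φ.symm)
    (mdifferentiableAt_complex_symm hψ (ψ.map_source hz')) hT.mdifferentiableAt
  rw [mfderiv_eq_fderiv] at h1
  have h2 := hev.mfderiv_eq (I := 𝓘(ℂ, Cn n)) (I' := 𝓘(ℂ, Cn n))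
  exact h2.trans h1

lemma coordField_eq_sum (hφ : φ ∈ atlas (Cn n) M) (hψ : ψ ∈ atlas (Cn n) M) {z : Cn n}
    (hz : z ∈ φ.target) (hz' : φ.symm z ∈ ψ.source) (j : Fin n) :
    frame φ z (EuclideanSpace.single j 1) =
      frame ψ (ψ (φ.symm z)) (∑ k, jac (ψ ∘ φ.symm) z j k • EuclideanSpace.single k 1) := by
  rw [frame_transition hφ hψ hz hz']
  exact congrArg (frame ψ (ψ (φ.symm z))) (sum_smul_single (fderiv ℂ (ψ ∘ φ.symm) z
    (EuclideanSpace.single j 1))).symm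

/-- The metric in a coordinate frame. -/
lemma form_frame (g : TangentHermitianMetric n M) (φ : OpenPartialHomeomorph M (Cn n)) (z a b : Cn n) :
    g.form (φ.symm z) (frame φ z a) (frame φ z b) =
      ∑ j, ∑ k, b j * metricMatrix g φ z j k * conj (a k) := by
  let B : Cn n →ₗ⋆[ℂ] Cn n →ₗ[ℂ] ℂ := g.form (φ.symm z)
  let F : Cn n →ₗ[ℂ] Cn n := frame φ z
  change B (F a) (F b) = ∑ j, ∑ k, b j * B (F (EuclideanSpace.single k 1))
    (F (EuclideanSpace.single j 1)) * conj (a k)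
  conv_lhs => rw [← sum_smul_single a, ← sum_smul_single b]
  simp only [map_sum, map_smul, map_smulₛₗ, LinearMap.sum_apply, LinearMap.smul_apply, smul_eq_mul,
    Finset.mul_sum]
  refine Finset.sum_congr rfl fun j _ => Finset.sum_congr rfl fun k _ => ?_
  ring

lemma metricMatrix_conj (g : TangentHermitianMetric n M) (φ : OpenPartialHomeomorph M (Cn n)) (z : Cn n)
    (j k : Fin n) : conj (metricMatrix g φ z j k) = metricMatrix g φ z k j :=
  g.conj_form _ _ _

lemma form_congr (g : TangentHermitianMetric n M) {x y : M} (h : x = y) (v w : Cn n) :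
    g.form x v w = g.form y v w := by
  subst h; rfl

/-- The transformation rule `G^φ = J G^ψ Jᴴ` for the matrix of a metric. -/
lemma metricMatrix_transition (g : TangentHermitianMetric n M)
    (hφ : φ ∈ atlas (Cn n) M) (hψ : ψ ∈ atlas (Cn n) M) {z : Cn n}
    (hz : z ∈ φ.target) (hz' : φ.symm z ∈ ψ.source) :
    metricMatrix g φ z = jac (ψ ∘ φ.symm) z * metricMatrix g ψ (ψ (φ.symm z)) *
      (jac (ψ ∘ φ.symm) z).conjTranspose := by
  ext j k
  have h1 : metricMatrix g φ z j k = g.form (φ.symm z) (frame φ z (EuclideanSpace.single k 1))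
    (frame φ z (EuclideanSpace.single j 1)) := rfl
  rw [h1, coordField_eq_sum hφ hψ hz hz', coordField_eq_sum hφ hψ hz hz',
    form_congr g (ψ.left_inv hz').symm, form_frame, Matrix.mul_apply, Finset.sum_comm]
  refine Finset.sum_congr rfl fun l _ => ?_
  rw [Matrix.mul_apply, Finset.sum_mul]
  refine Finset.sum_congr rfl fun m _ => ?_
  simp [Pi.single_apply]

lemma frame_injective (hφ : φ ∈ atlas (Cn n) M) {z : Cn n} (hz : z ∈ φ.target) :
    Function.Injective (frame φ z) := by
  have h1 := mfderiv_comp z (I := 𝓘(ℂ, Cn n)) (I' := 𝓘(ℂ, Cn n)) (I'' := 𝓘(ℂ, Cn n))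
    (g := φ) (f := φ.symm) (mdifferentiableAt_atlas hφ (φ.map_target hz))
    (mdifferentiableAt_complex_symm hφ hz)
  have hev : φ ∘ φ.symm =ᶠ[𝓝 z] id := by
    filter_upwards [φ.open_target.mem_nhds hz] with w hw
    simp [φ.right_inv hw]
  rw [hev.mfderiv_eq, mfderiv_id] at h1
  intro a b hab
  have h2 := DFunLike.congr_fun h1 a
  have h3 := DFunLike.congr_fun h1 b
  exact h2.trans ((congrArg (mfderiv 𝓘(ℂ, Cn n) 𝓘(ℂ, Cn n) φ (φ.symm z)) hab).trans h3.symm)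

lemma components_frame (hφ : φ ∈ atlas (Cn n) M) {z : Cn n} (hz : z ∈ φ.target) (a : Cn n) :
    components φ (⟨φ.symm z, frame φ z a⟩ : TangentBundle 𝓘(ℂ, Cn n) M) = a := by
  have h1 := mfderiv_comp z (I := 𝓘(ℂ, Cn n)) (I' := 𝓘(ℂ, Cn n)) (I'' := 𝓘(ℂ, Cn n))
    (g := φ) (f := φ.symm) (mdifferentiableAt_atlas hφ (φ.map_target hz))
    (mdifferentiableAt_complex_symm hφ hz)
  have hev : φ ∘ φ.symm =ᶠ[𝓝 z] id := by
    filter_upwards [φ.open_target.mem_nhds hz] with w hw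
    simp [φ.right_inv hw]
  rw [hev.mfderiv_eq, mfderiv_id] at h1
  exact (DFunLike.congr_fun h1 a).symm

lemma frame_components (hφ : φ ∈ atlas (Cn n) M) {p : TangentBundle 𝓘(ℂ, Cn n) M}
    (hp : p.1 ∈ φ.source) : frame φ (φ p.1) (components φ p) = p.2 := by
  obtain ⟨a, ha⟩ := (LinearMap.injective_iff_surjective (f := (frame φ (φ p.1) : Cn n →ₗ[ℂ] Cn n))).1
    (frame_injective hφ (φ.map_source hp)) p.2
  have h1 := components_frame hφ (φ.map_source hp) a
  have h2 : (⟨φ.symm (φ p.1), frame φ (φ p.1) a⟩ : TangentBundle 𝓘(ℂ, Cn n) M) = p := by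
    obtain ⟨x, v⟩ := p
    have h3 : φ.symm (φ x) = x := φ.left_inv hp
    have h4 : frame φ (φ x) a = v := ha
    rw [h4]
    exact congrArg (fun y => (⟨y, v⟩ : TangentBundle 𝓘(ℂ, Cn n) M)) h3
  rw [h2] at h1
  rw [h1]
  exact ha

open scoped ComplexOrder in
lemma posDef_metricMatrix (g : TangentHermitianMetric n M) (hφ : φ ∈ atlas (Cn n) M) {z : Cn n}
    (hz : z ∈ φ.target) : (metricMatrix g φ z).PosDef := by
  refine Matrix.PosDef.of_dotProduct_mulVec_pos ?_ fun x hx => ?_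
  · ext j k
    exact metricMatrix_conj g φ z k j
  · let a : Cn n := WithLp.toLp 2 (star x)
    have ha : a ≠ 0 := fun h => hx (by
      ext i
      have := congrArg (fun b : Cn n => conj (b i)) h
      simpa [a] using this)
    have h1 := form_frame g φ z a a
    have h2 : star x ⬝ᵥ (metricMatrix g φ z).mulVec x = g.form (φ.symm z) (frame φ z a) (frame φ z a) := by
      rw [h1]
      simp only [dotProduct, Matrix.mulVec, Finset.mul_sum]
      refine Finset.sum_congr rfl fun j _ => Finset.sum_congr rfl fun k _ => ?_
      simp [a]
      ring
    rw [h2]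
    have h3 := g.pos (φ.symm z) (frame φ z a) fun h0 => ha (frame_injective hφ hz
      (h0.trans (map_zero (frame φ z)).symm))
    have h4 := g.conj_form (φ.symm z) (frame φ z a) (frame φ z a)
    rw [Complex.lt_def]
    exact ⟨h3, (Complex.conj_eq_iff_im.1 h4).symm⟩

lemma det_metricMatrix (g : TangentHermitianMetric n M) (hφ : φ ∈ atlas (Cn n) M) {z : Cn n}
    (hz : z ∈ φ.target) : 0 < (metricMatrix g φ z).det.re ∧
      (metricMatrix g φ z).det = ((metricMatrix g φ z).det.re : ℂ) := by
  have h := Complex.lt_def.1 (posDef_metricMatrix g hφ hz).det_pos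
  exact ⟨h.1, Complex.ext rfl h.2.symm⟩

lemma isUnit_det_metricMatrix (g : TangentHermitianMetric n M) (hφ : φ ∈ atlas (Cn n) M) {z : Cn n}
    (hz : z ∈ φ.target) : IsUnit (metricMatrix g φ z).det := by
  obtain ⟨h1, h2⟩ := det_metricMatrix g hφ hz
  rw [h2, isUnit_iff_ne_zero]
  exact_mod_cast h1.ne'

lemma contDiffOn_metricMatrix (g : TangentHermitianMetric n M) (hφ : φ ∈ atlas (Cn n) M) (j k : Fin n) :
    ContDiffOn ℝ ∞ (fun z => metricMatrix g φ z j k) φ.target := by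
  have := isManifold_real (n := n) (M := M)
  let e : Trivialization (Cn n) (π (Cn n) (TangentSpace 𝓘(ℂ, Cn n) : M → Type _)) :=
    (tangentBundleCore 𝓘(ℂ, Cn n) M).localTriv ⟨φ, hφ⟩
  have : MemTrivializationAtlas e := ⟨⟨⟨φ, hφ⟩, rfl⟩⟩
  have h1 := g.smooth e
    (EuclideanSpace.single k 1) (EuclideanSpace.single j 1)
  rw [← contMDiffOn_iff_contDiffOn]
  have h2 : ContMDiffOn 𝓘(ℝ, Cn n) 𝓘(ℝ, Cn n) ∞ φ.symm φ.target :=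
    contMDiffOn_symm_of_mem_maximalAtlas (IsManifold.subset_maximalAtlas hφ)
  refine (h1.comp h2 fun z hz => φ.map_target hz).congr fun z hz => ?_
  have h3 : ∀ a, ((tangentBundleCore 𝓘(ℂ, Cn n) M).localTriv ⟨φ, hφ⟩).symm (φ.symm z) a =
      frame φ z a := fun a => by
    have h := localTriv_symm_eq_frame hφ (φ.map_target hz) a
    rwa [φ.right_inv hz] at h
  exact (congrArg₂ (fun v w : Cn n => g.form (φ.symm z) v w) (h3 _) (h3 _)).symm

/-- The determinant of the matrix of a metric in a chart, as a function on `M`. -/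
def detMetric (g : TangentHermitianMetric n M) (φ : OpenPartialHomeomorph M (Cn n)) (x : M) : ℝ :=
  (metricMatrix g φ (φ x)).det.re

lemma contDiffOn_det_metricMatrix (g : TangentHermitianMetric n M) (hφ : φ ∈ atlas (Cn n) M) :
    ContDiffOn ℝ ∞ (fun z => (metricMatrix g φ z).det.re) φ.target := by
  simp only [Matrix.det_apply']
  exact Complex.reCLM.contDiff.comp_contDiffOn (ContDiffOn.sum fun σ _ => contDiffOn_const.mul
    (contDiffOn_prod fun i _ => contDiffOn_metricMatrix g hφ _ _))

lemma contMDiffOn_detMetric (g : TangentHermitianMetric n M) (hφ : φ ∈ atlas (Cn n) M) :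
    ContMDiffOn 𝓘(ℝ, Cn n) 𝓘(ℝ, ℝ) ∞ (detMetric g φ) φ.source := by
  have := isManifold_real (n := n) (M := M)
  exact (contDiffOn_det_metricMatrix g hφ).contMDiffOn.comp
    (contMDiffOn_of_mem_maximalAtlas (IsManifold.subset_maximalAtlas hφ)) fun x hx => φ.map_source hx

lemma detMetric_pos (g : TangentHermitianMetric n M) (hφ : φ ∈ atlas (Cn n) M) {x : M}
    (hx : x ∈ φ.source) : 0 < detMetric g φ x := (det_metricMatrix g hφ (φ.map_source hx)).1

lemma detMetric_transition (g : TangentHermitianMetric n M) (hφ : φ ∈ atlas (Cn n) M)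
    (hψ : ψ ∈ atlas (Cn n) M) {x : M} (hx : x ∈ φ.source) (hx' : x ∈ ψ.source) :
    detMetric g φ x =
      Complex.normSq (fderiv ℂ (ψ ∘ φ.symm) (φ x)).det * detMetric g ψ x := by
  have h1 := metricMatrix_transition g hφ hψ (φ.map_source hx) (by rwa [φ.left_inv hx])
  have h2 := (det_metricMatrix g hψ (ψ.map_source hx')).2
  rw [detMetric, h1, Matrix.det_mul, Matrix.det_mul, Matrix.det_conjTranspose, det_jac, φ.left_inv hx,
    h2, mul_right_comm, Complex.star_def, Complex.mul_conj, ← Complex.ofReal_mul, Complex.ofReal_re]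
  rfl

/-- The inverses of the determinants of a Hermitian metric are the weights of a metric on `K_M`. -/
lemma isWeightFamily_detMetric (g : TangentHermitianMetric n M) :
    IsWeightFamily (n := n) (canonicalCore n M) fun i x => (detMetric g i.1 x)⁻¹ where
  pos i x hx := inv_pos.2 (detMetric_pos g i.2 hx)
  smooth i x hx := (contMDiffOn_detMetric g i.2 x hx).inv₀ (detMetric_pos g i.2 hx).ne'
  change i j x hx := by
    have hc : (canonicalCore n M).coordChange i j x 1 =
        (fderiv ℂ (i.1 ∘ j.1.symm) (j.1 x)).det := by
      simp [canonicalCore, tangentBundleCore, fderivWithin_univ]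
    have h0 : Complex.normSq (fderiv ℂ (i.1 ∘ j.1.symm) (j.1 x)).det ≠ 0 := by
      rw [← hc]
      simpa using lineCore_ne_zero _ hx
    rw [hc, detMetric_transition g j.2 i.2 hx.2 hx.1, mul_inv, mul_inv_cancel_left₀ h0]

lemma chernRicci_eq (g : TangentHermitianMetric n M) (x : M) :
    chernRicci g x = -iddbar n (fun y => Real.log (detMetric g (chartAt (Cn n) x) y)) x := rfl

end Frames

/-! ### Bott–Chern class, Ricci-flat metrics and flat metrics on the canonical bundle -/

section BottChernClass

variable {n : ℕ} {M : Type*} [TopologicalSpace M] [ChartedSpace (Cn n) M]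
  [IsManifold 𝓘(ℂ, Cn n) ω M]

lemma contMDiffAt_log_detMetric (g : TangentHermitianMetric n M)
    {φ : OpenPartialHomeomorph M (Cn n)} (hφ : φ ∈ atlas (Cn n) M) {x : M} (hx : x ∈ φ.source) :
    ContMDiffAt 𝓘(ℝ, Cn n) 𝓘(ℝ, ℝ) ∞ (fun y => Real.log (detMetric g φ y)) x :=
  (Real.contDiffAt_log.2 (detMetric_pos g hφ hx).ne').contMDiffAt.comp x
    ((contMDiffOn_detMetric g hφ).contMDiffAt (φ.open_source.mem_nhds hx))

/-- The metric induced on `K_M` by a Hermitian metric on `M` has curvature `-Ric`. -/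
lemma curvature_canonical (g : TangentHermitianMetric n M) (x : M) :
    (HermitianMetric.ofWeights (isWeightFamily_detMetric g)).curvature x = -chernRicci g x := by
  rw [HermitianMetric.ofWeights_curvature, chernRicci_eq]
  congr 1
  exact iddbar_log_inv (contMDiffAt_log_detMetric g (chart_mem_atlas (Cn n) x)
    (mem_chart_source (Cn n) x))

/-- The metric induced on the anticanonical bundle by a Hermitian metric on `M` has curvature
`Ric`. -/
lemma curvature_anticanonical (g : TangentHermitianMetric n M) (x : M) :
    (HermitianMetric.ofWeights (isWeightFamily_detMetric g).inv).curvature x = chernRicci g x := by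
  rw [HermitianMetric.ofWeights_curvature, chernRicci_eq]
  simp only [inv_inv]
  rfl

lemma curvature_dual {ι : Type*} {Z : VectorBundleCore ℂ M ℂ ι} [Z.IsContMDiff 𝓘(ℂ, Cn n) ω]
    (h : HermitianMetric n ℂ Z.Fiber) (x : M) :
    (HermitianMetric.ofWeights h.isWeightFamily.inv).curvature x = -h.curvature x := by
  rw [HermitianMetric.ofWeights_curvature, h.curvature_eq_weight]
  congr 1
  exact iddbar_log_inv (h.isWeightFamily.contMDiffAt_log (Z.mem_baseSet_at x))

variable [CompactSpace M] [T2Space M]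

lemma manifoldBottChernClass_eq_zero (h : HermitianMetric n ℂ (CanonicalBundle n M))
    (hh : ∀ x, h.curvature x = 0) : manifoldBottChernClass n M = 0 := by
  rw [manifoldBottChernClass,
    firstBottChernClass_eq (HermitianMetric.ofWeights h.isWeightFamily.inv)]
  have : (HermitianMetric.ofWeights h.isWeightFamily.inv).curvatureForm =
      (0 : closedReal11Forms n M) := by
    apply Subtype.ext
    funext x
    refine (curvature_dual h x).trans ?_
    rw [hh x]
    ext v
    exact neg_zero
  rw [this]
  rfl

/-- The conformal metric `e^u g`. -/
def conformalMetric (g : TangentHermitianMetric n M) (u : M → ℝ)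
    (hu : ContMDiff 𝓘(ℝ, Cn n) 𝓘(ℝ, ℝ) ∞ u) : TangentHermitianMetric n M where
  form x := ((Real.exp (u x) : ℝ) : ℂ) • g.form x
  conj_form x v w := by
    simp only [LinearMap.smul_apply, smul_eq_mul, map_mul, Complex.conj_ofReal, g.conj_form]
  pos x v hv := by
    simp only [LinearMap.smul_apply, smul_eq_mul, Complex.re_ofReal_mul]
    exact mul_pos (Real.exp_pos _) (g.pos x v hv)
  smooth e he a b := by
    have h1 : ContMDiff 𝓘(ℝ, Cn n) 𝓘(ℝ, ℝ) ∞ fun x => Real.exp (u x) :=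
      Real.contDiff_exp.contMDiff.comp hu
    exact (h1.contMDiffOn.smul (g.smooth e a b)).congr fun x _ => by simp

lemma detMetric_conformal (g : TangentHermitianMetric n M) {u : M → ℝ}
    (hu : ContMDiff 𝓘(ℝ, Cn n) 𝓘(ℝ, ℝ) ∞ u) {φ : OpenPartialHomeomorph M (Cn n)} {x : M}
    (hx : x ∈ φ.source) :
    detMetric (conformalMetric g u hu) φ x = Real.exp (n * u x) * detMetric g φ x := by
  have h1 : metricMatrix (conformalMetric g u hu) φ (φ x) =
      ((Real.exp (u x) : ℝ) : ℂ) • metricMatrix g φ (φ x) := by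
    ext j k
    change ((Real.exp (u (φ.symm (φ x))) : ℝ) : ℂ) * metricMatrix g φ (φ x) j k =
      ((Real.exp (u x) : ℝ) : ℂ) * metricMatrix g φ (φ x) j k
    rw [φ.left_inv hx]
  rw [detMetric, h1, Matrix.det_smul, Fintype.card_fin, ← Complex.ofReal_pow,
    Complex.re_ofReal_mul, ← Real.exp_nat_mul]
  rfl

/-- If `c₁^{BC}(M) = 0`, the Ricci form of any Hermitian metric is `i∂∂̄u`, and the metric becomes
Ricci-flat when it is multiplied by `e^{u/n}`. -/
lemma exists_chernRicci_eq_zero (h : manifoldBottChernClass n M = 0) :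
    ∃ g : TangentHermitianMetric n M, ∀ x, chernRicci g x = 0 := by
  have : ContMDiffVectorBundle ω (Cn n) (TangentSpace 𝓘(ℂ, Cn n) : M → Type _) 𝓘(ℂ, Cn n) :=
    TangentBundle.contMDiffVectorBundle (n := ω)
  obtain ⟨g⟩ := HermitianMetric.nonempty (n := n) (F := Cn n)
    (TangentSpace 𝓘(ℂ, Cn n) : M → Type _)
  rcases Nat.eq_zero_or_pos n with rfl | hn
  · refine ⟨g, fun x => ?_⟩
    ext v
    have hv : v 0 = 0 := Subsingleton.elim (α := Cn 0) _ _
    rw [ContinuousAlternatingMap.map_coord_zero _ 0 hv]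
    rfl
  rw [manifoldBottChernClass, firstBottChernClass_eq
    (HermitianMetric.ofWeights (isWeightFamily_detMetric g).inv),
    Submodule.Quotient.mk_eq_zero] at h
  obtain ⟨u, hu, hu'⟩ := h
  have hv : ContMDiff 𝓘(ℝ, Cn n) 𝓘(ℝ, ℝ) ∞ ((n : ℝ)⁻¹ • u) :=
    (contDiff_const_smul (n : ℝ)⁻¹).contMDiff.comp hu
  refine ⟨conformalMetric g _ hv, fun x => ?_⟩
  have hx := mem_chart_source (Cn n) x
  have h1 : chernRicci g x = iddbar n u x :=
    (curvature_anticanonical g x).symm.trans (congrFun hu' x)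
  have h2 : (fun y => Real.log (detMetric (conformalMetric g _ hv) (chartAt (Cn n) x) y)) =ᶠ[𝓝 x]
      u + fun y => Real.log (detMetric g (chartAt (Cn n) x) y) := by
    filter_upwards [(chartAt (Cn n) x).open_source.mem_nhds hx] with y hy
    rw [detMetric_conformal g hv hy, Real.log_mul (Real.exp_pos _).ne'
      (detMetric_pos g (chart_mem_atlas (Cn n) x) hy).ne', Real.log_exp]
    have hn' : (n : ℝ) ≠ 0 := by exact_mod_cast hn.ne'
    simp [mul_inv_cancel_left₀ hn']
  rw [chernRicci_eq, iddbar_congr h2, iddbar_add hu.contMDiffAt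
    (contMDiffAt_log_detMetric g (chart_mem_atlas (Cn n) x) hx), ← h1, chernRicci_eq,
    neg_add_cancel]
  ext v
  exact neg_zero

end BottChernClass

/-! ### Torsion canonical bundles -/

section Torsion

variable {n : ℕ} {M : Type*} [TopologicalSpace M] [ChartedSpace (Cn n) M]
  [IsManifold 𝓘(ℂ, Cn n) ω M] {ι : Type*}

/-- In the local frames of a line bundle, a holomorphic trivialization is given by nonvanishing
holomorphic functions. -/
lemma exists_trivializing_functions {Z : VectorBundleCore ℂ M ℂ ι} [Z.IsContMDiff 𝓘(ℂ, Cn n) ω]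
    (h : HolomorphicallyIsomorphic n Z.Fiber (Bundle.Trivial M ℂ)) :
    ∃ f : ι → M → ℂ, (∀ i, ∀ x ∈ Z.baseSet i, f i x ≠ 0) ∧
      (∀ i, ContMDiffOn 𝓘(ℂ, Cn n) 𝓘(ℂ, ℂ) ω (f i) (Z.baseSet i)) ∧
      ∀ i j, ∀ x ∈ Z.baseSet i ∩ Z.baseSet j, f i x = Z.coordChange i j x 1 * f j x := by
  obtain ⟨Φ, hΦ, -⟩ := h
  let Ψ : ∀ x, ℂ ≃ₗ[ℂ] ℂ := fun x => Φ x
  refine ⟨fun i x => Ψ x (Z.coordChange i (Z.indexAt x) x 1), fun i x hx => ?_, fun i => ?_,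
    fun i j x hx => ?_⟩
  · rw [Ne, LinearEquiv.map_eq_zero_iff]
    exact lineCore_ne_zero Z ⟨hx, Z.mem_baseSet_at x⟩
  · have h1 : ContMDiffOn 𝓘(ℂ, Cn n) (𝓘(ℂ, Cn n).prod 𝓘(ℂ, ℂ)) ω
        (fun x => (Z.localTriv i).toOpenPartialHomeomorph.symm (x, (1 : ℂ))) (Z.baseSet i) := by
      refine (Trivialization.contMDiffOn_symm (IB := 𝓘(ℂ, Cn n)) (n := ω) (Z.localTriv i)).comp
        (contMDiffOn_id.prodMk contMDiffOn_const) fun x hx => ?_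
      exact (Z.mem_localTriv_target i (x, 1)).2 hx
    have h2 := hΦ.comp_contMDiffOn h1
    intro x hx
    have h3 := (Bundle.contMDiffWithinAt_totalSpace.1 (h2 x hx)).2
    exact h3
  · beta_reduce
    rw [← lineCore_mul Z hx.1 hx.2 (Z.mem_baseSet_at x), ← smul_eq_mul, map_smul, smul_eq_mul]

lemma contDiffAt_log_normSq {w : ℂ} (hw : w ≠ 0) :
    ContDiffAt ℝ ∞ (fun w : ℂ => Real.log (Complex.normSq w)) w := by
  refine ContDiffAt.log ?_ (by simpa using hw)
  have h3 : (Complex.normSq : ℂ → ℝ) = fun w => ‖w‖ ^ 2 := by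
    funext w; exact Complex.normSq_eq_norm_sq w
  rw [h3]
  exact (contDiff_norm_sq ℝ).contDiffAt

lemma contMDiffAt_log_normSq {f : M → ℂ} {x : M} (hf : ContMDiffAt 𝓘(ℂ, Cn n) 𝓘(ℂ, ℂ) ω f x)
    (h0 : f x ≠ 0) :
    ContMDiffAt 𝓘(ℝ, Cn n) 𝓘(ℝ, ℝ) ∞ (fun y => Real.log (Complex.normSq (f y))) x :=
  (contDiffAt_log_normSq h0).contMDiffAt.comp x
    ((contMDiffAt_restrictScalars hf).of_le (n := ω) (m := ∞) le_top)

/-- A holomorphic trivialization of `L^l` makes the `l`-th root of the trivial metric a flat metric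
on `L`. -/
lemma exists_flat_metric_of_torsion (Z : VectorBundleCore ℂ M ℂ ι) [Z.IsContMDiff 𝓘(ℂ, Cn n) ω]
    {l : ℕ} (hl : 1 ≤ l)
    (h : HolomorphicallyIsomorphic n (tensorPowerCore Z l).Fiber (Bundle.Trivial M ℂ)) :
    ∃ h : HermitianMetric n ℂ Z.Fiber, ∀ x, h.curvature x = 0 := by
  obtain ⟨f, hf0, hf, hfc⟩ := exists_trivializing_functions (n := n) h
  have hlog : ∀ i, ∀ x ∈ Z.baseSet i, ContMDiffAt 𝓘(ℝ, Cn n) 𝓘(ℝ, ℝ) ∞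
      (fun y => Real.log (Complex.normSq (f i y))) x := fun i x hx =>
    contMDiffAt_log_normSq ((hf i).contMDiffAt ((Z.isOpen_baseSet i).mem_nhds hx)) (hf0 i x hx)
  have hl' : (l : ℝ) ≠ 0 := by exact_mod_cast (Nat.one_le_iff_ne_zero.1 hl)
  have hρ : IsWeightFamily (n := n) Z
      fun i x => Real.exp ((l : ℝ)⁻¹ * Real.log (Complex.normSq (f i x))) := by
    refine ⟨fun i x _ => Real.exp_pos _, fun i x hx => ?_, fun i j x hx => ?_⟩
    · have h1 : ContDiff ℝ ∞ fun t : ℝ => Real.exp ((l : ℝ)⁻¹ * t) :=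
        Real.contDiff_exp.comp (contDiff_const.mul contDiff_id)
      exact (h1.contMDiff.contMDiffAt.comp x (hlog i x hx)).contMDiffWithinAt
    · have hc : (tensorPowerCore Z l).coordChange i j x 1 = Z.coordChange i j x 1 ^ l := by
        simp [tensorPowerCore]
      have hc0 := lineCore_ne_zero Z hx
      rw [hfc i j x hx, hc, Complex.normSq_mul, map_pow,
        Real.log_mul (pow_ne_zero _ (by simpa using hc0)) (by simpa using hf0 j x hx.2),
        Real.log_pow, mul_add, inv_mul_cancel_left₀ hl', Real.exp_add,
        Real.exp_log (Complex.normSq_pos.2 hc0)]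
  refine ⟨HermitianMetric.ofWeights hρ, fun x => ?_⟩
  have hx := Z.mem_baseSet_at x
  have h1 : (fun y => Real.log (Real.exp ((l : ℝ)⁻¹ *
      Real.log (Complex.normSq (f (Z.indexAt x) y))))) =
      (l : ℝ)⁻¹ • fun y => Real.log (Complex.normSq (f (Z.indexAt x) y)) := by
    funext y
    simp
  rw [HermitianMetric.ofWeights_curvature, h1, iddbar_smul _ (hlog _ x hx),
    iddbar_log_normSq ((hf _).contMDiffAt ((Z.isOpen_baseSet _).mem_nhds hx)) (hf0 _ x hx),
    smul_zero]
  ext v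
  exact neg_zero

end Torsion

/-! ### The derivative of a determinant -/

section DetDeriv

variable {m : Type*} [Fintype m] [DecidableEq m] {E : Type*} [NormedAddCommGroup E]
  [NormedSpace ℝ E]

/-- Jacobi's formula `d(det X) = tr(adj X · dX)`. -/
lemma hasFDerivAt_det {X : E → Matrix m m ℂ} {X' : Matrix m m (E →L[ℝ] ℂ)} {z : E}
    (h : ∀ i j, HasFDerivAt (fun w => X w i j) (X' i j) z) :
    HasFDerivAt (fun w => (X w).det) (∑ j, ∑ i, (X z).adjugate j i • X' i j) z := by
  have h1 : HasFDerivAt (fun w => ∑ σ : Equiv.Perm m, (Equiv.Perm.sign σ : ℂ) * ∏ i, X w (σ i) i)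
      (∑ σ : Equiv.Perm m, (Equiv.Perm.sign σ : ℂ) •
        ∑ j, (∏ i ∈ Finset.univ.erase j, X z (σ i) i) • X' (σ j) j) z :=
    HasFDerivAt.fun_sum fun σ _ =>
      (HasFDerivAt.finsetProd fun i _ => h (σ i) i).const_mul _
  simp only [Matrix.det_apply']
  refine h1.congr_fderiv ?_
  ext a
  simp only [_root_.sum_apply, _root_.smul_apply, smul_eq_mul,
    Finset.mul_sum]
  rw [Finset.sum_comm]
  refine Finset.sum_congr rfl fun j _ => ?_
  have h2 : ∑ i, (X z).adjugate j i * X' i j a =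
      ((X z).updateCol j fun i => X' i j a).det := by
    rw [← Matrix.cramer_apply, Matrix.cramer_eq_adjugate_mulVec]
    rfl
  rw [h2, Matrix.det_apply']
  refine Finset.sum_congr rfl fun σ _ => ?_
  congr 1
  rw [← Finset.mul_prod_erase _ _ (Finset.mem_univ j), Matrix.updateCol_self, mul_comm]
  congr 1
  refine Finset.prod_congr rfl fun i hi => ?_
  rw [Matrix.updateCol_ne (Finset.ne_of_mem_erase hi)]

/-- Liouville's formula: if `X' = -X A`, then `(det X)' = -tr A · det X`. -/
lemma hasDerivAt_det_of_linear {X : ℝ → Matrix m m ℂ} {A : Matrix m m ℂ} {t : ℝ}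
    (h : ∀ i j, HasDerivAt (fun τ => X τ i j) (-(X t * A) i j) t) :
    HasDerivAt (fun τ => (X τ).det) (-(A.trace * (X t).det)) t := by
  have h1 := (hasFDerivAt_det fun i j => (h i j).hasFDerivAt).hasDerivAt
  refine h1.congr_deriv ?_
  have h2 : ∑ j, ∑ i, (X t).adjugate j i * (X t * A) i j = A.trace * (X t).det := by
    have : ∑ j, ∑ i, (X t).adjugate j i * (X t * A) i j = ((X t).adjugate * (X t * A)).trace := rfl
    rw [this, ← Matrix.mul_assoc, Matrix.adjugate_mul, Matrix.smul_mul, Matrix.one_mul,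
      Matrix.trace_smul, smul_eq_mul, mul_comm]
  rw [← h2]
  simp

end DetDeriv

/-! ### The operator `∂` -/

section Del

variable {n : ℕ} {f g : Cn n → ℂ} {z : Cn n}

lemma del_congr (h : f =ᶠ[𝓝 z] g) (a : Cn n) : del f z a = del g z a := by
  simp only [del, h.fderiv_eq]

lemma del_mul (hf : DifferentiableAt ℝ f z) (hg : DifferentiableAt ℝ g z) (a : Cn n) :
    del (fun w => f w * g w) z a = del f z a * g z + f z * del g z a := by
  simp only [del, fderiv_fun_mul hf hg, _root_.add_apply,
    _root_.smul_apply, smul_eq_mul]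
  ring

lemma del_sum {ι : Type*} (s : Finset ι) {F : ι → Cn n → ℂ}
    (hF : ∀ i ∈ s, DifferentiableAt ℝ (F i) z) (a : Cn n) :
    del (fun w => ∑ i ∈ s, F i w) z a = ∑ i ∈ s, del (F i) z a := by
  simp only [del, (HasFDerivAt.fun_sum fun i hi => (hF i hi).hasFDerivAt).fderiv,
    _root_.sum_apply, Finset.mul_sum, ← Finset.sum_sub_distrib]

lemma del_holomorphic (hf : DifferentiableAt ℂ f z) (a : Cn n) : del f z a = fderiv ℂ f z a := by
  simp only [del, hf.fderiv_restrictScalars ℝ, ContinuousLinearMap.coe_restrictScalars', map_smul,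
    smul_eq_mul]
  linear_combination -(1 / 2) * fderiv ℂ f z a * Complex.I_mul_I

lemma fderiv_conj (hf : DifferentiableAt ℝ f z) (a : Cn n) :
    fderiv ℝ (fun w => conj (f w)) z a = conj (fderiv ℝ f z a) := by
  have h : HasFDerivAt (fun w => conj (f w))
      ((Complex.conjCLE : ℂ →L[ℝ] ℂ).comp (fderiv ℝ f z)) z :=
    (Complex.conjCLE : ℂ →L[ℝ] ℂ).hasFDerivAt.comp z hf.hasFDerivAt
  rw [h.fderiv]
  rfl

lemma fderiv_eq_del_add (hf : DifferentiableAt ℝ f z) (a : Cn n) :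
    fderiv ℝ f z a = del f z a + conj (del (fun w => conj (f w)) z a) := by
  simp only [del, fderiv_conj hf, map_mul, map_sub, Complex.conj_conj, Complex.conj_I, map_div₀,
    map_one, map_ofNat]
  ring

lemma del_conj_holomorphic (hf : DifferentiableAt ℂ f z) (a : Cn n) :
    del (fun w => conj (f w)) z a = 0 := by
  simp only [del, fderiv_conj (hf.restrictScalars ℝ), hf.fderiv_restrictScalars ℝ,
    ContinuousLinearMap.coe_restrictScalars', map_smul, smul_eq_mul, map_mul, Complex.conj_I]
  linear_combination (1 / 2) * conj (fderiv ℂ f z a) * Complex.I_mul_I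

lemma del_comp {T : Cn n → Cn n} (hf : DifferentiableAt ℝ f (T z)) (hT : DifferentiableAt ℂ T z)
    (a : Cn n) : del (fun w => f (T w)) z a = del f (T z) (fderiv ℂ T z a) := by
  have h : fderiv ℝ (fun w => f (T w)) z = (fderiv ℝ f (T z)).comp (fderiv ℝ T z) :=
    fderiv_comp z hf (hT.restrictScalars ℝ)
  simp only [del, h, ContinuousLinearMap.comp_apply, hT.fderiv_restrictScalars ℝ,
    ContinuousLinearMap.coe_restrictScalars', map_smul]

/-- Entrywise application of `∂` to a matrix of functions. -/
def delMatrix (X : Cn n → Matrix (Fin n) (Fin n) ℂ) (z a : Cn n) : Matrix (Fin n) (Fin n) ℂ :=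
  Matrix.of fun j k => del (fun w => X w j k) z a

lemma delMatrix_congr {X Y : Cn n → Matrix (Fin n) (Fin n) ℂ} (h : X =ᶠ[𝓝 z] Y) (a : Cn n) :
    delMatrix X z a = delMatrix Y z a := by
  ext j k
  exact del_congr (h.mono fun w hw => by simp only [hw]) a

lemma differentiableAt_matrix_mul {X Y : Cn n → Matrix (Fin n) (Fin n) ℂ}
    (hX : ∀ j k, DifferentiableAt ℝ (fun w => X w j k) z)
    (hY : ∀ j k, DifferentiableAt ℝ (fun w => Y w j k) z) (j k : Fin n) :
    DifferentiableAt ℝ (fun w => (X w * Y w) j k) z := by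
  simp only [Matrix.mul_apply]
  exact DifferentiableAt.fun_sum fun i _ => (hX j i).mul (hY i k)

lemma delMatrix_mul {X Y : Cn n → Matrix (Fin n) (Fin n) ℂ}
    (hX : ∀ j k, DifferentiableAt ℝ (fun w => X w j k) z)
    (hY : ∀ j k, DifferentiableAt ℝ (fun w => Y w j k) z) (a : Cn n) :
    delMatrix (fun w => X w * Y w) z a = delMatrix X z a * Y z + X z * delMatrix Y z a := by
  ext j k
  simp only [delMatrix, Matrix.of_apply, Matrix.mul_apply, Matrix.add_apply]
  rw [← Finset.sum_add_distrib]
  refine (del_sum Finset.univ (F := fun i w => X w j i * Y w i k)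
    (fun i _ => (hX j i).mul (hY i k)) a).trans ?_
  exact Finset.sum_congr rfl fun i _ => del_mul (hX j i) (hY i k) a

lemma del_det {X : Cn n → Matrix (Fin n) (Fin n) ℂ}
    (hX : ∀ j k, DifferentiableAt ℝ (fun w => X w j k) z) (a : Cn n) :
    del (fun w => (X w).det) z a = ((X z).adjugate * delMatrix X z a).trace := by
  have h := hasFDerivAt_det (X' := fun j k => fderiv ℝ (fun w => X w j k) z)
    fun j k => (hX j k).hasFDerivAt
  simp only [del, h.fderiv, Matrix.trace, Matrix.diag_apply, Matrix.mul_apply, delMatrix,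
    Matrix.of_apply, _root_.sum_apply, _root_.smul_apply, smul_eq_mul,
    Finset.mul_sum, ← Finset.sum_sub_distrib]
  refine Finset.sum_congr rfl fun j _ => Finset.sum_congr rfl fun k _ => ?_
  ring

/-- The real 1-form `du` of a real function gives the complex 1-form `∂u`, as a real-linear map. -/
def delReal (u : Cn n → ℝ) (z : Cn n) : Cn n →L[ℝ] ℂ :=
  (1 / 2 : ℂ) • (Complex.ofRealCLM.comp (fderiv ℝ u z) -
    Complex.I • Complex.ofRealCLM.comp ((fderiv ℝ u z).comp (mulI n)))

lemma delReal_apply (u : Cn n → ℝ) (z a : Cn n) :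
    delReal u z a = (1 / 2) * (fderiv ℝ u z a - Complex.I * fderiv ℝ u z (Complex.I • a)) := by
  simp [delReal]

end Del

/-! ### The Chern connection -/

section Connection

variable {n : ℕ} {M : Type*} [TopologicalSpace M] [ChartedSpace (Cn n) M]
  [IsManifold 𝓘(ℂ, Cn n) ω M] {φ ψ : OpenPartialHomeomorph M (Cn n)}

lemma differentiableAt_metricMatrix (g : TangentHermitianMetric n M) (hφ : φ ∈ atlas (Cn n) M)
    {z : Cn n} (hz : z ∈ φ.target) (j k : Fin n) :
    DifferentiableAt ℝ (fun w => metricMatrix g φ w j k) z :=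
  ((contDiffOn_metricMatrix g hφ j k).contDiffAt (φ.open_target.mem_nhds hz)).differentiableAt
    (by simp)

lemma connection_mul_metricMatrix (g : TangentHermitianMetric n M) (hφ : φ ∈ atlas (Cn n) M)
    {z : Cn n} (hz : z ∈ φ.target) (a : Cn n) :
    chernConnectionMatrix g φ z a * metricMatrix g φ z = delMatrix (metricMatrix g φ) z a := by
  rw [chernConnectionMatrix, Matrix.mul_assoc,
    Matrix.nonsing_inv_mul _ (isUnit_det_metricMatrix g hφ hz), Matrix.mul_one]
  rfl

lemma contDiffAt_jac {T : Cn n → Cn n} {z : Cn n} (hT : ContDiffAt ℂ ω T z) (j k : Fin n) :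
    ContDiffAt ℂ ω (fun w => jac T w j k) z := by
  have h1 : ContDiffAt ℂ ω (fun w => fderiv ℂ T w (EuclideanSpace.single j 1)) z :=
    (hT.fderiv_right (m := ω) (by simp)).clm_apply contDiffAt_const
  exact (EuclideanSpace.proj (𝕜 := ℂ) k : Cn n →L[ℂ] ℂ).contDiff.contDiffAt.comp z h1

/-- The transformation rule `A^φ(a) J = ∂J(a) + J A^ψ(T'a)` of the Chern connection under a change
of charts `T` with Jacobian matrix `J`. -/
lemma connection_transition (g : TangentHermitianMetric n M) (hφ : φ ∈ atlas (Cn n) M)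
    (hψ : ψ ∈ atlas (Cn n) M) {z : Cn n} (hz : z ∈ φ.target) (hz' : φ.symm z ∈ ψ.source)
    (a : Cn n) :
    chernConnectionMatrix g φ z a * jac (ψ ∘ φ.symm) z =
      delMatrix (jac (ψ ∘ φ.symm)) z a + jac (ψ ∘ φ.symm) z *
        chernConnectionMatrix g ψ (ψ (φ.symm z)) (fderiv ℂ (ψ ∘ φ.symm) z a) := by
  set T := ψ ∘ φ.symm with hT
  have hTz : ψ (φ.symm z) = T z := rfl
  have hTt : T z ∈ ψ.target := ψ.map_source hz'
  have hTd : ContDiffAt ℂ ω T z := contDiffAt_transition hφ hψ hz hz'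
  have hJ : ∀ j k, DifferentiableAt ℂ (fun w => jac T w j k) z := fun j k =>
    (contDiffAt_jac hTd j k).differentiableAt (by simp)
  have hJr : ∀ j k, DifferentiableAt ℝ (fun w => jac T w j k) z := fun j k =>
    (hJ j k).restrictScalars ℝ
  have hJc : ∀ j k, DifferentiableAt ℝ (fun w => (jac T w).conjTranspose j k) z := fun j k =>
    (Complex.conjCLE : ℂ →L[ℝ] ℂ).differentiableAt.comp z (hJr k j)
  have hG : ∀ j k, DifferentiableAt ℝ (fun w => metricMatrix g ψ (T w) j k) z := fun j k =>
    (differentiableAt_metricMatrix g hψ hTt j k).comp z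
      ((hTd.differentiableAt (by simp)).restrictScalars ℝ)
  have hev : metricMatrix g φ =ᶠ[𝓝 z]
      fun w => (jac T w * metricMatrix g ψ (T w)) * (jac T w).conjTranspose := by
    filter_upwards [φ.open_target.mem_nhds hz,
      (φ.continuousAt_symm hz).eventually (ψ.open_source.mem_nhds hz')] with w hw hw'
    exact metricMatrix_transition g hφ hψ hw hw'
  have h1 : delMatrix (fun w => (jac T w).conjTranspose) z a = 0 := by
    ext j k
    exact del_conj_holomorphic (hJ k j) a
  have h2 : delMatrix (fun w => metricMatrix g ψ (T w)) z a =
      delMatrix (metricMatrix g ψ) (T z) (fderiv ℂ T z a) := by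
    ext j k
    exact del_comp (differentiableAt_metricMatrix g hψ hTt j k) (hTd.differentiableAt (by simp)) a
  have h3 : delMatrix (metricMatrix g φ) z a =
      (delMatrix (jac T) z a * metricMatrix g ψ (T z) +
        jac T z * delMatrix (metricMatrix g ψ) (T z) (fderiv ℂ T z a)) *
        (jac T z).conjTranspose := by
    rw [delMatrix_congr hev, delMatrix_mul (differentiableAt_matrix_mul hJr hG) hJc,
      delMatrix_mul hJr hG, h1, h2, Matrix.mul_zero, add_zero]
  have h4 := metricMatrix_transition g hφ hψ hz hz'
  rw [← connection_mul_metricMatrix g hφ hz, ← connection_mul_metricMatrix g hψ hTt, h4] at h3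
  have hu : IsUnit (metricMatrix g ψ (T z) * (jac T z).conjTranspose) := by
    rw [Matrix.isUnit_iff_isUnit_det]
    have h5 := isUnit_det_metricMatrix g hφ hz
    rw [h4, Matrix.mul_assoc, Matrix.det_mul] at h5
    exact isUnit_of_mul_isUnit_right h5
  refine hu.mul_right_cancel ?_
  rw [hTz] at h3 ⊢
  simp only [Matrix.mul_assoc, Matrix.add_mul] at h3 ⊢
  exact h3

/-- The trace of the Chern connection is `∂ log det G`. -/
lemma trace_connection (g : TangentHermitianMetric n M) (hφ : φ ∈ atlas (Cn n) M) {z : Cn n}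
    (hz : z ∈ φ.target) (a : Cn n) :
    (chernConnectionMatrix g φ z a).trace =
      delReal (fun w => Real.log (metricMatrix g φ w).det.re) z a := by
  set d : Cn n → ℝ := fun w => (metricMatrix g φ w).det.re with hd
  have hd0 : 0 < d z := (det_metricMatrix g hφ hz).1
  have hdd : DifferentiableAt ℝ d z := ((contDiffOn_det_metricMatrix g hφ).contDiffAt
    (φ.open_target.mem_nhds hz)).differentiableAt (by simp)
  have hdet : (metricMatrix g φ z).det = (d z : ℂ) := (det_metricMatrix g hφ hz).2
  have h1 := del_det (differentiableAt_metricMatrix g hφ hz) a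
  rw [← connection_mul_metricMatrix g hφ hz, Matrix.trace_mul_comm, Matrix.mul_assoc,
    Matrix.mul_adjugate, Matrix.mul_smul, Matrix.mul_one, Matrix.trace_smul, hdet, smul_eq_mul] at h1
  have hev : (fun w => (metricMatrix g φ w).det) =ᶠ[𝓝 z] fun w => (d w : ℂ) := by
    filter_upwards [φ.open_target.mem_nhds hz] with w hw
    exact (det_metricMatrix g hφ hw).2
  have h2 : fderiv ℝ (fun w => (d w : ℂ)) z = Complex.ofRealCLM.comp (fderiv ℝ d z) :=
    (Complex.ofRealCLM.hasFDerivAt.comp z hdd.hasFDerivAt).fderiv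
  have h3 : fderiv ℝ (fun w => Real.log (d w)) z = (d z)⁻¹ • fderiv ℝ d z :=
    (hdd.hasFDerivAt.log hd0.ne').fderiv
  have hd0' : (d z : ℂ) ≠ 0 := by exact_mod_cast hd0.ne'
  rw [del_congr hev, del, h2] at h1
  rw [delReal_apply, h3]
  refine mul_left_cancel₀ hd0' (h1.symm.trans ?_)
  simp only [ContinuousLinearMap.comp_apply, _root_.smul_apply, smul_eq_mul,
    Complex.ofRealCLM_apply, Complex.ofReal_mul, Complex.ofReal_inv]
  field_simp

end Connection

/-! ### Pluriharmonic functions -/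

section Pluriharmonic

variable {n : ℕ} {u : Cn n → ℝ} {z : Cn n}

lemma contDiffAt_delReal (h : ContDiffAt ℝ ∞ u z) : ContDiffAt ℝ ∞ (delReal u) z := by
  have h1 : ContDiffAt ℝ ∞ (fderiv ℝ u) z := h.fderiv_right (m := ∞) (by simp)
  have h2 : ContDiffAt ℝ ∞ (fun w => Complex.ofRealCLM.comp (fderiv ℝ u w)) z :=
    contDiffAt_const.clm_comp h1
  have h3 : ContDiffAt ℝ ∞ (fun w => Complex.ofRealCLM.comp ((fderiv ℝ u w).comp (mulI n))) z :=
    contDiffAt_const.clm_comp (h1.clm_comp contDiffAt_const)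
  exact (h2.sub (h3.const_smul Complex.I)).const_smul (1 / 2 : ℂ)

lemma fderiv_delReal (h : ContDiffAt ℝ ∞ u z) (a b : Cn n) :
    fderiv ℝ (delReal u) z a b = (1 / 2) * (fderiv ℝ (fderiv ℝ u) z a b -
      Complex.I * fderiv ℝ (fderiv ℝ u) z a (Complex.I • b)) := by
  have h1 : DifferentiableAt ℝ (delReal u) z := (contDiffAt_delReal h).differentiableAt (by simp)
  have h2 := ((h.fderiv_right (m := ∞) (by simp)).differentiableAt (by simp)).hasFDerivAt
  have h3 : HasFDerivAt (fun w => delReal u w b) ((fderiv ℝ (delReal u) z).flip b) z := by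
    simpa using h1.hasFDerivAt.clm_apply (hasFDerivAt_const b z)
  have h4 : ∀ c : Cn n, HasFDerivAt (fun w => ((fderiv ℝ u w c : ℝ) : ℂ))
      (Complex.ofRealCLM.comp ((fderiv ℝ (fderiv ℝ u) z).flip c)) z := fun c =>
    Complex.ofRealCLM.hasFDerivAt.comp z (by simpa using h2.clm_apply (hasFDerivAt_const c z))
  have h5 := ((h4 b).sub ((h4 (Complex.I • b)).const_mul Complex.I)).const_mul (1 / 2 : ℂ)
  have h6 := h3.unique (h5.congr_of_eventuallyEq
    (Filter.Eventually.of_forall fun w => delReal_apply u w b))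
  have h7 := DFunLike.congr_fun h6 a
  simpa using h7

/-- The form `∂u` is closed if and only if `i∂∂̄u = 0`. -/
lemma fderiv_delReal_symm_iff (h : ContDiffAt ℝ ∞ u z) :
    (∀ a b, fderiv ℝ (delReal u) z a b = fderiv ℝ (delReal u) z b a) ↔ iddbarC u z = 0 := by
  have hs : IsSymmSndFDerivAt ℝ u z := h.isSymmSndFDerivAt (by simpa using ENat.LEInfty.out)
  constructor
  · intro H
    ext v
    have hv : v = ![v 0, v 1] := by ext i; fin_cases i <;> rfl
    have h1 := congrArg Complex.im (H (v 0) (v 1))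
    rw [fderiv_delReal h, fderiv_delReal h] at h1
    simp at h1
    rw [hv, iddbarC_apply h, h1]
    simp
  · intro H a b
    have h1 := DFunLike.congr_fun H ![a, b]
    rw [iddbarC_apply h] at h1
    have h2 : fderiv ℝ (fderiv ℝ u) z b (Complex.I • a) =
        fderiv ℝ (fderiv ℝ u) z a (Complex.I • b) := by
      have h3 : (0 : Cn n [⋀^Fin 2]→L[ℝ] ℝ) ![a, b] = 0 := rfl
      rw [h3] at h1
      linarith
    rw [fderiv_delReal h, fderiv_delReal h, h2, hs.eq a b]

/-- On a ball, a pluriharmonic function is `log |f|²` for a nonvanishing function `f` with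
`df = f ∂u`; such an `f` is holomorphic. -/
lemma exists_holomorphic_root {z₀ : Cn n} {r : ℝ} (hr : 0 < r)
    (hu : ∀ z ∈ Metric.ball z₀ r, ContDiffAt ℝ ∞ u z)
    (h : ∀ z ∈ Metric.ball z₀ r, iddbarC u z = 0) :
    ∃ f : Cn n → ℂ, ∀ z ∈ Metric.ball z₀ r, f z ≠ 0 ∧ Complex.normSq (f z) = Real.exp (u z) ∧
      HasFDerivAt f (f z • delReal u z) z := by
  have hdiff : DifferentiableOn ℝ (delReal u) (Metric.ball z₀ r) := fun z hz =>
    ((contDiffAt_delReal (hu z hz)).differentiableAt (by simp)).differentiableWithinAt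
  obtain ⟨F, hF⟩ := (convex_ball z₀ r).exists_forall_hasFDerivAt_of_fderiv_symmetric
    Metric.isOpen_ball hdiff
    (fun z hz => (fderiv_delReal_symm_iff (hu z hz)).2 (h z hz))
  have hz₀ := Metric.mem_ball_self (x := z₀) hr
  -- the function `2 Re F - u` is constant
  have hc : ∀ z ∈ Metric.ball z₀ r, 2 * (F z).re - u z = 2 * (F z₀).re - u z₀ := by
    intro z hz
    have hd : ∀ w ∈ Metric.ball z₀ r,
        HasFDerivAt (fun w : Cn n => 2 * (F w).re - u w) (0 : Cn n →L[ℝ] ℝ) w := by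
      intro w hw
      have hu' : HasFDerivAt u (fderiv ℝ u w) w :=
        ((hu w hw).differentiableAt (by simp)).hasFDerivAt
      have h1 := ((Complex.reCLM.hasFDerivAt.comp w (hF w hw)).const_mul (2 : ℝ)).sub hu'
      refine h1.congr_fderiv ?_
      ext a
      simp [delReal_apply]
    refine (convex_ball z₀ r).is_const_of_fderivWithin_eq_zero (𝕜 := ℝ)
      (fun w hw => (hd w hw).differentiableAt.differentiableWithinAt) (fun w hw => ?_) hz hz₀
    rw [fderivWithin_of_isOpen Metric.isOpen_ball hw, (hd w hw).fderiv]
  refine ⟨fun z => Complex.exp (F z - ((F z₀).re - u z₀ / 2 : ℝ)), fun z hz =>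
    ⟨Complex.exp_ne_zero _, ?_, ?_⟩⟩
  · rw [Complex.normSq_eq_norm_sq, Complex.norm_exp, ← Real.exp_nat_mul]
    congr 1
    have := hc z hz
    simp only [Complex.sub_re, Complex.ofReal_re]
    push_cast
    linarith
  · exact ((hF z hz).sub_const _).cexp

lemma differentiableAt_of_hasFDerivAt_delReal {f : Cn n → ℂ}
    (h : HasFDerivAt f (f z • delReal u z) z) : DifferentiableAt ℂ f z := by
  let L : Cn n →ₗ[ℂ] ℂ :=
    { toFun := fun a => (f z • delReal u z) a
      map_add' := fun a b => map_add _ a b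
      map_smul' := by
        intro c a
        have hc : c • a = (c.re : ℝ) • a + (c.im : ℝ) • (Complex.I • a) := by
          rw [← Complex.coe_smul, ← Complex.coe_smul, smul_smul, ← add_smul, Complex.re_add_im]
        have hI : delReal u z (Complex.I • a) = Complex.I * delReal u z a := by
          rw [delReal_apply, delReal_apply, smul_smul, Complex.I_mul_I, neg_one_smul, map_neg]
          push_cast
          linear_combination ((1 / 2) * (fderiv ℝ u z (Complex.I • a) : ℂ)) * Complex.I_mul_I
        rw [hc, map_add, map_smul, map_smul, RingHom.id_apply]
        simp only [_root_.smul_apply, hI, smul_eq_mul, Complex.real_smul]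
        linear_combination (f z * delReal u z a) * (Complex.re_add_im c) }
  exact (hasFDerivAt_of_restrictScalars ℝ (f' := LinearMap.toContinuousLinearMap L) h
    (by ext a; rfl)).differentiableAt

end Pluriharmonic

/-! ### Monodromy of locally constant cocycles -/

section Monodromy

/-- The complex numbers with the discrete topology, the fibre of a covering space. -/
def DiscreteComplex : Type := ℂ

instance : TopologicalSpace DiscreteComplex := ⊥

instance : DiscreteTopology DiscreteComplex := ⟨rfl⟩

variable {X ι : Type*} [TopologicalSpace X]

/-- The flat complex line bundle, as a bundle with discrete fibre, of a locally constant
cocycle `r`. -/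
def flatCore (U : ι → Set X) (hU : ∀ i, IsOpen (U i)) (idx : X → ι) (hidx : ∀ x, x ∈ U (idx x))
    (r : ι → ι → X → ℂ) (hself : ∀ i, ∀ x ∈ U i, r i i x = 1)
    (hcomp : ∀ i j k, ∀ x, x ∈ U i → x ∈ U j → x ∈ U k → r i j x * r j k x = r i k x)
    (hloc : ∀ i j, ∀ x, x ∈ U i → x ∈ U j → ∀ᶠ y in 𝓝 x, r i j y = r i j x) :
    FiberBundleCore ι X DiscreteComplex where
  baseSet := U
  isOpen_baseSet := hU
  indexAt := idx
  mem_baseSet_at := hidx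
  coordChange i j x c := (id (α := ℂ) c * r i j x : ℂ)
  coordChange_self i x hx c := by
    change (id (α := ℂ) c * r i i x : ℂ) = c
    rw [hself i x hx, mul_one]
    rfl
  continuousOn_coordChange i j := by
    rintro ⟨x, c⟩ ⟨hx, -⟩
    refine ContinuousAt.continuousWithinAt ?_
    have h1 : ∀ᶠ p : X × DiscreteComplex in 𝓝 (x, c), r i j p.1 = r i j x ∧ p.2 = c := by
      have h2 : ∀ᶠ d : DiscreteComplex in 𝓝 c, d = c :=
        (isOpen_discrete ({c} : Set DiscreteComplex)).mem_nhds rfl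
      rw [nhds_prod_eq]
      exact (hloc i j x hx.1 hx.2).prod_mk h2
    let d : DiscreteComplex := (id (α := ℂ) c * r i j x : ℂ)
    refine ContinuousAt.congr (f := fun _ => d) continuousAt_const ?_
    filter_upwards [h1] with p hp
    rw [hp.1, hp.2]
  coordChange_comp i j k x hx c := by
    change ((id (α := ℂ) c * r i j x) * r j k x : ℂ) = id (α := ℂ) c * r i k x
    rw [mul_assoc, hcomp i j k x hx.1.1 hx.1.2 hx.2]

/-- A flat section of the line bundle of a locally constant cocycle along a null-homotopic loop
returns to its initial value: it is a lift of the loop to a covering space. -/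
theorem flat_section_eq (U : ι → Set X) (hU : ∀ i, IsOpen (U i)) (idx : X → ι)
    (hidx : ∀ x, x ∈ U (idx x))
    (r : ι → ι → X → ℂ) (hself : ∀ i, ∀ x ∈ U i, r i i x = 1)
    (hcomp : ∀ i j k, ∀ x, x ∈ U i → x ∈ U j → x ∈ U k → r i j x * r j k x = r i k x)
    (hloc : ∀ i j, ∀ x, x ∈ U i → x ∈ U j → ∀ᶠ y in 𝓝 x, r i j y = r i j x)
    {x : X} (γ : Path x x) (hγ : γ.Homotopic (Path.refl x)) (c : ι → unitInterval → ℂ)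
    (hc : ∀ i j t, γ t ∈ U i → γ t ∈ U j → c j t = c i t * r i j (γ t))
    (hconst : ∀ i t, γ t ∈ U i → ∀ᶠ s in 𝓝 t, c i s = c i t) :
    c (idx x) 1 = c (idx x) 0 := by
  let Z := flatCore U hU idx hidx r hself hcomp hloc
  have : ∀ x, DiscreteTopology (Z.Fiber x) := fun _ =>
    inferInstanceAs (DiscreteTopology DiscreteComplex)
  have cov : IsCoveringMap (π DiscreteComplex Z.Fiber) :=
    IsCoveringMap.mk _ (fun _ : X => DiscreteComplex) (fun x : X => Z.localTriv (idx x))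
      (fun x => hidx x)
  let Γ : unitInterval → Z.TotalSpace := fun t => ⟨γ t, c (idx (γ t)) t⟩
  have hΓ : Continuous Γ := by
    rw [continuous_iff_continuousAt]
    intro t
    have hxt : γ t ∈ U (idx (γ t)) := hidx (γ t)
    have hγc : ContinuousAt γ t := γ.continuous.continuousAt
    let d : DiscreteComplex := c (idx (γ t)) t
    have h1 : (fun s => (Z.localTriv (idx (γ t))).toOpenPartialHomeomorph.symm (γ s, d))
        =ᶠ[𝓝 t] Γ := by
      filter_upwards [hγc.eventually ((hU _).mem_nhds hxt), hconst _ t hxt] with s hs hs'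
      have h2 : (Z.localTriv (idx (γ t))).toOpenPartialHomeomorph.symm (γ s, d) =
          ⟨γ s, (c (idx (γ t)) t * r (idx (γ t)) (idx (γ s)) (γ s) : ℂ)⟩ := rfl
      rw [h2, ← hs', ← hc _ _ s hs (hidx _)]
    refine ContinuousAt.congr ?_ h1
    refine ContinuousAt.comp (f := fun s => (γ s, d))
      ((Z.localTriv (idx (γ t))).toOpenPartialHomeomorph.continuousAt_symm ?_)
      (hγc.prodMk continuousAt_const)
    exact (Z.mem_localTriv_target _ _).2 hxt
  have h0 : (γ : C(unitInterval, X)) 0 = π DiscreteComplex Z.Fiber (Γ 0) := rfl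
  have h0' : (Path.refl x : C(unitInterval, X)) 0 = π DiscreteComplex Z.Fiber (Γ 0) :=
    γ.source.symm
  have h1 : Γ = cov.liftPath γ (Γ 0) h0 := (cov.eq_liftPath_iff h0).2 ⟨hΓ, rfl, rfl⟩
  have h2 := cov.liftPath_apply_one_eq_of_homotopicRel hγ (Γ 0) h0 h0'
  have h3 : (cov.liftPath (Path.refl x : C(unitInterval, X)) (Γ 0) h0' : unitInterval → _) 1 = Γ 0 :=
    congrArg (fun f : C(unitInterval, Z.TotalSpace) => f 1)
      (cov.liftPath_const (x := x) (e := Γ 0) h0')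
  have h2 : Γ 1 = Γ 0 := (congrFun h1 1).trans (h2.trans h3)
  have h4 : ∀ p q : Z.TotalSpace, p = q → id (α := ℂ) p.2 = id (α := ℂ) q.2 := by
    rintro p _ rfl; rfl
  have h5 : c (idx (γ 1)) 1 = c (idx (γ 0)) 0 := h4 _ _ h2
  rwa [γ.source, γ.target] at h5

end Monodromy

section OffFinite

/-- A continuous function whose derivative vanishes off a finite set is constant. -/
lemma eq_of_hasDerivAt_zero_off_finite {h : ℝ → ℂ} {a b : ℝ} (hab : a ≤ b)
    (hc : ContinuousOn h (Icc a b)) (S : Finset ℝ)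
    (hd : ∀ t ∈ Ioo a b, t ∉ S → HasDerivAt h 0 t) : h b = h a := by
  have := MeasureTheory.integral_eq_of_hasDerivAt_off_countable_of_le h 0 hab
    S.countable_toSet hc (fun x hx => hd x hx.1 (by simpa using hx.2)) intervalIntegrable_const
  have h0 : ∫ x in a..b, (0 : ℝ → ℂ) x = 0 := by simp
  exact sub_eq_zero.1 (this.symm.trans h0)

end OffFinite

/-! ### The Chern–Ricci form and flat determinants in charts -/

section RicciFlat

variable {n : ℕ} {M : Type*} [TopologicalSpace M] [ChartedSpace (Cn n) M]
  [IsManifold 𝓘(ℂ, Cn n) ω M] {φ ψ : OpenPartialHomeomorph M (Cn n)}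

/-- The Chern–Ricci form may be computed in any chart of the atlas. -/
lemma chernRicci_eq_of_mem_source (g : TangentHermitianMetric n M) (hφ : φ ∈ atlas (Cn n) M)
    {x : M} (hx : x ∈ φ.source) :
    chernRicci g x = -iddbar n (fun y => Real.log (detMetric g φ y)) x := by
  have h1 := curvature_canonical g x
  rw [(HermitianMetric.ofWeights (isWeightFamily_detMetric g)).curvature_eq
    ((canonicalCore n M).localTriv ⟨φ, hφ⟩) hx] at h1
  have h2 : (fun y => Real.log ((HermitianMetric.ofWeights (isWeightFamily_detMetric g)).weight
      ((canonicalCore n M).localTriv ⟨φ, hφ⟩) y)) =ᶠ[𝓝 x]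
      fun y => Real.log (detMetric g φ y)⁻¹ := by
    filter_upwards [φ.open_source.mem_nhds hx] with y hy
    rw [HermitianMetric.ofWeights_weight (isWeightFamily_detMetric g) (i := ⟨φ, hφ⟩) hy]
  rw [iddbar_congr h2, iddbar_log_inv (contMDiffAt_log_detMetric g hφ hx)] at h1
  exact (neg_injective h1).symm

lemma contDiffAt_log_det (g : TangentHermitianMetric n M) (hφ : φ ∈ atlas (Cn n) M) {z : Cn n}
    (hz : z ∈ φ.target) :
    ContDiffAt ℝ ∞ (fun w => Real.log (metricMatrix g φ w).det.re) z :=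
  ((contDiffOn_det_metricMatrix g hφ).contDiffAt (φ.open_target.mem_nhds hz)).log
    (det_metricMatrix g hφ hz).1.ne'

lemma log_detMetric_symm (g : TangentHermitianMetric n M) {z : Cn n} (hz : z ∈ φ.target) :
    (fun y => Real.log (detMetric g φ y)) ∘ φ.symm =ᶠ[𝓝 z]
      fun w => Real.log (metricMatrix g φ w).det.re := by
  filter_upwards [φ.open_target.mem_nhds hz] with w hw
  simp [detMetric, φ.right_inv hw]

lemma iddbarC_log_det_eq_zero {g : TangentHermitianMetric n M} (hg : ∀ x, chernRicci g x = 0)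
    (hφ : φ ∈ atlas (Cn n) M) {z : Cn n} (hz : z ∈ φ.target) :
    iddbarC (fun w => Real.log (metricMatrix g φ w).det.re) z = 0 := by
  have h1 := hg (φ.symm z)
  rw [chernRicci_eq_of_mem_source g hφ (φ.map_target hz)] at h1
  have h2 : iddbar n (fun y => Real.log (detMetric g φ y)) (φ.symm z) = 0 := by
    rw [← neg_neg (iddbar n _ _), h1]
    ext v
    exact neg_zero
  rw [← iddbarC_congr (log_detMetric_symm g hz),
    ← iddbar_inChart hφ hz (contMDiffAt_log_detMetric g hφ (φ.map_target hz))]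
  change (iddbar n _ (φ.symm z)).compContinuousLinearMap _ = 0
  rw [h2]
  rfl

lemma chernRicci_eq_zero_of_iddbarC {g : TangentHermitianMetric n M} {x : M}
    (h : iddbarC (fun w => Real.log (metricMatrix g (chartAt (Cn n) x) w).det.re)
      (chartAt (Cn n) x x) = 0) : chernRicci g x = 0 := by
  rw [chernRicci_eq, iddbar, iddbarC_congr (log_detMetric_symm g (mem_chart_target (Cn n) x)), h]
  ext v
  exact neg_zero

/-- For a Ricci-flat metric, `det G` is locally `|f|²` for a nonvanishing holomorphic function `f`
with `df = f tr A`, where `A` is the Chern connection. -/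
lemma exists_flat_factor {g : TangentHermitianMetric n M} (hg : ∀ x, chernRicci g x = 0)
    (hφ : φ ∈ atlas (Cn n) M) {x : M} (hx : x ∈ φ.source) :
    ∃ (r : ℝ) (f : Cn n → ℂ), 0 < r ∧ Metric.ball (φ x) r ⊆ φ.target ∧
      ∀ z ∈ Metric.ball (φ x) r, f z ≠ 0 ∧ Complex.normSq (f z) = (metricMatrix g φ z).det.re ∧
        HasFDerivAt f
          (f z • delReal (fun w => Real.log (metricMatrix g φ w).det.re) z) z := by
  obtain ⟨r, hr, hb⟩ := Metric.isOpen_iff.1 φ.open_target (φ x) (φ.map_source hx)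
  obtain ⟨f, hf⟩ := exists_holomorphic_root hr (fun z hz => contDiffAt_log_det g hφ (hb hz))
    (fun z hz => iddbarC_log_det_eq_zero hg hφ (hb hz))
  refine ⟨r, f, hr, hb, fun z hz => ?_⟩
  obtain ⟨h1, h2, h3⟩ := hf z hz
  rw [Real.exp_log (det_metricMatrix g hφ (hb hz)).1] at h2
  exact ⟨h1, h2, h3⟩

lemma canonicalCore_coordChange (i j : atlas (Cn n) M) (x : M) :
    (canonicalCore n M).coordChange i j x 1 = (fderiv ℂ (i.1 ∘ j.1.symm) (j.1 x)).det := by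
  simp [canonicalCore, tangentBundleCore, fderivWithin_univ]

/-- The flat local frames of the anticanonical bundle given by two holomorphic functions as in
`exists_flat_factor` differ by a locally constant factor: it is holomorphic of modulus one. -/
lemma eventually_flat_transition_eq {g : TangentHermitianMetric n M}
    (hφ : φ ∈ atlas (Cn n) M) (hψ : ψ ∈ atlas (Cn n) M) {f f' : Cn n → ℂ} {s s' : Set (Cn n)}
    (hs : IsOpen s) (hs' : IsOpen s') (hst : s ⊆ φ.target)
    (hf : ∀ z ∈ s, f z ≠ 0 ∧ Complex.normSq (f z) = (metricMatrix g φ z).det.re ∧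
      DifferentiableAt ℂ f z)
    (hf' : ∀ z ∈ s', f' z ≠ 0 ∧ Complex.normSq (f' z) = (metricMatrix g ψ z).det.re ∧
      DifferentiableAt ℂ f' z)
    {x : M} (hx : x ∈ φ.source) (hx' : x ∈ ψ.source) (hxs : φ x ∈ s) (hxs' : ψ x ∈ s') :
    ∀ᶠ y in 𝓝 x, (fderiv ℂ (ψ ∘ φ.symm) (φ y)).det * f' (ψ y) / f (φ y) =
      (fderiv ℂ (ψ ∘ φ.symm) (φ x)).det * f' (ψ x) / f (φ x) := by
  set T := ψ ∘ φ.symm with hT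
  let R : Cn n → ℂ := fun w => (fderiv ℂ T w).det * f' (T w) / f w
  have hR : ∀ y ∈ φ.source, R (φ y) = (fderiv ℂ T (φ y)).det * f' (ψ y) / f (φ y) := by
    intro y hy
    simp only [R, hT, Function.comp_apply, φ.left_inv hy]
  have hcont : ContinuousAt φ.symm (φ x) := φ.continuousAt_symm (φ.map_source hx)
  have hcont' : ContinuousAt T (φ x) := by
    refine ContinuousAt.comp ?_ hcont
    rw [φ.left_inv hx]
    exact ψ.continuousAt hx'
  have hgood : ∀ᶠ w in 𝓝 (φ x), w ∈ s ∧ φ.symm w ∈ ψ.source ∧ T w ∈ s' := by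
    refine Filter.Eventually.and (hs.mem_nhds hxs)
      ((hcont.eventually (ψ.open_source.mem_nhds ?_)).and (hcont'.eventually (hs'.mem_nhds ?_)))
    · rwa [φ.left_inv hx]
    · rw [hT, Function.comp_apply, φ.left_inv hx]
      exact hxs'
  have hdiff : ∀ᶠ w in 𝓝 (φ x), DifferentiableAt ℂ R w := by
    filter_upwards [hgood] with w hw
    have hTw : ContDiffAt ℂ ω T w := contDiffAt_transition hφ hψ (hst hw.1) hw.2.1
    have h1 : DifferentiableAt ℂ (fun w => (fderiv ℂ T w).det) w :=
      ((contDiff_det n).contDiffAt.comp w (hTw.fderiv_right (m := ω) (by simp))).differentiableAt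
        (by simp)
    have h2 : DifferentiableAt ℂ (fun w => f' (T w)) w :=
      (hf' _ hw.2.2).2.2.comp w (hTw.differentiableAt (by simp))
    simp only [R, div_eq_mul_inv]
    exact (h1.mul h2).mul ((hf _ hw.1).2.2.inv (hf _ hw.1).1)
  have hnorm : ∀ w, w ∈ s ∧ φ.symm w ∈ ψ.source ∧ T w ∈ s' → ‖R w‖ = 1 := by
    rintro w ⟨h1, h2, h3⟩
    have hw := hst h1
    have h4 := detMetric_transition g hφ hψ (φ.map_target hw) h2
    rw [detMetric, detMetric, φ.right_inv hw, ← (hf w h1).2.1] at h4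
    have h5 := (hf' _ h3).2.1
    have h6 : Complex.normSq (R w) = 1 := by
      simp only [R, map_mul, map_div₀]
      rw [h5]
      rw [div_eq_one_iff_eq (by simpa using (hf w h1).1)]
      exact h4.symm
    rw [Complex.normSq_eq_norm_sq] at h6
    exact (pow_eq_one_iff_of_nonneg (norm_nonneg _) two_ne_zero).1 h6
  have hmax : IsLocalMax (norm ∘ R) (φ x) := by
    filter_upwards [hgood] with w hw
    simp only [Function.comp_apply]
    rw [hnorm w hw, hnorm _ hgood.self_of_nhds]
  have h1 := Complex.eventually_eq_of_isLocalMax_norm hdiff hmax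
  filter_upwards [(φ.continuousAt hx).eventually h1, φ.open_source.mem_nhds hx] with y hy hy'
  rw [← hR y hy', ← hR x hx]
  exact hy

end RicciFlat

/-! ### Parallel vector fields -/

section Parallel

variable {n : ℕ} {M : Type*} [TopologicalSpace M] [ChartedSpace (Cn n) M]
  [IsManifold 𝓘(ℂ, Cn n) ω M] {φ ψ : OpenPartialHomeomorph M (Cn n)}

lemma components_transition (hφ : φ ∈ atlas (Cn n) M) (hψ : ψ ∈ atlas (Cn n) M)
    {p : TangentBundle 𝓘(ℂ, Cn n) M} (hp : p.1 ∈ φ.source) (hp' : p.1 ∈ ψ.source) :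
    components ψ p = fderiv ℂ (ψ ∘ φ.symm) (φ p.1) (components φ p) := by
  apply frame_injective hψ (ψ.map_source hp')
  have h1 := frame_components hψ hp'
  have h2 := frame_components hφ hp
  rw [frame_transition hφ hψ (φ.map_source hp) (by rwa [φ.left_inv hp]), φ.left_inv hp] at h2
  exact h1.trans h2.symm

lemma components_transition_apply (hφ : φ ∈ atlas (Cn n) M) (hψ : ψ ∈ atlas (Cn n) M)
    {p : TangentBundle 𝓘(ℂ, Cn n) M} (hp : p.1 ∈ φ.source) (hp' : p.1 ∈ ψ.source) (k : Fin n) :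
    components ψ p k = ∑ j, components φ p j * jac (ψ ∘ φ.symm) (φ p.1) j k := by
  rw [components_transition hφ hψ hp hp', clm_apply_eq_sum]
  rfl

lemma localTriv_snd_eq_components (hφ : φ ∈ atlas (Cn n) M) {p : TangentBundle 𝓘(ℂ, Cn n) M}
    (hp : p.1 ∈ φ.source) :
    ((tangentBundleCore 𝓘(ℂ, Cn n) M).localTriv ⟨φ, hφ⟩ p).2 = components φ p := by
  have h1 := localTriv_symm_eq_frame hφ hp (components φ p)
  rw [frame_components hφ hp] at h1
  have h2 := ((tangentBundleCore 𝓘(ℂ, Cn n) M).localTriv ⟨φ, hφ⟩).apply_mk_symm hp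
    (components φ p)
  rw [h1] at h2
  exact congrArg Prod.snd h2

lemma continuousWithinAt_components {V : ℝ → TangentBundle 𝓘(ℂ, Cn n) M} {s : Set ℝ} {t : ℝ}
    (hV : ContinuousWithinAt V s t) (hφ : φ ∈ atlas (Cn n) M) (ht : (V t).1 ∈ φ.source) :
    ContinuousWithinAt (fun τ => components φ (V τ)) s t := by
  let e : Trivialization (Cn n) (π (Cn n) (TangentSpace 𝓘(ℂ, Cn n) : M → Type _)) :=
    (tangentBundleCore 𝓘(ℂ, Cn n) M).localTriv ⟨φ, hφ⟩
  have he : V t ∈ e.source := e.mem_source.2 ht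
  have h1 : ContinuousWithinAt (fun τ => (e (V τ)).2) s t :=
    continuous_snd.continuousAt.comp_continuousWithinAt
      ((e.continuousOn.continuousAt (e.open_source.mem_nhds he)).comp_continuousWithinAt hV)
  refine h1.congr_of_eventuallyEq ?_ (localTriv_snd_eq_components hφ ht).symm
  filter_upwards [hV.eventually (e.open_source.mem_nhds he)] with τ hτ
  exact (localTriv_snd_eq_components hφ (e.mem_source.1 hτ)).symm

/-- A piecewise smooth curve is smooth away from finitely many times. -/
lemma IsPiecewiseSmooth.exists_contMDiffAt {γ : ℝ → M} (h : IsPiecewiseSmooth n γ) :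
    ∃ S : Finset ℝ, ∀ t ∈ Ioo (0 : ℝ) 1, t ∉ S → ContMDiffAt 𝓘(ℝ, ℝ) 𝓘(ℝ, Cn n) ∞ γ t := by
  obtain ⟨m, t, -, h0, h1, hs⟩ := h
  refine ⟨Finset.univ.image t, fun τ hτ hS => ?_⟩
  have hne : ∀ i, t i ≠ τ := fun i hi => hS (by rw [← hi]; simp)
  by_contra hcon
  have hlt : ∀ i, t i < τ := by
    intro i
    induction i using Fin.induction with
    | zero => rw [h0]; exact hτ.1
    | succ i ih =>
      by_contra hle
      exact hcon ((hs i).contMDiffAt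
        (Icc_mem_nhds ih (lt_of_le_of_ne (not_lt.1 hle) (hne i.succ).symm)))
  have := hlt (Fin.last m)
  rw [h1] at this
  exact lt_asymm this hτ.2

lemma differentiableAt_chart_comp {γ : ℝ → M} {t : ℝ}
    (h : ContMDiffAt 𝓘(ℝ, ℝ) 𝓘(ℝ, Cn n) ∞ γ t) (hφ : φ ∈ atlas (Cn n) M) (ht : γ t ∈ φ.source) :
    DifferentiableAt ℝ (fun τ => φ (γ τ)) t := by
  have := isManifold_real (n := n) (M := M)
  have h1 : ContMDiffAt 𝓘(ℝ, Cn n) 𝓘(ℝ, Cn n) ∞ φ (γ t) :=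
    (contMDiffOn_of_mem_maximalAtlas (IsManifold.subset_maximalAtlas hφ)).contMDiffAt
      (φ.open_source.mem_nhds ht)
  exact (contMDiffAt_iff_contDiffAt.1 (h1.comp t h)).differentiableAt (by simp)

/-- The differential equation of a parallel vector field, in terms of the underlying curve. -/
lemma IsParallel.exists_hasDerivAt {g : TangentHermitianMetric n M}
    {V : ℝ → TangentBundle 𝓘(ℂ, Cn n) M} (hV : IsParallel g V) {γ : ℝ → M}
    (hγ : ∀ t ∈ Icc (0 : ℝ) 1, (V t).1 = γ t) :
    ∃ S : Finset ℝ, ∀ t ∈ Ioo (0 : ℝ) 1, t ∉ S → ∀ φ ∈ atlas (Cn n) M, γ t ∈ φ.source →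
      ∀ k : Fin n, HasDerivAt (fun τ => components φ (V τ) k)
        (-∑ j, components φ (V t) j *
          chernConnectionMatrix g φ (φ (γ t)) (deriv (fun τ => φ (γ τ)) t) j k) t := by
  obtain ⟨-, S, hS⟩ := hV
  refine ⟨S, fun t ht htS φ hφ hx k => ?_⟩
  have h1 := hγ t (Ioo_subset_Icc_self ht)
  have h2 : (fun τ => φ (V τ).1) =ᶠ[𝓝 t] fun τ => φ (γ τ) := by
    filter_upwards [Ioo_mem_nhds ht.1 ht.2] with τ hτ
    rw [hγ τ (Ioo_subset_Icc_self hτ)]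
  have h3 := hS t ht htS φ hφ (by rwa [h1]) k
  rwa [h2.deriv_eq, h1] at h3

/-- The Chern connection preserves the metric. -/
lemma hasDerivAt_form_parallel (g : TangentHermitianMetric n M) (hφ : φ ∈ atlas (Cn n) M)
    {c v w : ℝ → Cn n} {a : Cn n} {t : ℝ} (hc : HasDerivAt c a t) (hz : c t ∈ φ.target)
    (hv : ∀ k, HasDerivAt (fun τ => v τ k)
      (-∑ j, v t j * chernConnectionMatrix g φ (c t) a j k) t)
    (hw : ∀ k, HasDerivAt (fun τ => w τ k)
      (-∑ j, w t j * chernConnectionMatrix g φ (c t) a j k) t) :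
    HasDerivAt (fun τ => ∑ j, ∑ k, v τ j * metricMatrix g φ (c τ) j k * conj (w τ k)) 0 t := by
  set A := chernConnectionMatrix g φ (c t) a with hA
  set G := metricMatrix g φ (c t) with hG
  have hAG : A * G = delMatrix (metricMatrix g φ) (c t) a := connection_mul_metricMatrix g hφ hz a
  have hGd : ∀ j k, HasDerivAt (fun τ => metricMatrix g φ (c τ) j k)
      ((A * G) j k + conj ((A * G) k j)) t := by
    intro j k
    have h1 := differentiableAt_metricMatrix g hφ hz j k
    have h2 := h1.hasFDerivAt.comp_hasDerivAt t hc
    refine h2.congr_deriv ?_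
    rw [fderiv_eq_del_add h1, hAG]
    simp only [metricMatrix_conj]
    rfl
  have hwc : ∀ k, HasDerivAt (fun τ => conj (w τ k)) (conj (-∑ j, w t j * A j k)) t := fun k =>
    (Complex.conjCLE : ℂ →L[ℝ] ℂ).hasFDerivAt.comp_hasDerivAt t (hw k)
  have h1 := HasDerivAt.fun_sum (u := Finset.univ) fun j _ =>
    HasDerivAt.fun_sum (u := Finset.univ) fun k _ => ((hv j).mul (hGd j k)).mul (hwc k)
  refine h1.congr_deriv ?_
  have e1 : ∑ j, ∑ k, (∑ l, v t l * A l j) * G j k * conj (w t k) =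
      ∑ j, ∑ k, v t j * (A * G) j k * conj (w t k) := by
    simp only [Matrix.mul_apply, Finset.sum_mul, Finset.mul_sum]
    rw [Finset.sum_congr rfl fun j _ => Finset.sum_comm, Finset.sum_comm]
    refine Finset.sum_congr rfl fun l _ => ?_
    rw [Finset.sum_comm]
    refine Finset.sum_congr rfl fun j _ => Finset.sum_congr rfl fun k _ => ?_
    ring
  have e2 : ∑ j, ∑ k, v t j * conj ((A * G) k j) * conj (w t k) =
      ∑ j, ∑ k, v t j * G j k * conj (∑ l, w t l * A l k) := by
    refine Finset.sum_congr rfl fun j _ => ?_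
    simp only [Matrix.mul_apply, map_sum, map_mul, Finset.sum_mul, Finset.mul_sum, hG,
      metricMatrix_conj]
    rw [Finset.sum_comm]
    refine Finset.sum_congr rfl fun l _ => Finset.sum_congr rfl fun k _ => ?_
    ring
  have e3 : ∀ p q : Fin n → ℂ, ∑ j, ∑ k, ((-p j * G j k +
      v t j * ((A * G) j k + conj ((A * G) k j))) * conj (w t k) + v t j * G j k * conj (-q k)) =
      -(∑ j, ∑ k, p j * G j k * conj (w t k)) +
      ∑ j, ∑ k, v t j * (A * G) j k * conj (w t k) +
      ∑ j, ∑ k, v t j * conj ((A * G) k j) * conj (w t k) -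
      ∑ j, ∑ k, v t j * G j k * conj (q k) := by
    intro p q
    simp only [← Finset.sum_neg_distrib, ← Finset.sum_add_distrib, ← Finset.sum_sub_distrib, map_neg]
    refine Finset.sum_congr rfl fun j _ => Finset.sum_congr rfl fun k _ => ?_
    ring
  refine (e3 _ _).trans ?_
  rw [e1, e2]
  ring

lemma form_eq_components (g : TangentHermitianMetric n M) (hφ : φ ∈ atlas (Cn n) M)
    {p q : TangentBundle 𝓘(ℂ, Cn n) M} {x : M} (hp : p.1 = x) (hq : q.1 = x) (hx : x ∈ φ.source) :
    g.form x p.2 q.2 =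
      ∑ j, ∑ k, components φ q j * metricMatrix g φ (φ x) j k * conj (components φ p k) := by
  rw [← form_frame, ← form_congr g (φ.left_inv hx).symm]
  have h1 := frame_components hφ (p := p) (by rwa [hp])
  have h2 := frame_components hφ (p := q) (by rwa [hq])
  rw [hp] at h1
  rw [hq] at h2
  exact (congrArg₂ (fun v w : Cn n => g.form x v w) h1 h2).symm

end Parallel

/-! ### Ricci-flat metrics have restricted holonomy in the special unitary group -/

section RicciFlatHolonomy

variable {n : ℕ} {M : Type*} [TopologicalSpace M] [ChartedSpace (Cn n) M]
  [IsManifold 𝓘(ℂ, Cn n) ω M] {φ ψ : OpenPartialHomeomorph M (Cn n)}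

lemma continuousOn_components {V : ℝ → TangentBundle 𝓘(ℂ, Cn n) M} {γ : ℝ → M} {s : Set ℝ}
    (hs : s ⊆ Icc 0 1) (hV : ContinuousOn V (Icc 0 1)) (hVγ : ∀ t ∈ Icc (0 : ℝ) 1, (V t).1 = γ t)
    (hφ : φ ∈ atlas (Cn n) M) (hγ : ∀ t ∈ s, γ t ∈ φ.source) (k : Fin n) :
    ContinuousOn (fun τ => components φ (V τ) k) s := fun t ht =>
  (EuclideanSpace.proj (𝕜 := ℂ) k : Cn n →L[ℂ] ℂ).continuous.continuousAt.comp_continuousWithinAt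
    ((continuousWithinAt_components (hV t (hs ht)) hφ (by
      rw [hVγ t (hs ht)]; exact hγ t ht)).mono hs)

/-- Parallel transport preserves the metric. -/
lemma form_eq_of_isParallel {g : TangentHermitianMetric n M} {γ : ℝ → M}
    (hγc : Continuous γ) (hγ : IsPiecewiseSmooth n γ) {V W : ℝ → TangentBundle 𝓘(ℂ, Cn n) M}
    (hV : IsParallel g V) (hW : IsParallel g W) (hVγ : ∀ t ∈ Icc (0 : ℝ) 1, (V t).1 = γ t)
    (hWγ : ∀ t ∈ Icc (0 : ℝ) 1, (W t).1 = γ t) :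
    g.form (γ 1) (W 1).2 (V 1).2 = g.form (γ 0) (W 0).2 (V 0).2 := by
  obtain ⟨S₁, hS₁⟩ := hV.exists_hasDerivAt hVγ
  obtain ⟨S₂, hS₂⟩ := hW.exists_hasDerivAt hWγ
  obtain ⟨S₃, hS₃⟩ := hγ.exists_contMDiffAt
  have hloc : ∀ t ∈ Icc (0 : ℝ) 1, ∀ φ ∈ atlas (Cn n) M, γ t ∈ φ.source →
      g.form (γ t) (W t).2 (V t).2 = ∑ j, ∑ k, components φ (V t) j *
        metricMatrix g φ (φ (γ t)) j k * conj (components φ (W t) k) := fun t ht φ hφ hx =>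
    form_eq_components g hφ (hWγ t ht) (hVγ t ht) hx
  refine eq_of_hasDerivAt_zero_off_finite (h := fun t => g.form (γ t) (W t).2 (V t).2) zero_le_one
    (fun t ht => ?_) (S₁ ∪ S₂ ∪ S₃) fun t ht htS => ?_
  · set φ := chartAt (Cn n) (γ t)
    have hφ : φ ∈ atlas (Cn n) M := chart_mem_atlas (Cn n) (γ t)
    have hx : γ t ∈ φ.source := mem_chart_source (Cn n) (γ t)
    have hU : γ ⁻¹' φ.source ∈ 𝓝 t := hγc.continuousAt (φ.open_source.mem_nhds hx)
    have hC : ∀ {X : ℝ → TangentBundle 𝓘(ℂ, Cn n) M}, ContinuousOn X (Icc 0 1) →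
        (∀ t ∈ Icc (0 : ℝ) 1, (X t).1 = γ t) → ∀ k,
        ContinuousWithinAt (fun τ => components φ (X τ) k) (Icc 0 1) t := fun hX hXγ k =>
      (EuclideanSpace.proj (𝕜 := ℂ) k : Cn n →L[ℂ] ℂ).continuous.continuousAt.comp_continuousWithinAt
        (continuousWithinAt_components (hX t ht) hφ (by rw [hXγ t ht]; exact hx))
    have hG : ∀ j k, ContinuousAt (fun τ => metricMatrix g φ (φ (γ τ)) j k) t := fun j k =>
      ((differentiableAt_metricMatrix g hφ (φ.map_source hx) j k).continuousAt).comp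
        (f := fun τ => φ (γ τ)) ((φ.continuousAt hx).comp hγc.continuousAt)
    have h1 : ContinuousWithinAt (fun t => ∑ j, ∑ k, components φ (V t) j *
        metricMatrix g φ (φ (γ t)) j k * conj (components φ (W t) k)) (Icc 0 1) t := by
      refine tendsto_finsetSum _ fun j _ => tendsto_finsetSum _ fun k _ => ?_
      exact ((hC hV.1 hVγ j).mul (hG j k).continuousWithinAt).mul
        (Complex.continuous_conj.continuousAt.comp_continuousWithinAt (hC hW.1 hWγ k))
    refine h1.congr_of_eventuallyEq ?_ (hloc t ht φ hφ hx)
    filter_upwards [mem_nhdsWithin_of_mem_nhds hU, self_mem_nhdsWithin] with τ hτ hτ'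
    exact hloc τ hτ' φ hφ hτ
  · simp only [Finset.mem_union, not_or] at htS
    set φ := chartAt (Cn n) (γ t)
    have hφ : φ ∈ atlas (Cn n) M := chart_mem_atlas (Cn n) (γ t)
    have hx : γ t ∈ φ.source := mem_chart_source (Cn n) (γ t)
    have hU : γ ⁻¹' φ.source ∈ 𝓝 t := hγc.continuousAt (φ.open_source.mem_nhds hx)
    have hc := (differentiableAt_chart_comp (hS₃ t ht htS.2) hφ hx).hasDerivAt
    have h1 := hasDerivAt_form_parallel g hφ hc (φ.map_source hx)
      (hS₁ t ht htS.1.1 φ hφ hx) (hS₂ t ht htS.1.2 φ hφ hx)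
    refine h1.congr_of_eventuallyEq ?_
    filter_upwards [hU, Ioo_mem_nhds ht.1 ht.2] with τ hτ hτ'
    exact hloc τ (Ioo_subset_Icc_self hτ') φ hφ hτ

/-- The components of a family of tangent vectors in a chart, one vector in each row. -/
def frameMatrix (φ : OpenPartialHomeomorph M (Cn n)) (V : Fin n → TangentBundle 𝓘(ℂ, Cn n) M) :
    Matrix (Fin n) (Fin n) ℂ :=
  Matrix.of fun i k => components φ (V i) k

lemma det_frameMatrix_transition (hφ : φ ∈ atlas (Cn n) M) (hψ : ψ ∈ atlas (Cn n) M)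
    {V : Fin n → TangentBundle 𝓘(ℂ, Cn n) M} {x : M} (hV : ∀ i, (V i).1 = x) (hx : x ∈ φ.source)
    (hx' : x ∈ ψ.source) :
    (frameMatrix ψ V).det = (frameMatrix φ V).det * (fderiv ℂ (ψ ∘ φ.symm) (φ x)).det := by
  rw [← det_jac, ← Matrix.det_mul]
  congr 1
  ext i k
  have h := components_transition_apply hφ hψ (p := V i) (by rwa [hV i]) (by rwa [hV i]) k
  rw [hV i] at h
  rw [Matrix.mul_apply]
  exact h

/-- The determinant of a parallel frame times a function `f` with `df = f tr A` is constant. -/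
lemma det_frameMatrix_mul_eq {g : TangentHermitianMetric n M} {γ : ℝ → M}
    (hγc : Continuous γ) (hγ : IsPiecewiseSmooth n γ)
    {V : Fin n → ℝ → TangentBundle 𝓘(ℂ, Cn n) M} (hV : ∀ i, IsParallel g (V i))
    (hVγ : ∀ i, ∀ t ∈ Icc (0 : ℝ) 1, (V i t).1 = γ t) (hφ : φ ∈ atlas (Cn n) M) {f : Cn n → ℂ}
    {a b : ℝ} (ha : 0 ≤ a) (hab : a ≤ b) (hb : b ≤ 1) (hφγ : ∀ t ∈ Icc a b, γ t ∈ φ.source)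
    (hf : ∀ t ∈ Icc a b, HasFDerivAt f (f (φ (γ t)) •
      delReal (fun w => Real.log (metricMatrix g φ w).det.re) (φ (γ t))) (φ (γ t))) :
    (frameMatrix φ fun i => V i b).det * f (φ (γ b)) =
      (frameMatrix φ fun i => V i a).det * f (φ (γ a)) := by
  choose S hS using fun i => (hV i).exists_hasDerivAt (hVγ i)
  obtain ⟨S', hS'⟩ := hγ.exists_contMDiffAt
  have hsub : Icc a b ⊆ Icc 0 1 := Icc_subset_Icc ha hb
  refine eq_of_hasDerivAt_zero_off_finite
    (h := fun t => (frameMatrix φ fun i => V i t).det * f (φ (γ t))) hab ?_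
    (Finset.univ.biUnion S ∪ S') fun t ht htS => ?_
  · refine ContinuousOn.mul ?_ fun t ht => ?_
    · have hX : ∀ i k, ContinuousOn (fun t => frameMatrix φ (fun i => V i t) i k) (Icc a b) :=
        fun i k => continuousOn_components hsub (hV i).1 (hVγ i) hφ hφγ k
      simp only [Matrix.det_apply']
      exact continuousOn_finsetSum _ fun σ _ => continuousOn_const.mul
        (continuousOn_finsetProd _ fun i _ => hX _ _)
    · exact (ContinuousAt.comp (f := fun t => φ (γ t)) (hf t ht).continuousAt
        ((φ.continuousAt (hφγ t ht)).comp hγc.continuousAt)).continuousWithinAt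
  · simp only [Finset.mem_union, Finset.mem_biUnion, Finset.mem_univ, true_and, not_or,
      not_exists] at htS
    have ht1 : t ∈ Ioo (0 : ℝ) 1 := ⟨ha.trans_lt ht.1, ht.2.trans_le hb⟩
    have ht2 := Ioo_subset_Icc_self ht
    have hx := hφγ t ht2
    have hc := (differentiableAt_chart_comp (hS' t ht1 htS.2) hφ hx).hasDerivAt
    set c' := deriv (fun τ => φ (γ τ)) t
    have h1 : HasDerivAt (fun τ => (frameMatrix φ fun i => V i τ).det)
        (-((chernConnectionMatrix g φ (φ (γ t)) c').trace *
          (frameMatrix φ fun i => V i t).det)) t :=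
      hasDerivAt_det_of_linear fun i k => hS i t ht1 (htS.1 i) φ hφ hx k
    have h2 : HasDerivAt (fun τ => f (φ (γ τ))) _ t := (hf t ht2).comp_hasDerivAt t hc
    refine (h1.mul h2).congr_deriv ?_
    rw [trace_connection g hφ (φ.map_source hx), _root_.smul_apply, smul_eq_mul]
    ring

/-- The restricted holonomy of a Ricci-flat metric preserves determinants: a parallel frame
multiplied by the local holomorphic factors is a flat section along the loop. -/
lemma det_eq_one_of_chernRicci_eq_zero {g : TangentHermitianMetric n M}
    (hg : ∀ x, chernRicci g x = 0) {x : M}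
    {P : TangentSpace 𝓘(ℂ, Cn n) x →ₗ[ℂ] TangentSpace 𝓘(ℂ, Cn n) x}
    (hP : P ∈ restrictedHolonomy g x) : LinearMap.det P = 1 := by
  obtain ⟨γ, hγ, hγh, hV⟩ := hP
  choose V hVp hVγ hV0 hV1 using fun i : Fin n => hV (EuclideanSpace.single i (1 : ℂ) : Cn n)
  have hγc : Continuous γ.extend := γ.continuous_extend
  have hca : ∀ y : M, chartAt (Cn n) y ∈ atlas (Cn n) M := chart_mem_atlas (Cn n)
  choose r f hr hrt hf using fun y : M => exists_flat_factor hg (hca y) (mem_chart_source (Cn n) y)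
  let U : M → Set M := fun y => (chartAt (Cn n) y).source ∩
    chartAt (Cn n) y ⁻¹' Metric.ball (chartAt (Cn n) y y) (r y)
  have hU : ∀ y, IsOpen (U y) := fun y =>
    (chartAt (Cn n) y).isOpen_inter_preimage Metric.isOpen_ball
  have hUmem : ∀ y, y ∈ U y := fun y => ⟨mem_chart_source (Cn n) y, Metric.mem_ball_self (hr y)⟩
  have hfd : ∀ y, ∀ z ∈ Metric.ball (chartAt (Cn n) y y) (r y), f y z ≠ 0 ∧
      Complex.normSq (f y z) = (metricMatrix g (chartAt (Cn n) y) z).det.re ∧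
      DifferentiableAt ℂ (f y) z := fun y z hz =>
    ⟨(hf y z hz).1, (hf y z hz).2.1, differentiableAt_of_hasFDerivAt_delReal (hf y z hz).2.2⟩
  let K : M → M → M → ℂ := fun i j y =>
    (canonicalCore n M).coordChange (achart (Cn n) j) (achart (Cn n) i) y 1
  have hK : ∀ i j y, K i j y = (fderiv ℂ (chartAt (Cn n) j ∘ (chartAt (Cn n) i).symm)
      (chartAt (Cn n) i y)).det := fun i j y => canonicalCore_coordChange _ _ _
  let R : M → M → M → ℂ := fun i j y =>
    K i j y * f j (chartAt (Cn n) j y) / f i (chartAt (Cn n) i y)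
  let c : M → unitInterval → ℂ := fun i t =>
    (frameMatrix (chartAt (Cn n) i) fun l => V l t).det * f i (chartAt (Cn n) i (γ t))
  have hext : ∀ t : unitInterval, γ.extend t = γ t := fun t => γ.extend_apply t.2
  have key := flat_section_eq U hU id hUmem R
    (fun i y hy => by
      have h1 : K i i y = 1 := (canonicalCore n M).coordChange_self (achart (Cn n) i) y hy.1 1
      simp only [R]
      rw [h1, one_mul, div_self (hf i _ hy.2).1])
    (fun i j k y hi hj hk => by
      have h1 : K j k y * K i j y = K i k y := lineCore_mul _ hk.1 hj.1 hi.1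
      have h2 := (hf i _ hi.2).1
      have h3 := (hf j _ hj.2).1
      simp only [R]
      rw [← h1]
      field_simp)
    (fun i j y hi hj => by
      have h1 := eventually_flat_transition_eq (hca i) (hca j) Metric.isOpen_ball
        Metric.isOpen_ball (hrt i) (hfd i) (hfd j) hi.1 hj.1 hi.2 hj.2
      filter_upwards [h1] with z hz
      simp only [R, hK]
      exact hz)
    γ hγh c
    (fun i j t hi hj => by
      have h1 := det_frameMatrix_transition (hca i) (hca j) (V := fun l => V l t)
        (fun l => (hVγ l t t.2).trans (hext t)) hi.1 hj.1
      have h2 := (hf i _ hi.2).1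
      simp only [c, R, hK]
      rw [h1]
      field_simp)
    (fun i t hi => by
      obtain ⟨δ, hδ, hball⟩ := Metric.isOpen_iff.1 ((hU i).preimage hγc) (t : ℝ) (by
        rw [mem_preimage, hext]; exact hi)
      filter_upwards [Metric.ball_mem_nhds t hδ] with s hs
      have hst : |(s : ℝ) - t| < δ := hs
      have hsub : ∀ a b : unitInterval, (a : ℝ) ≤ b → |(a : ℝ) - t| < δ → |(b : ℝ) - t| < δ →
          c i b = c i a := by
        intro a b hab ha hb
        have hI : ∀ τ ∈ Icc (a : ℝ) b, γ.extend τ ∈ U i := fun τ hτ => by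
          refine hball ?_
          rw [Metric.mem_ball, Real.dist_eq, abs_lt]
          rw [abs_lt] at ha hb
          exact ⟨by linarith [hτ.1], by linarith [hτ.2]⟩
        have h1 := det_frameMatrix_mul_eq hγc hγ hVp hVγ (hca i) (f := f i) a.2.1 hab b.2.2
          (fun τ hτ => (hI τ hτ).1) (fun τ hτ => (hf i _ (hI τ hτ).2).2.2)
        rwa [hext, hext] at h1
      rcases le_total (s : ℝ) t with h | h
      · exact (hsub s t h hst (by simpa using hδ)).symm
      · exact hsub t s h (by simpa using hδ) hst)
  -- compare the parallel frame at the end points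
  set φ := chartAt (Cn n) x
  have hx : x ∈ φ.source := mem_chart_source (Cn n) x
  let L₀ : Cn n →L[ℂ] Cn n := mfderiv 𝓘(ℂ, Cn n) 𝓘(ℂ, Cn n) φ x
  let L : Cn n →ₗ[ℂ] Cn n := L₀
  let P' : Cn n →ₗ[ℂ] Cn n := P
  have hL0 : LinearMap.det L ≠ 0 := by
    have hli : (frame φ (φ x) : Cn n →ₗ[ℂ] Cn n) ∘ₗ L = LinearMap.id := by
      ext1 v
      exact frame_components (hca x) (p := ⟨x, v⟩) hx
    intro h0
    have h1 := congrArg LinearMap.det hli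
    rw [LinearMap.det_comp, h0, mul_zero, LinearMap.det_id] at h1
    exact zero_ne_one h1
  have h0 : (frameMatrix φ fun l => V l (0 : unitInterval)) = Matrix.of fun i k : Fin n =>
      L (EuclideanSpace.single i (1 : ℂ)) k := by
    ext i k
    have h1 : V i ((0 : unitInterval) : ℝ) = _ := hV0 i
    rw [frameMatrix, Matrix.of_apply, h1]
    rfl
  have h1 : (frameMatrix φ fun l => V l (1 : unitInterval)) = Matrix.of fun i k : Fin n =>
      (L ∘ₗ P') (EuclideanSpace.single i (1 : ℂ)) k := by
    ext i k
    have h1 : V i ((1 : unitInterval) : ℝ) = _ := hV1 i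
    rw [frameMatrix, Matrix.of_apply, h1]
    rfl
  have h2 : (frameMatrix φ fun l => V l (1 : unitInterval)).det * f x (φ (γ 1)) =
      (frameMatrix φ fun l => V l (0 : unitInterval)).det * f x (φ (γ 0)) := key
  rw [h0, h1, det_of_apply_single, det_of_apply_single, LinearMap.det_comp, γ.source, γ.target] at h2
  have h3 := (hf x _ (hUmem x).2).1
  have h4 : LinearMap.det P' = 1 := by
    have h5 := mul_right_cancel₀ h3 h2
    exact mul_left_cancel₀ hL0 (h5.trans (mul_one _).symm)
  exact h4

lemma restrictedHolonomy_subset_of_chernRicci_eq_zero {g : TangentHermitianMetric n M}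
    (hg : ∀ x, chernRicci g x = 0) (x : M) : restrictedHolonomy g x ⊆ specialUnitary g x := by
  intro P hP
  refine ⟨fun v w => ?_, det_eq_one_of_chernRicci_eq_zero hg hP⟩
  obtain ⟨γ, hγ, -, hV'⟩ := hP
  obtain ⟨V, hV, hVγ, hV0, hV1⟩ := hV' w
  obtain ⟨W, hW, hWγ, hW0, hW1⟩ := hV' v
  have h1 := form_eq_of_isParallel γ.continuous_extend hγ hV hW hVγ hWγ
  rw [hV0, hV1, hW0, hW1] at h1
  have e0 : γ.extend 0 = x := γ.extend_zero
  have e1 : γ.extend 1 = x := γ.extend_one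
  exact (form_congr g e1 (P v) (P w)).symm.trans (h1.trans (form_congr g e0 v w))

end RicciFlatHolonomy

/-! ### Metrics with restricted holonomy in the special unitary group are Ricci-flat -/

section LinearODE

variable {n : ℕ}

/-- A linear differential equation `Φ' = -Φ A` for matrices has a solution on `[0, 1]`, if `A` is
small. -/
lemma exists_linear_ode {A : ℝ → Matrix (Fin n) (Fin n) ℂ} {δ : ℝ} (hδ : n * δ ≤ 1 / 2)
    (hA : ∀ j k, ContinuousOn (fun t => A t j k) (Icc 0 1))
    (hb : ∀ t ∈ Icc (0 : ℝ) 1, ∀ j k, ‖A t j k‖ ≤ δ) :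
    ∃ Φ : ℝ → Matrix (Fin n) (Fin n) ℂ, Φ 0 = 1 ∧ ∀ t ∈ Icc (0 : ℝ) 1, ∀ i k,
      HasDerivWithinAt (fun τ => Φ τ i k) (-(Φ t * A t) i k) (Icc 0 1) t := by
  let f : ℝ → (Fin n → Fin n → ℂ) → Fin n → Fin n → ℂ := fun t X i k => -∑ j, X i j * A t j k
  let x₀ : Fin n → Fin n → ℂ := (1 : Matrix (Fin n) (Fin n) ℂ)
  have hsub : ∀ t X Y, f t (X - Y) = f t X - f t Y := fun t X Y => by
    ext i k
    simp only [f, Pi.sub_apply, sub_mul, Finset.sum_sub_distrib]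
    ring
  have hle : ∀ t ∈ Icc (0 : ℝ) 1, ∀ X, ‖f t X‖ ≤ 1 / 2 * ‖X‖ := by
    intro t ht X
    have h0 : 0 ≤ 1 / 2 * ‖X‖ := by positivity
    refine (pi_norm_le_iff_of_nonneg h0).2 fun i => (pi_norm_le_iff_of_nonneg h0).2 fun k => ?_
    simp only [f, norm_neg]
    calc ‖∑ j, X i j * A t j k‖ ≤ ∑ _j : Fin n, ‖X‖ * δ := by
          refine norm_sum_le_of_le _ fun j _ => ?_
          rw [norm_mul]
          exact mul_le_mul ((norm_le_pi_norm (X i) j).trans (norm_le_pi_norm X i)) (hb t ht j k)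
            (norm_nonneg _) (norm_nonneg _)
      _ = (n * δ) * ‖X‖ := by simp; ring
      _ ≤ 1 / 2 * ‖X‖ := by gcongr
  have hPL : IsPicardLindelof f (⟨0, by simp⟩ : Icc (0 : ℝ) 1) x₀ ‖x₀‖₊ 0 ‖x₀‖₊ (1 / 2) := by
    refine ⟨fun t ht => ?_, fun X _ => ?_, fun t ht X hX => ?_, ?_⟩
    · refine LipschitzOnWith.of_dist_le_mul fun X _ Y _ => ?_
      rw [dist_eq_norm, dist_eq_norm, ← hsub]
      simpa using hle t ht (X - Y)
    · exact continuousOn_pi.2 fun i => continuousOn_pi.2 fun k =>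
        (continuousOn_finsetSum _ fun j _ => continuousOn_const.mul (hA j k)).neg
    · have h1 : ‖X‖ ≤ ‖x₀‖ + ‖x₀‖ := by
        have h2 := norm_le_norm_add_norm_sub' X x₀
        rw [mem_closedBall_iff_norm] at hX
        exact h2.trans (by simpa using hX)
      have h3 := hle t ht X
      simp only [coe_nnnorm]
      linarith
    · simp
  obtain ⟨Φ, h0, hΦ⟩ := hPL.exists_eq_forall_mem_Icc_hasDerivWithinAt (x := x₀) (by simp)
  refine ⟨Φ, h0, fun t ht i k => ?_⟩
  have h1 := hasDerivWithinAt_pi.1 (hasDerivWithinAt_pi.1 (hΦ t ht) i) k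
  exact h1

/-- The linear map `u ↦ (∑ᵢ uᵢ Xᵢₖ)ₖ` of row vectors. -/
def rowMap (X : Matrix (Fin n) (Fin n) ℂ) : Cn n →ₗ[ℂ] Cn n where
  toFun u := WithLp.toLp 2 fun k => ∑ i, u i * X i k
  map_add' u v := by ext k; simp [add_mul, Finset.sum_add_distrib]
  map_smul' r u := by ext k; simp [mul_assoc, Finset.mul_sum]

lemma rowMap_apply (X : Matrix (Fin n) (Fin n) ℂ) (u : Cn n) (k : Fin n) :
    rowMap X u k = ∑ i, u i * X i k := rfl

lemma det_rowMap (X : Matrix (Fin n) (Fin n) ℂ) : LinearMap.det (rowMap X) = X.det := by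
  rw [← det_of_apply_single]
  congr 1
  ext i k
  simp [rowMap_apply]

end LinearODE

section HolonomyRicciFlat

variable {n : ℕ} {M : Type*} [TopologicalSpace M] [ChartedSpace (Cn n) M]
  [IsManifold 𝓘(ℂ, Cn n) ω M] {φ ψ : OpenPartialHomeomorph M (Cn n)}

/-- A loop in a simply connected space is mapped to a null-homotopic loop. -/
lemma exists_nullhomotopic_loop {X Y : Type*} [TopologicalSpace X] [TopologicalSpace Y]
    [SimplyConnectedSpace X] {f : X → Y} (hf : Continuous f) {b : X} {y : Y} (hb : f b = y)
    (p : Path b b) : ∃ γ : Path y y, (∀ t, γ t = f (p t)) ∧ γ.Homotopic (Path.refl y) := by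
  subst hb
  refine ⟨p.map hf, fun t => rfl, ?_⟩
  have h := (SimplyConnectedSpace.paths_homotopic p (Path.refl b)).map ⟨f, hf⟩
  exact h

/-- A vector field along a curve that solves the equation of parallel transport in one chart solves
it in every chart. -/
lemma hasDerivAt_components_transition (g : TangentHermitianMetric n M) (hφ : φ ∈ atlas (Cn n) M)
    (hψ : ψ ∈ atlas (Cn n) M) {c : ℝ → Cn n} {a : Cn n} {t : ℝ} (hc : HasDerivAt c a t)
    {V : ℝ → TangentBundle 𝓘(ℂ, Cn n) M} (hz : c t ∈ φ.target)
    (hV : ∀ᶠ τ in 𝓝 t, (V τ).1 = φ.symm (c τ)) (hx : (V t).1 ∈ ψ.source)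
    (hu : ∀ k, HasDerivAt (fun τ => components φ (V τ) k)
      (-∑ j, components φ (V t) j * chernConnectionMatrix g φ (c t) a j k) t) (k : Fin n) :
    HasDerivAt (fun τ => components ψ (V τ) k) (-∑ j, components ψ (V t) j *
      chernConnectionMatrix g ψ (ψ (V t).1) (deriv (fun τ => ψ (V τ).1) t) j k) t := by
  set T : Cn n → Cn n := ψ ∘ φ.symm with hT
  have hVt := hV.self_of_nhds
  have hz' : φ.symm (c t) ∈ ψ.source := hVt ▸ hx
  have hTd : ContDiffAt ℂ ω T (c t) := contDiffAt_transition hφ hψ hz hz'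
  have hderiv : deriv (fun τ => ψ (V τ).1) t = fderiv ℂ T (c t) a := by
    have h1 : (fun τ => ψ (V τ).1) =ᶠ[𝓝 t] fun τ => T (c τ) := by
      filter_upwards [hV] with τ hτ
      rw [hτ]; rfl
    rw [h1.deriv_eq]
    exact (((hTd.differentiableAt (by simp)).hasFDerivAt.restrictScalars ℝ).comp_hasDerivAt t
      hc).deriv
  have hJ : ∀ j, HasDerivAt (fun τ => jac T (c τ) j k) (delMatrix (jac T) (c t) a j k) t := by
    intro j
    have h1 : DifferentiableAt ℂ (fun w => jac T w j k) (c t) :=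
      (contDiffAt_jac hTd j k).differentiableAt (by simp)
    have h2 := (h1.hasFDerivAt.restrictScalars ℝ).comp_hasDerivAt t hc
    refine h2.congr_deriv ?_
    exact (del_holomorphic h1 a).symm
  have hev : (fun τ => components ψ (V τ) k) =ᶠ[𝓝 t]
      fun τ => ∑ j, components φ (V τ) j * jac T (c τ) j k := by
    have h1 : ∀ᶠ τ in 𝓝 t, c τ ∈ φ.target ∩ φ.symm ⁻¹' ψ.source :=
      hc.continuousAt ((φ.isOpen_inter_preimage_symm ψ.open_source).mem_nhds ⟨hz, hz'⟩)
    filter_upwards [hV, h1] with τ hτ hτ'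
    rw [components_transition_apply hφ hψ (by rw [hτ]; exact φ.map_target hτ'.1)
      (by rw [hτ]; exact hτ'.2), hτ, φ.right_inv hτ'.1]
  have hcomp : ∀ k, components ψ (V t) k = ∑ j, components φ (V t) j * jac T (c t) j k := by
    intro k
    rw [components_transition_apply hφ hψ (by rw [hVt]; exact φ.map_target hz) hx, hVt,
      φ.right_inv hz]
  refine HasDerivAt.congr_of_eventuallyEq ?_ hev
  have h1 := HasDerivAt.fun_sum (u := Finset.univ) fun j _ => (hu j).mul (hJ j)
  refine h1.congr_deriv ?_
  have key := connection_transition g hφ hψ hz hz' a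
  rw [hderiv]
  have hψt : ψ (V t).1 = ψ (φ.symm (c t)) := by rw [hVt]
  rw [hψt]
  simp only [hcomp]
  set B := chernConnectionMatrix g ψ (ψ (φ.symm (c t))) (fderiv ℂ T (c t) a)
  set u := components φ (V t)
  have e1 : ∑ l, (∑ j, u j * jac T (c t) j l) * B l k = ∑ j, u j * (jac T (c t) * B) j k := by
    simp only [Matrix.mul_apply, Finset.sum_mul, Finset.mul_sum]
    rw [Finset.sum_comm]
    simp only [mul_assoc]
  have e2 : ∑ j, (∑ l, u l * chernConnectionMatrix g φ (c t) a l j) * jac T (c t) j k =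
      ∑ l, u l * (chernConnectionMatrix g φ (c t) a * jac T (c t)) l k := by
    simp only [Matrix.mul_apply, Finset.sum_mul, Finset.mul_sum]
    rw [Finset.sum_comm]
    simp only [mul_assoc]
  have e3 : jac T (c t) * B = chernConnectionMatrix g φ (c t) a * jac T (c t) -
      delMatrix (jac T) (c t) a := by
    rw [key]; abel
  rw [e1, e3, Finset.sum_add_distrib]
  simp only [neg_mul, Finset.sum_neg_distrib, e2, Matrix.sub_apply, mul_sub, Finset.sum_sub_distrib]
  ring

/-- If the restricted holonomy at `x` preserves determinants, then so does the parallel transport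
along a loop in a coordinate ball around `x`. -/
lemma det_eq_one_of_loop {g : TangentHermitianMetric n M} {x : M}
    (hol : restrictedHolonomy g x ⊆ specialUnitary g x) (hφ : φ ∈ atlas (Cn n) M)
    (hx : x ∈ φ.source) {R : ℝ} (hR : Metric.ball (φ x) R ⊆ φ.target) {c : ℝ → Cn n}
    (hc : ContDiff ℝ ∞ c) (hcb : ∀ t, c t ∈ Metric.ball (φ x) R) (hc0 : c 0 = φ x)
    (hc1 : c 1 = φ x) {Φ : ℝ → Matrix (Fin n) (Fin n) ℂ} (hΦ0 : Φ 0 = 1)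
    (hΦ : ∀ t ∈ Icc (0 : ℝ) 1, ∀ i k, HasDerivWithinAt (fun τ => Φ τ i k)
      (-(Φ t * chernConnectionMatrix g φ (c t) (deriv c t)) i k) (Icc 0 1) t) :
    (Φ 1).det = 1 := by
  have := isManifold_real (n := n) (M := M)
  let e : Trivialization (Cn n) (π (Cn n) (TangentSpace 𝓘(ℂ, Cn n) : M → Type _)) :=
    (tangentBundleCore 𝓘(ℂ, Cn n) M).localTriv ⟨φ, hφ⟩
  have htgt : ∀ t, c t ∈ φ.target := fun t => hR (hcb t)
  have hsrc : ∀ t, φ.symm (c t) ∈ e.baseSet := fun t => φ.map_target (htgt t)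
  -- the loop in `M` and its homotopy
  have hpos : 0 < R := Metric.nonempty_ball.1 ⟨_, hcb 0⟩
  have hcontr : ContractibleSpace (Metric.ball (φ x) R) :=
    (convex_ball (φ x) R).contractibleSpace ⟨_, hcb 0⟩
  let b : Metric.ball (φ x) R := ⟨φ x, Metric.mem_ball_self hpos⟩
  let p : Path b b :=
    { toFun := fun t => ⟨c t, hcb t⟩
      continuous_toFun := by
        exact (hc.continuous.comp continuous_subtype_val).subtype_mk _
      source' := Subtype.ext hc0
      target' := Subtype.ext hc1 }
  obtain ⟨γ, hγ, hγh⟩ := exists_nullhomotopic_loop (f := fun z : Metric.ball (φ x) R => φ.symm z)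
    (φ.continuousOn_symm.comp_continuous continuous_subtype_val fun z => hR z.2) (b := b)
    (φ.left_inv hx) p
  have hγe : ∀ t ∈ Icc (0 : ℝ) 1, γ.extend t = φ.symm (c t) := fun t ht =>
    (γ.extend_apply ht).trans (hγ ⟨t, ht⟩)
  have hγs : IsPiecewiseSmooth n γ.extend := by
    refine ⟨1, ![0, 1], ?_, rfl, rfl, fun i => ?_⟩
    · refine Fin.monotone_iff_le_succ.2 fun i => ?_
      fin_cases i
      simp
    · have h1 : ContMDiff 𝓘(ℝ, ℝ) 𝓘(ℝ, Cn n) ∞ fun t => φ.symm (c t) := fun t =>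
        ((contMDiffOn_symm_of_mem_maximalAtlas (IsManifold.subset_maximalAtlas hφ)).contMDiffAt
          (φ.open_target.mem_nhds (htgt t))).comp t hc.contMDiff.contMDiffAt
      fin_cases i
      exact h1.contMDiffOn.congr hγe
  -- parallel transport along the loop
  let L : Cn n →L[ℂ] Cn n := mfderiv 𝓘(ℂ, Cn n) 𝓘(ℂ, Cn n) φ x
  have hFL : ∀ v, frame φ (φ x) (L v) = v := fun v =>
    frame_components hφ (p := (⟨x, v⟩ : TangentBundle 𝓘(ℂ, Cn n) M)) hx
  have hFL' : (frame φ (φ x) : Cn n →ₗ[ℂ] Cn n) * (L : Cn n →ₗ[ℂ] Cn n) = 1 :=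
    LinearMap.ext hFL
  have hLF : ∀ v, L (frame φ (φ x) v) = v := fun v =>
    LinearMap.congr_fun (mul_eq_one_comm.1 hFL') v
  let P : Cn n →ₗ[ℂ] Cn n := (frame φ (φ x) : Cn n →ₗ[ℂ] Cn n) * rowMap (Φ 1) * L
  have hdet : LinearMap.det P = (Φ 1).det := by
    have h1 := congrArg LinearMap.det hFL'
    rw [map_mul, map_one] at h1
    rw [map_mul, map_mul, det_rowMap, mul_right_comm, h1, one_mul]
  have hep : ∀ v : Cn n, e.toOpenPartialHomeomorph.symm (x, L v) =
      (⟨x, v⟩ : TangentBundle 𝓘(ℂ, Cn n) M) := by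
    intro v
    have h1 : e (⟨x, v⟩ : TangentBundle 𝓘(ℂ, Cn n) M) = (x, L v) :=
      Prod.ext rfl (localTriv_snd_eq_components hφ hx)
    rw [← h1]
    exact e.toOpenPartialHomeomorph.left_inv (e.mem_source.2 hx)
  have hP : P ∈ restrictedHolonomy g x := by
    refine ⟨γ, hγs, hγh, fun v => ?_⟩
    let u : ℝ → Cn n := fun t => rowMap (Φ t) (L v)
    let V : ℝ → TangentBundle 𝓘(ℂ, Cn n) M := fun t =>
      e.toOpenPartialHomeomorph.symm (φ.symm (c t), u t)
    have hV1 : ∀ t, (V t).1 = φ.symm (c t) := fun t => e.proj_symm_apply' (hsrc t)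
    have hVc : ∀ t, components φ (V t) = u t := fun t => by
      rw [← localTriv_snd_eq_components hφ (by rw [hV1]; exact hsrc t)]
      exact congrArg Prod.snd (e.apply_symm_apply' (hsrc t))
    have hu : ∀ t ∈ Icc (0 : ℝ) 1, ∀ k, HasDerivWithinAt (fun τ => u τ k)
        (-∑ j, u t j * chernConnectionMatrix g φ (c t) (deriv c t) j k) (Icc 0 1) t := by
      intro t ht k
      have h1 := HasDerivWithinAt.fun_sum (u := Finset.univ) fun i _ =>
        (hΦ t ht i k).const_mul (L v i)
      refine h1.congr_deriv ?_
      simp only [u, rowMap_apply, Matrix.mul_apply, Finset.sum_mul, mul_neg,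
        Finset.sum_neg_distrib, Finset.mul_sum]
      rw [Finset.sum_comm]
      simp only [mul_assoc]
    refine ⟨V, ⟨?_, ∅, fun t ht _ ψ hψ hxψ k => ?_⟩, fun t ht => (hV1 t).trans (hγe t ht).symm,
      ?_, ?_⟩
    · have h1 : ContinuousOn u (Icc 0 1) := by
        refine (PiLp.continuous_toLp 2 _).comp_continuousOn (f := fun t k => u t k) ?_
        exact continuousOn_pi.2 fun k t ht => (hu t ht k).continuousWithinAt
      have h2 : ContinuousOn (fun t => φ.symm (c t)) (Icc 0 1) :=
        φ.continuousOn_symm.comp hc.continuous.continuousOn fun t _ => htgt t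
      exact e.toOpenPartialHomeomorph.continuousOn_symm.comp (h2.prodMk h1)
        fun t _ => e.mem_target.2 (hsrc t)
    · refine hasDerivAt_components_transition g hφ hψ (hc.differentiable (by simp) t).hasDerivAt
        (htgt t) (Filter.Eventually.of_forall hV1) hxψ (fun k => ?_) k
      simp only [hVc]
      exact (hu t (Ioo_subset_Icc_self ht) k).hasDerivAt (Icc_mem_nhds ht.1 ht.2)
    · have h1 : u 0 = L v := by
        ext k
        simp [u, rowMap_apply, hΦ0, Matrix.one_apply]
      simp only [V, h1, hc0, φ.left_inv hx]
      exact hep v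
    · have h1 : u 1 = L (P v) := (hLF _).symm
      simp only [V, h1, hc1, φ.left_inv hx]
      exact hep (P v)
  exact hdet.symm.trans (hol hP).2

end HolonomyRicciFlat

section SmallLoops

variable {E : Type*} [NormedAddCommGroup E] [NormedSpace ℝ E]

/-- The loop `t ↦ (cos 2πt - 1) a + (sin 2πt) b` at the origin. -/
def ellipse (a b : E) (t : ℝ) : E :=
  (Real.cos (2 * Real.pi * t) - 1) • a + Real.sin (2 * Real.pi * t) • b

/-- The velocity of `ellipse`. -/
def ellipseDeriv (a b : E) (t : ℝ) : E :=
  (-(2 * Real.pi) * Real.sin (2 * Real.pi * t)) • a +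
    (2 * Real.pi * Real.cos (2 * Real.pi * t)) • b

lemma hasDerivAt_cos_two_pi (t : ℝ) : HasDerivAt (fun t => Real.cos (2 * Real.pi * t))
    (-(2 * Real.pi) * Real.sin (2 * Real.pi * t)) t := by
  have h := ((hasDerivAt_id t).const_mul (2 * Real.pi)).cos
  refine h.congr_deriv ?_
  simp only [id]
  ring

lemma hasDerivAt_sin_two_pi (t : ℝ) : HasDerivAt (fun t => Real.sin (2 * Real.pi * t))
    (2 * Real.pi * Real.cos (2 * Real.pi * t)) t := by
  have h := ((hasDerivAt_id t).const_mul (2 * Real.pi)).sin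
  refine h.congr_deriv ?_
  simp only [id]
  ring

lemma hasDerivAt_ellipse (a b : E) (t : ℝ) :
    HasDerivAt (ellipse a b) (ellipseDeriv a b t) t :=
  (((hasDerivAt_cos_two_pi t).sub_const 1).smul_const a).add
    ((hasDerivAt_sin_two_pi t).smul_const b)

lemma contDiff_ellipse (a b : E) : ContDiff ℝ ∞ (ellipse a b) := by
  unfold ellipse
  fun_prop

lemma continuous_ellipseDeriv (a b : E) : Continuous (ellipseDeriv a b) := by
  unfold ellipseDeriv
  fun_prop

lemma norm_ellipse_le (a b : E) (t : ℝ) : ‖ellipse a b t‖ ≤ 2 * ‖a‖ + ‖b‖ := by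
  refine (norm_add_le _ _).trans ?_
  rw [norm_smul, norm_smul, Real.norm_eq_abs, Real.norm_eq_abs]
  have h1 : |Real.cos (2 * Real.pi * t) - 1| ≤ 2 := by
    rw [abs_le]
    constructor <;> linarith [Real.cos_le_one (2 * Real.pi * t), Real.neg_one_le_cos (2 * Real.pi * t)]
  have h2 := Real.abs_sin_le_one (2 * Real.pi * t)
  have h3 := mul_le_mul_of_nonneg_right h1 (norm_nonneg a)
  have h4 := mul_le_mul_of_nonneg_right h2 (norm_nonneg b)
  linarith

lemma norm_ellipseDeriv_le (a b : E) (t : ℝ) :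
    ‖ellipseDeriv a b t‖ ≤ 2 * Real.pi * (‖a‖ + ‖b‖) := by
  refine (norm_add_le _ _).trans ?_
  have hπ : 0 ≤ 2 * Real.pi := by positivity
  rw [norm_smul, norm_smul, norm_mul, norm_mul, norm_neg, Real.norm_of_nonneg hπ, mul_add]
  have h1 := Real.abs_cos_le_one (2 * Real.pi * t)
  have h2 := Real.abs_sin_le_one (2 * Real.pi * t)
  simp only [Real.norm_eq_abs, mul_assoc (2 * Real.pi)]
  gcongr
  · exact mul_le_of_le_one_left (norm_nonneg a) h2
  · exact mul_le_of_le_one_left (norm_nonneg b) h1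

/-- The integral of an affine 1-form along `ellipse`: only the antisymmetric part of the linear term
contributes, with the enclosed area. -/
lemma integral_ellipse (α₀ : E →L[ℝ] ℂ) (B : E →L[ℝ] E →L[ℝ] ℂ) (a b : E) (ε : ℝ) :
    ∫ t in (0 : ℝ)..1, (α₀ (ellipseDeriv a b t) + ε • B (ellipse a b t) (ellipseDeriv a b t)) =
      ε • Real.pi • (B a b - B b a) := by
  have hint : IntervalIntegrable (fun t => α₀ (ellipseDeriv a b t) +
      ε • B (ellipse a b t) (ellipseDeriv a b t)) MeasureTheory.volume 0 1 := by
    have h1 := continuous_ellipseDeriv a b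
    have h2 := (contDiff_ellipse a b).continuous
    exact Continuous.intervalIntegrable (by fun_prop) 0 1
  -- `S' = p q'` for the coefficients `p = cos 2πt - 1` and `q = sin 2πt`
  let p : ℝ → ℝ := fun t => Real.cos (2 * Real.pi * t) - 1
  let q : ℝ → ℝ := fun t => Real.sin (2 * Real.pi * t)
  let p' : ℝ → ℝ := fun t => -(2 * Real.pi) * Real.sin (2 * Real.pi * t)
  let q' : ℝ → ℝ := fun t => 2 * Real.pi * Real.cos (2 * Real.pi * t)
  let S : ℝ → ℝ := fun t => Real.pi * t + 2⁻¹ * (q t * Real.cos (2 * Real.pi * t)) - q t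
  have hp : ∀ t, HasDerivAt p (p' t) t := fun t => (hasDerivAt_cos_two_pi t).sub_const 1
  have hq : ∀ t, HasDerivAt q (q' t) t := hasDerivAt_sin_two_pi
  have hS : ∀ t, HasDerivAt S (p t * q' t) t := fun t => by
    have h1 := (((hasDerivAt_id t).const_mul Real.pi).add
      (((hq t).mul (hasDerivAt_cos_two_pi t)).const_mul 2⁻¹)).sub (hq t)
    refine h1.congr_deriv ?_
    simp only [p, q, q']
    linear_combination (-Real.pi) * Real.sin_sq_add_cos_sq (2 * Real.pi * t)
  rw [intervalIntegral.integral_eq_sub_of_hasDerivAt (f := fun t => α₀ (ellipse a b t) +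
    ε • ((2⁻¹ * (p t * p t)) • B a a + S t • B a b + (p t * q t - S t) • B b a +
      (2⁻¹ * (q t * q t)) • B b b)) (fun t _ => ?_) hint]
  · simp [p, q, S, ellipse]
    ring
  · have h1 := α₀.hasFDerivAt.comp_hasDerivAt t (hasDerivAt_ellipse a b t)
    have h2 := ((((((hp t).mul (hp t)).const_mul 2⁻¹).smul_const (B a a)).add
      ((hS t).smul_const (B a b))).add ((((hp t).mul (hq t)).sub (hS t)).smul_const (B b a))).add
      ((((hq t).mul (hq t)).const_mul 2⁻¹).smul_const (B b b))
    refine (h1.add (h2.const_smul ε)).congr_deriv ?_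
    have e1 : ellipse a b t = p t • a + q t • b := rfl
    have e2 : ellipseDeriv a b t = p' t • a + q' t • b := rfl
    rw [e1, e2]
    simp only [map_add, map_smul, _root_.add_apply, _root_.smul_apply, Complex.real_smul]
    push_cast
    ring

lemma eventually_mul_lt (K : ℝ) {δ : ℝ} (hδ : 0 < δ) : ∀ᶠ ε : ℝ in 𝓝[>] 0, ε * K < δ := by
  have h : Filter.Tendsto (fun ε : ℝ => ε * K) (𝓝 0) (𝓝 (0 * K)) :=
    (continuous_id.mul continuous_const).tendsto 0
  rw [zero_mul] at h
  exact (h.eventually (gt_mem_nhds hδ)).filter_mono nhdsWithin_le_nhds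

/-- A 1-form whose integrals along all small ellipses through `z` vanish is closed at `z`. -/
lemma fderiv_symm_of_integral_ellipse {α : E → E →L[ℝ] ℂ} {B : E →L[ℝ] E →L[ℝ] ℂ} {z : E}
    (hα : HasFDerivAt α B z) {U : Set E} (hU : U ∈ 𝓝 z) (hαc : ContinuousOn α U) (a b : E)
    (h : ∀ᶠ ε : ℝ in 𝓝[>] 0,
      ∫ t in (0 : ℝ)..1, α (z + ε • ellipse a b t) (ε • ellipseDeriv a b t) = 0) :
    B a b = B b a := by
  set H : ℝ := 2 * ‖a‖ + ‖b‖ with hH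
  set H' : ℝ := 2 * Real.pi * (‖a‖ + ‖b‖) with hH'
  have hH0 : 0 ≤ H := by positivity
  have hH0' : 0 ≤ H' := by positivity
  have key : ∀ η > 0, ‖Real.pi • (B a b - B b a)‖ ≤ η * (H * H') := by
    intro η hη
    have h1 : ∀ᶠ w in 𝓝 z, ‖α w - α z - B (w - z)‖ ≤ η * ‖w - z‖ := hα.isLittleO.def hη
    obtain ⟨δ, hδ, hball⟩ := Metric.nhds_basis_ball.mem_iff.1 (Filter.inter_mem hU h1)
    obtain ⟨ε, hε, hεH, hε0⟩ := (h.and ((eventually_mul_lt H hδ).and self_mem_nhdsWithin)).exists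
    replace hε0 : 0 < ε := hε0
    have hmem : ∀ t, z + ε • ellipse a b t ∈ Metric.ball z δ := fun t => by
      rw [mem_ball_iff_norm, add_sub_cancel_left, norm_smul, Real.norm_of_nonneg hε0.le]
      exact (mul_le_mul_of_nonneg_left (norm_ellipse_le a b t) hε0.le).trans_lt hεH
    have hcont : Continuous fun t => α (z + ε • ellipse a b t) (ellipseDeriv a b t) := by
      have h3 : Continuous fun t => α (z + ε • ellipse a b t) :=
        hαc.comp_continuous (continuous_const.add
          ((contDiff_ellipse a b).continuous.const_smul ε)) fun t => (hball (hmem t)).1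
      exact h3.clm_apply (continuous_ellipseDeriv a b)
    have hcont' : Continuous fun t => α z (ellipseDeriv a b t) +
        ε • B (ellipse a b t) (ellipseDeriv a b t) := by
      have h3 := continuous_ellipseDeriv a b
      have h4 := (contDiff_ellipse a b).continuous
      fun_prop
    have hzero : ∫ t in (0 : ℝ)..1, α (z + ε • ellipse a b t) (ellipseDeriv a b t) = 0 := by
      simp only [map_smul] at hε
      rw [intervalIntegral.integral_smul] at hε
      exact (smul_eq_zero.1 hε).resolve_left hε0.ne'
    have hdiff : ‖∫ t in (0 : ℝ)..1, (α (z + ε • ellipse a b t) (ellipseDeriv a b t) -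
        (α z (ellipseDeriv a b t) + ε • B (ellipse a b t) (ellipseDeriv a b t)))‖ ≤
        η * (ε * H) * H' * |1 - 0| := by
      refine intervalIntegral.norm_integral_le_of_norm_le_const fun t _ => ?_
      have h3 := (hball (hmem t)).2
      simp only [mem_ofPred_eq, add_sub_cancel_left] at h3
      have h4 : α (z + ε • ellipse a b t) (ellipseDeriv a b t) -
          (α z (ellipseDeriv a b t) + ε • B (ellipse a b t) (ellipseDeriv a b t)) =
          (α (z + ε • ellipse a b t) - α z - B (ε • ellipse a b t)) (ellipseDeriv a b t) := by
        simp only [map_smul, _root_.sub_apply, _root_.smul_apply]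
        ring
      rw [h4]
      refine (ContinuousLinearMap.le_opNorm _ _).trans ?_
      refine mul_le_mul (h3.trans ?_) (norm_ellipseDeriv_le a b t) (norm_nonneg _) (by positivity)
      rw [norm_smul, Real.norm_of_nonneg hε0.le]
      have := norm_ellipse_le a b t
      gcongr
    rw [intervalIntegral.integral_sub (hcont.intervalIntegrable 0 1)
      (hcont'.intervalIntegrable 0 1), hzero, integral_ellipse, zero_sub, norm_neg, norm_smul,
      Real.norm_of_nonneg hε0.le] at hdiff
    refine le_of_mul_le_mul_left (hdiff.trans_eq ?_) hε0
    simp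
    ring
  have hlim : ‖Real.pi • (B a b - B b a)‖ ≤ 0 := by
    refine le_of_forall_pos_le_add fun η hη => ?_
    have h1 := key (η / (H * H' + 1)) (by positivity)
    refine h1.trans ?_
    rw [zero_add, div_mul_eq_mul_div, div_le_iff₀ (by positivity)]
    nlinarith [mul_nonneg hH0 hH0']
  have h1 := norm_le_zero_iff.1 hlim
  exact sub_eq_zero.1 ((smul_eq_zero.1 h1).resolve_left Real.pi_ne_zero)

/-- A solution of `D' = -F D` is `exp (-∫ F)` up to a constant factor. -/
lemma exp_integral_mul_eq {D F : ℝ → ℂ} (hF : Continuous F) (hDc : ContinuousOn D (Icc 0 1))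
    (hD : ∀ t ∈ Ioo (0 : ℝ) 1, HasDerivAt D (-(F t * D t)) t) :
    Complex.exp (∫ t in (0 : ℝ)..1, F t) * D 1 = D 0 := by
  have hI : ∀ t, HasDerivAt (fun t => ∫ τ in (0 : ℝ)..t, F τ) (F t) t := fun t =>
    intervalIntegral.integral_hasDerivAt_right (hF.intervalIntegrable 0 t)
      (hF.stronglyMeasurableAtFilter _ _) hF.continuousAt
  have h1 := eq_of_hasDerivAt_zero_off_finite
    (h := fun t => Complex.exp (∫ τ in (0 : ℝ)..t, F τ) * D t) zero_le_one
    (ContinuousOn.mul (fun t _ => ((hI t).cexp.continuousAt).continuousWithinAt) hDc) ∅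
    fun t ht _ => ((hI t).cexp.mul (hD t ht)).congr_deriv (by ring)
  simpa using h1

end SmallLoops

section HolonomyRicciFlat

variable {n : ℕ} {M : Type*} [TopologicalSpace M] [ChartedSpace (Cn n) M]
  [IsManifold 𝓘(ℂ, Cn n) ω M] {φ : OpenPartialHomeomorph M (Cn n)}

lemma continuousOn_chernConnectionMatrix (g : TangentHermitianMetric n M)
    (hφ : φ ∈ atlas (Cn n) M) (j k : Fin n) :
    ContinuousOn (fun q : Cn n × Cn n => chernConnectionMatrix g φ q.1 q.2 j k)
      (φ.target ×ˢ univ) := by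
  have hfst : MapsTo Prod.fst (φ.target ×ˢ (univ : Set (Cn n))) φ.target := fun q hq => hq.1
  have hG : ContinuousOn (metricMatrix g φ) φ.target := continuousOn_pi.2 fun j =>
    continuousOn_pi.2 fun k => (contDiffOn_metricMatrix g hφ j k).continuousOn
  have hinv : ContinuousOn (fun z => (metricMatrix g φ z)⁻¹) φ.target := by
    simp only [Matrix.inv_def, Ring.inverse_eq_inv']
    have h1 : ContinuousOn (fun z => (metricMatrix g φ z).det) φ.target :=
      continuous_id.matrix_det.comp_continuousOn hG
    exact (h1.inv₀ fun z hz => (isUnit_det_metricMatrix g hφ hz).ne_zero).smul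
      (continuous_id.matrix_adjugate.comp_continuousOn hG)
  have hdel : ∀ l, ContinuousOn (fun q : Cn n × Cn n =>
      del (fun w => metricMatrix g φ w j l) q.1 q.2) (φ.target ×ˢ univ) := by
    intro l
    have h1 : ContinuousOn (fun q : Cn n × Cn n => fderiv ℝ (fun w => metricMatrix g φ w j l) q.1)
        (φ.target ×ˢ univ) :=
      ((contDiffOn_metricMatrix g hφ j l).continuousOn_fderiv_of_isOpen φ.open_target
        (by simp)).comp continuousOn_fst hfst
    exact continuousOn_const.mul ((h1.clm_apply continuousOn_snd).sub
      (continuousOn_const.mul (h1.clm_apply (continuousOn_snd.const_smul Complex.I))))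
  simp only [chernConnectionMatrix, Matrix.mul_apply, Matrix.of_apply]
  refine continuousOn_finsetSum _ fun l _ => (hdel l).mul ?_
  exact (continuous_apply_apply l k).comp_continuousOn (hinv.comp continuousOn_fst hfst)

lemma continuous_chernConnectionMatrix_along (g : TangentHermitianMetric n M)
    (hφ : φ ∈ atlas (Cn n) M) {c a : ℝ → Cn n} (hc : Continuous c) (ha : Continuous a)
    (hct : ∀ t, c t ∈ φ.target) (j k : Fin n) :
    Continuous fun t => chernConnectionMatrix g φ (c t) (a t) j k := by
  have h1 := continuousOn_chernConnectionMatrix g hφ j k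
  have h2 : Continuous fun t => (c t, a t) := hc.prodMk ha
  have h3 : ∀ t, (c t, a t) ∈ φ.target ×ˢ (univ : Set (Cn n)) := fun t =>
    mk_mem_prod (hct t) (mem_univ _)
  have h4 := ContinuousOn.comp_continuous h1 h2 h3
  exact h4

lemma chernConnectionMatrix_smul (g : TangentHermitianMetric n M) (z a : Cn n) (r : ℝ)
    (j k : Fin n) : chernConnectionMatrix g φ z (r • a) j k =
      r * chernConnectionMatrix g φ z a j k := by
  simp only [chernConnectionMatrix, Matrix.mul_apply, Matrix.of_apply, Finset.mul_sum]
  refine Finset.sum_congr rfl fun l _ => ?_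
  simp only [del, smul_comm Complex.I r a, map_smul, Complex.real_smul]
  ring

lemma exists_norm_chernConnectionMatrix_le (g : TangentHermitianMetric n M)
    (hφ : φ ∈ atlas (Cn n) M) {z : Cn n} {R : ℝ} (hR : Metric.closedBall z R ⊆ φ.target) (H : ℝ) :
    ∃ C : ℝ, 0 ≤ C ∧ ∀ w ∈ Metric.closedBall z R, ∀ a : Cn n, ‖a‖ ≤ H → ∀ j k,
      ‖chernConnectionMatrix g φ w a j k‖ ≤ C := by
  have hK : IsCompact (Metric.closedBall z R ×ˢ Metric.closedBall (0 : Cn n) H) :=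
    (isCompact_closedBall z R).prod (isCompact_closedBall 0 H)
  choose C hC using fun j k => hK.exists_bound_of_continuousOn
    ((continuousOn_chernConnectionMatrix g hφ j k).mono fun q hq => ⟨hR hq.1, trivial⟩)
  refine ⟨∑ j, ∑ k, |C j k|, by positivity, fun w hw a ha j k => ?_⟩
  refine (hC j k (w, a) ⟨hw, by simpa using ha⟩).trans ((le_abs_self _).trans ?_)
  exact (Finset.single_le_sum (f := fun k => |C j k|) (fun _ _ => abs_nonneg _)
    (Finset.mem_univ k)).trans (Finset.single_le_sum (f := fun j => ∑ k, |C j k|)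
      (fun _ _ => by positivity) (Finset.mem_univ j))

/-- The determinant of the parallel transport along a small loop `c` is `exp (-∫_c ∂ log det G)`. It
equals `1` by assumption, and then the integral vanishes because it is small. -/
lemma integral_delReal_eq_zero {g : TangentHermitianMetric n M} {x : M}
    (hol : restrictedHolonomy g x ⊆ specialUnitary g x) (hφ : φ ∈ atlas (Cn n) M)
    (hx : x ∈ φ.source) (a b : Cn n) : ∀ᶠ ε : ℝ in 𝓝[>] 0, ∫ t in (0 : ℝ)..1,
      delReal (fun w => Real.log (metricMatrix g φ w).det.re) (φ x + ε • ellipse a b t)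
        (ε • ellipseDeriv a b t) = 0 := by
  set u : Cn n → ℝ := fun w => Real.log (metricMatrix g φ w).det.re
  obtain ⟨R, hR, hRt⟩ := Metric.nhds_basis_closedBall.mem_iff.1
    (φ.open_target.mem_nhds (φ.map_source hx))
  set H : ℝ := 2 * ‖a‖ + ‖b‖ with hH
  obtain ⟨C, hC0, hC⟩ := exists_norm_chernConnectionMatrix_le g hφ hRt
    (2 * Real.pi * (‖a‖ + ‖b‖))
  have h1 := eventually_mul_lt H hR
  have h2 := eventually_mul_lt (n * C) (one_half_pos (α := ℝ))
  filter_upwards [h1, h2, self_mem_nhdsWithin] with ε hε1 hε2 hε0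
  replace hε0 : 0 < ε := hε0
  set c : ℝ → Cn n := fun t => φ x + ε • ellipse a b t with hc
  have hcd : ContDiff ℝ ∞ c := contDiff_const.add ((contDiff_ellipse a b).const_smul ε)
  have hc' : ∀ t, deriv c t = ε • ellipseDeriv a b t := fun t =>
    (((hasDerivAt_ellipse a b t).const_smul ε).const_add (φ x)).deriv
  have hcb : ∀ t, c t ∈ Metric.ball (φ x) R := fun t => by
    rw [mem_ball_iff_norm, hc, add_sub_cancel_left, norm_smul, Real.norm_of_nonneg hε0.le]
    exact (mul_le_mul_of_nonneg_left (norm_ellipse_le a b t) hε0.le).trans_lt hε1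
  have hct : ∀ t, c t ∈ φ.target := fun t => hRt (Metric.ball_subset_closedBall (hcb t))
  have hcont : ∀ j k, Continuous fun t => chernConnectionMatrix g φ (c t) (deriv c t) j k :=
    fun j k => continuous_chernConnectionMatrix_along g hφ hcd.continuous
      (hcd.continuous_deriv (by simp)) hct j k
  have hbound : ∀ t j k, ‖chernConnectionMatrix g φ (c t) (deriv c t) j k‖ ≤ ε * C := by
    intro t j k
    rw [hc', chernConnectionMatrix_smul, norm_mul, Complex.norm_of_nonneg hε0.le]
    gcongr
    exact hC _ (Metric.ball_subset_closedBall (hcb t)) _ (norm_ellipseDeriv_le a b t) j k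
  obtain ⟨Φ, hΦ0, hΦ⟩ := exists_linear_ode
    (A := fun t => chernConnectionMatrix g φ (c t) (deriv c t)) (δ := ε * C)
    (by linarith [mul_left_comm ε (n : ℝ) C]) (fun j k => (hcont j k).continuousOn)
    fun t _ => hbound t
  have hdet := det_eq_one_of_loop hol hφ hx (Metric.ball_subset_closedBall.trans hRt) hcd hcb
    (by simp [hc, ellipse]) (by simp [hc, ellipse]) hΦ0 hΦ
  let F : ℝ → ℂ := fun t => (chernConnectionMatrix g φ (c t) (deriv c t)).trace
  have hF : Continuous F := by
    simp only [F, Matrix.trace, Matrix.diag]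
    exact continuous_finsetSum _ fun j _ => hcont j j
  have hFu : ∀ t, F t = delReal u (c t) (ε • ellipseDeriv a b t) := fun t => by
    rw [← hc']
    exact trace_connection g hφ (hct t) _
  have hFb : ∀ t, ‖F t‖ ≤ 1 / 2 := fun t => by
    simp only [F, Matrix.trace, Matrix.diag]
    refine (norm_sum_le_of_le Finset.univ fun j _ => hbound t j j).trans ?_
    simp only [Finset.sum_const, Finset.card_univ, Fintype.card_fin, nsmul_eq_mul]
    linarith [mul_left_comm ε (n : ℝ) C]
  have hexp := exp_integral_mul_eq (D := fun t => (Φ t).det) hF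
    (by
      simp only [Matrix.det_apply']
      exact continuousOn_finsetSum _ fun σ _ => continuousOn_const.mul
        (continuousOn_finsetProd _ fun i _ t ht => (hΦ t ht _ _).continuousWithinAt))
    fun t ht => hasDerivAt_det_of_linear fun i k =>
      (hΦ t (Ioo_subset_Icc_self ht) i k).hasDerivAt (Icc_mem_nhds ht.1 ht.2)
  simp only [hdet, hΦ0, Matrix.det_one, mul_one] at hexp
  have hI : ‖∫ t in (0 : ℝ)..1, F t‖ ≤ 1 / 2 := by
    simpa using intervalIntegral.norm_integral_le_of_norm_le_const (a := 0) (b := 1)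
      fun t _ => hFb t
  have him := abs_le.1 ((Complex.abs_im_le_norm _).trans hI)
  have hlog := Complex.log_exp (x := ∫ t in (0 : ℝ)..1, F t)
    (by linarith [him.1, Real.pi_gt_three]) (by linarith [him.2, Real.pi_gt_three])
  rw [hexp, Complex.log_one] at hlog
  exact (intervalIntegral.integral_congr fun t _ => (hFu t).symm).trans hlog.symm

lemma chernRicci_eq_zero_of_restrictedHolonomy_subset {g : TangentHermitianMetric n M} {x : M}
    (hol : restrictedHolonomy g x ⊆ specialUnitary g x) : chernRicci g x = 0 := by
  have hφ : chartAt (Cn n) x ∈ atlas (Cn n) M := chart_mem_atlas (Cn n) x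
  have hx : x ∈ (chartAt (Cn n) x).source := mem_chart_source (Cn n) x
  have hz := (chartAt (Cn n) x).map_source hx
  refine chernRicci_eq_zero_of_iddbarC
    ((fderiv_delReal_symm_iff (contDiffAt_log_det g hφ hz)).1 fun a b => ?_)
  have hα : ∀ z ∈ (chartAt (Cn n) x).target, ContDiffAt ℝ ∞ (delReal fun w =>
      Real.log (metricMatrix g (chartAt (Cn n) x) w).det.re) z := fun z hz =>
    contDiffAt_delReal (contDiffAt_log_det g hφ hz)
  exact fderiv_symm_of_integral_ellipse ((hα _ hz).differentiableAt (by simp)).hasFDerivAt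
    ((chartAt (Cn n) x).open_target.mem_nhds hz)
    (fun z hz => (hα z hz).continuousAt.continuousWithinAt) a b
    (integral_delReal_eq_zero hol hφ hx a b)

end HolonomyRicciFlat

end

end BottChern

theorem proposition1p1 (n : ℕ) (M : Type*) [TopologicalSpace M]
    [ChartedSpace (EuclideanSpace ℂ (Fin n)) M]
    [IsManifold 𝓘(ℂ, EuclideanSpace ℂ (Fin n)) ω M] [CompactSpace M] [T2Space M] :
    [ BottChern.manifoldBottChernClass n M = 0,
      ∃ g : BottChern.TangentHermitianMetric n M, ∀ x, BottChern.chernRicci g x = 0,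
      ∃ h : BottChern.HermitianMetric n ℂ (BottChern.CanonicalBundle n M),
        ∀ x, h.curvature x = 0,
      ∃ g : BottChern.TangentHermitianMetric n M,
        ∀ x, BottChern.restrictedHolonomy g x ⊆ BottChern.specialUnitary g x ].TFAE ∧
    ((∃ l : ℕ, 1 ≤ l ∧ BottChern.HolomorphicallyIsomorphic n
        (BottChern.CanonicalPower n M l) (Bundle.Trivial M ℂ)) →
      BottChern.manifoldBottChernClass n M = 0) := by
  have h23 : (∃ g : BottChern.TangentHermitianMetric n M, ∀ x, BottChern.chernRicci g x = 0) →
      ∃ h : BottChern.HermitianMetric n ℂ (BottChern.CanonicalBundle n M),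
        ∀ x, h.curvature x = 0 := by
    rintro ⟨g, hg⟩
    refine ⟨_, fun x => (BottChern.curvature_canonical g x).trans ?_⟩
    rw [hg x, neg_zero]
  refine ⟨?_, ?_⟩
  · tfae_have 1 → 2 := BottChern.exists_chernRicci_eq_zero
    tfae_have 2 → 3 := h23
    tfae_have 3 → 1 := fun ⟨h, hh⟩ => BottChern.manifoldBottChernClass_eq_zero h hh
    tfae_have 2 → 4 := fun ⟨g, hg⟩ =>
      ⟨g, BottChern.restrictedHolonomy_subset_of_chernRicci_eq_zero hg⟩
    tfae_have 4 → 2 := fun ⟨g, hg⟩ =>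
      ⟨g, fun x => BottChern.chernRicci_eq_zero_of_restrictedHolonomy_subset (hg x)⟩
    tfae_finish
  · rintro ⟨l, hl, h⟩
    obtain ⟨k, hk⟩ := BottChern.exists_flat_metric_of_torsion (BottChern.canonicalCore n M) hl h
    exact BottChern.manifoldBottChernClass_eq_zero k hk
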